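/- **Model.** Let $Z\in\mathbb R^r$ have finite second moment. For $\theta_1\in\mathbb R^{p_1}$ the stage-1 model is the linear structural equation model $$\xi=\tilde\alpha+\tilde B\xi+\tilde\Gamma Z+\tilde\zeta,\qquad X=\tilde\nu+\tilde\Lambda\xi+\tilde KZ+\tilde\epsilon ,$$ whose matrices (with $I-\tilde B$ invertible) and residual laws depend on $\theta_1$; $\theta_{01}$ is the true value. The outcome satisfies $$\eta=\alpha+B\varphi(\xi)+\Gamma Z+\zeta,\qquad Y=\nu+\Lambda\eta+KZ+\epsilon ,$$ with $\varphi(\xi)$ of finite variance and $\zeta,\epsilon$ centred with covariances $\Psi,\Omega$; $Z,\tilde\zeta,\tilde\epsilon,\zeta,\epsilon$ are independent. The observations $O_i=(Y_i,X_i,Z_i)$, $i=1,2,\dots$, are i.i.d. from this model (with $\theta_1=\theta_{01}$). Let $\varphi^*(x,z;\theta_1)=E_{\theta_1}[\varphi(\xi)\mid X=x,Z=z]$. **Stage 2.** Let $U_2(\theta_2;y,z,v)$, $\theta_2\in\mathbb R^{p_2}$, be the Gaussian score of the linear structural equation model $\eta=\alpha+Bv+\Gamma Z+\zeta$, $Y=\nu+\Lambda\eta+KZ+\epsilon$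 with observed covariates $z,v$, all parameters being functions of $\theta_2$ that are differentiable near $\theta_{02}$. Here $\theta_{02}$ is the limiting value, which gives the true values of $\alpha,B,\Gamma,\nu,\Lambda,K,\Omega$, while $\Psi$ is replaced by $\Psi+B\operatorname{Var}[\varphi(\xi)-\varphi^*(X,Z;\theta_{01})]B^T$; the implied variance $\Lambda\Psi\Lambda^T+\Omega$ of $Y$ at $\theta_{02}$ is positive definite. Put $U(\theta_1,\theta_2;O)=U_2(\theta_2;Y,Z,\varphi^*(X,Z;\theta_1))$. Assume * $U(\theta_{01},\theta_{02};O)$ is square integrable; * on an open neighbourhood of $(\theta_{01},\theta_{02})$, almost surely $U$ is twice continuously differentiable in $(\theta_1,\theta_2)$, $\nabla U$ (the full derivative) is integrable and $n^{-1}\sum_{i\le n}\nabla U(\theta_1,\theta_2;O_i)$ converges to $E\nabla U(\theta_1,\theta_2;O)$ uniformly, in probability; * $A:=E[-\nabla_{\theta_2}U(\theta_{01},\theta_{02};O)]$ is positive definite. **(1) General stage 1.** Let $\hat\theta_1$ be an asymptotically linear estimator, $$\sqrt n(\hat\theta_1-\theta_{01})=n^{-1/2}\sum_{i\le n}IF_1(X_i,Z_i)+o_p(1),$$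 where $IF_1$ is centred and square integrable. Then for some $\rho>0$ the equation $\sum_{i\le n}U(\hat\theta_1,\theta_2;O_i)=0$ has, with probability tending to one, exactly one root $\theta_2$ with $|\theta_2-\theta_{02}|\le\rho$. Let $\hat\theta_2=\hat\theta_2(\hat\theta_1)$ be any sequence which is such a root with probability tending to one (every consistent sequence of roots is one). Then $\hat\theta_2$ is consistent for $\theta_{02}$, and $$\sqrt n(\hat\theta_2-\theta_{02})=n^{-1/2}\sum_{i\le n}IF_3(O_i)+o_p(1),$$ $$IF_3=IF_2+A^{-1}E[\nabla_{\theta_1}U]\,IF_1,\qquad IF_2=A^{-1}U,$$ with all quantities evaluated at $(\theta_{01},\theta_{02})$. The function $IF_3$ is centred and square integrable and, if $\hat\theta_2$ is measurable, $\sqrt n(\hat\theta_2-\theta_{02})\to N(0,\Sigma)$ in distribution with $\Sigma=E[IF_3IF_3^T]$. Suppose moreover that $IF_1(x,z)=IF_1(x,z;\theta_{01})$ for a family $IF_1(x,z;\theta_1)$ which, for $\theta_1$ near $\theta_{01}$, is measurable in $(x,z)$, almost surely continuous in $\theta_1$, and dominated by a square-integrable function of $(X,Z)$. Then $\hat\Sigma=n^{-1}\sum_{i\le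 n}\widehat{IF}_3(O_i)\widehat{IF}_3(O_i)^T$ converges to $\Sigma$ in probability. Here $\widehat{IF}_3$ is $IF_3$ with $(\hat\theta_1,\hat\theta_2)$ plugged in and with the expected derivatives either kept as functions of the parameters or replaced by sample averages. **(2) Gaussian mixture stage 1.** Suppose that, near $\theta_{01}$, the stage-1 model is a $c$-class Gaussian mixture: in class $k$, which has probability $\pi_k$ and is independent of $Z$ and the other residuals, $\xi=\tilde\alpha_k+\tilde B\xi+\tilde\Gamma Z+\tilde\zeta_k$ with $\tilde\zeta_k\sim N(0,\tilde\Psi_k)$, and $\tilde\epsilon\sim N(0,\tilde\Omega)$, the variance of $X$ given $Z$ in each class being positive definite. Let $p(x\mid z;\theta_1)$ be the conditional density of $X$ and $S=\nabla_{\theta_1}\log p$. Assume the usual regularity conditions: on a neighbourhood of $\theta_{01}$, for almost all $(x,z)$ with respect to Lebesgue measure times the law $P_Z$ of $Z$, $p$ is three times continuously differentiable in $\theta_1$, with $|\nabla p|\le f_1$, $|\nabla^2p|\le f_2$, $|\nabla^3\log p|\le f_3$, where $f_1,f_2$ are integrable with respect to $dx\,P_Z(dz)$ and $E f_3(X,Z)<\infty$;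 and the Fisher information $I=E[SS^T]$ at $\theta_{01}$ exists and is positive definite. Then, with probability tending to one, the likelihood equation $\sum_{i\le n}S(\theta_1;X_i,Z_i)=0$ has exactly one root in some fixed closed ball around $\theta_{01}$. Any measurable sequence $\hat\theta_1$ which is such a root with probability tending to one is consistent and asymptotically linear with $IF_1=I^{-1}S(\theta_{01};\cdot)$, and $\sqrt n(\hat\theta_1-\theta_{01})$ is asymptotically normal with mean zero and variance $E[IF_1IF_1^T]$. All conclusions of (1), including consistency of $\hat\Sigma$, hold for the two-stage estimator based on $\hat\theta_1$, where $IF_1$ is now estimated by the inverse observed information matrix $\bigl(-n^{-1}\sum_{i\le n}\nabla S(\hat\theta_1;X_i,Z_i)\bigr)^{-1}$ times $S(\hat\theta_1;\cdot)$. -/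

import Mathlib

open MeasureTheory ProbabilityTheory Filter Topology
open scoped ENNReal Matrix RealInnerProductSpace

namespace TwoStage

noncomputable section

/-- Column vectors with the Euclidean norm. -/
abbrev Vec (n : ℕ) := EuclideanSpace ℝ (Fin n)

/-- Matrix times column vector. -/
abbrev mv {a b : ℕ} (A : Matrix (Fin a) (Fin b) ℝ) (v : Vec b) : Vec a :=
  Matrix.toEuclideanLin A v

/-- One observation `(Y, X, Z)`. -/
abbrev Obs (m h r : ℕ) := Vec m × Vec h × Vec r

/-- The density of the normal distribution `N(μ, S)` (for positive definite `S`). -/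
def mvnPDF {n : ℕ} (μ : Vec n) (S : Matrix (Fin n) (Fin n) ℝ) (x : Vec n) : ℝ :=
  (Real.sqrt ((2 * Real.pi) ^ n * S.det))⁻¹ * Real.exp (-⟪x - μ, mv S⁻¹ (x - μ)⟫ / 2)

/-! ### Stage 1: the linear structural equation model for `(ξ, X)` given `Z` -/

/-- The linear structural equation model
`ξ = α + B ξ + Γ Z + ζ`, `X = ν + Λ ξ + K Z + ε`, where `ζ` has law `lawζ` and `ε` has law
`lawε`. -/
structure Stage1Model (q h r : ℕ) where
  α : Vec q
  B : Matrix (Fin q) (Fin q) ℝ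
  Γ : Matrix (Fin q) (Fin r) ℝ
  ν : Vec h
  Λ : Matrix (Fin h) (Fin q) ℝ
  K : Matrix (Fin h) (Fin r) ℝ
  lawζ : Measure (Vec q)
  lawε : Measure (Vec h)

namespace Stage1Model

variable {q h r l : ℕ}

/-- The residual laws are probability measures and the structural equation determines `ξ`. -/
def Valid (M : Stage1Model q h r) : Prop :=
  IsProbabilityMeasure M.lawζ ∧ IsProbabilityMeasure M.lawε ∧ IsUnit (1 - M.B).det

/-- The solution `ξ` of `ξ = α + B ξ + Γ z + e`. -/
def latent (M : Stage1Model q h r) (z : Vec r) (e : Vec q) : Vec q :=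
  mv (1 - M.B)⁻¹ (M.α + mv M.Γ z + e)

/-- The indicators `x = ν + Λ ξ + K z + e`. -/
def indicator (M : Stage1Model q h r) (z : Vec r) (ξ : Vec q) (e : Vec h) : Vec h :=
  M.ν + mv M.Λ ξ + mv M.K z + e

/-- The joint law of `(ξ, X, Z)` when `Z` has law `PZ` and `Z`, `ζ`, `ε` are independent. -/
def law (M : Stage1Model q h r) (PZ : Measure (Vec r)) : Measure (Vec q × Vec h × Vec r) :=
  (PZ.prod (M.lawζ.prod M.lawε)).map fun w =>
    (M.latent w.1 w.2.1, M.indicator w.1 (M.latent w.1 w.2.1) w.2.2, w.1)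

/-- The law of `(X, Z)`. -/
def lawXZ (M : Stage1Model q h r) (PZ : Measure (Vec r)) : Measure (Vec h × Vec r) :=
  (M.law PZ).map Prod.snd

/-- `f` is a version of the prediction `(x, z) ↦ E[φ(ξ) | X = x, Z = z]` under the model `M`. -/
def IsPrediction (M : Stage1Model q h r) (PZ : Measure (Vec r)) (φ : Vec q → Vec l)
    (f : Vec h × Vec r → Vec l) : Prop :=
  Integrable (fun w => φ w.1) (M.law PZ) ∧ Measurable f ∧
    (fun w => f w.2) =ᵐ[M.law PZ]
      (M.law PZ)[fun w => φ w.1 | MeasurableSpace.comap Prod.snd inferInstance]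

/-- The matrix `Var(φ(ξ) - f(X, Z))` for a prediction `f` of `φ(ξ)`. -/
def predVar (M : Stage1Model q h r) (PZ : Measure (Vec r)) (φ : Vec q → Vec l)
    (f : Vec h × Vec r → Vec l) : Matrix (Fin l) (Fin l) ℝ :=
  Matrix.of fun j k => ∫ w, (φ w.1 - f w.2) j * (φ w.1 - f w.2) k ∂(M.law PZ)

end Stage1Model

/-! ### Stage 2: the model for `Y` -/

/-- Parameters of `η = α + B φ + Γ Z + ζ`, `Y = ν + Λ η + K Z + ε`, `Var ζ = Ψ`, `Var ε = Ω`. -/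
structure Stage2Param (m p l r : ℕ) where
  α : Vec p
  B : Matrix (Fin p) (Fin l) ℝ
  Γ : Matrix (Fin p) (Fin r) ℝ
  ν : Vec m
  Λ : Matrix (Fin m) (Fin p) ℝ
  K : Matrix (Fin m) (Fin r) ℝ
  Ψ : Matrix (Fin p) (Fin p) ℝ
  Ω : Matrix (Fin m) (Fin m) ℝ

namespace Stage2Param

variable {m p l r q h d : ℕ}

/-- The structural equation `η = α + B v + Γ z + e`. -/
def latent (S : Stage2Param m p l r) (z : Vec r) (v : Vec l) (e : Vec p) : Vec p :=
  S.α + mv S.B v + mv S.Γ z + e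

/-- The measurement equation `y = ν + Λ η + K z + e`. -/
def indicator (S : Stage2Param m p l r) (z : Vec r) (η : Vec p) (e : Vec m) : Vec m :=
  S.ν + mv S.Λ η + mv S.K z + e

/-- Modelled mean of `Y` given the covariates `z` and `v`. -/
def meanY (S : Stage2Param m p l r) (z : Vec r) (v : Vec l) : Vec m :=
  S.indicator z (S.latent z v 0) 0

/-- Modelled variance of `Y` given the covariates. -/
def varY (S : Stage2Param m p l r) : Matrix (Fin m) (Fin m) ℝ :=
  S.Λ * S.Ψ * S.Λᵀ + S.Ω

/-- Gaussian log-likelihood contribution of the linear structural equation model with observed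
covariates `z`, `v`. -/
def logLik (S : Stage2Param m p l r) (y : Vec m) (z : Vec r) (v : Vec l) : ℝ :=
  Real.log (mvnPDF (S.meanY z v) S.varY y)

/-- All entries of the parameter vectors and matrices are differentiable in `θ` at `t`. -/
def DiffAt (par : Vec d → Stage2Param m p l r) (t : Vec d) : Prop :=
  (∀ i, DifferentiableAt ℝ (fun s => (par s).α i) t) ∧
  (∀ i j, DifferentiableAt ℝ (fun s => (par s).B i j) t) ∧
  (∀ i j, DifferentiableAt ℝ (fun s => (par s).Γ i j) t) ∧
  (∀ i, DifferentiableAt ℝ (fun s => (par s).ν i) t) ∧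
  (∀ i j, DifferentiableAt ℝ (fun s => (par s).Λ i j) t) ∧
  (∀ i j, DifferentiableAt ℝ (fun s => (par s).K i j) t) ∧
  (∀ i j, DifferentiableAt ℝ (fun s => (par s).Ψ i j) t) ∧
  (∀ i j, DifferentiableAt ℝ (fun s => (par s).Ω i j) t)

end Stage2Param

section NonlinearSEM

variable {m p l r q h p₁ p₂ : ℕ}

/-- The law of an observation `(Y, X, Z)` under the non-linear structural equation model with
stage-1 part `M`, non-linearity `φ`, stage-2 parameters `S` and laws `lawζ`, `lawε` of the
stage-2 residuals; `Z` and all residual terms are mutually independent. -/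
def obsLaw (M : Stage1Model q h r) (PZ : Measure (Vec r)) (φ : Vec q → Vec l)
    (S : Stage2Param m p l r) (lawζ : Measure (Vec p)) (lawε : Measure (Vec m)) :
    Measure (Obs m h r) :=
  ((M.law PZ).prod (lawζ.prod lawε)).map fun w =>
    (S.indicator w.1.2.2 (S.latent w.1.2.2 (φ w.1.1) w.2.1) w.2.2, w.1.2.1, w.1.2.2)

/-- `μ` has finite second moments, mean `0` and covariance matrix `C`. -/
def IsResidualLaw {n : ℕ} (μ : Measure (Vec n)) (C : Matrix (Fin n) (Fin n) ℝ) : Prop :=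
  MemLp id 2 μ ∧ ∫ x, x ∂μ = 0 ∧ ∀ j k, ∫ x, x j * x k ∂μ = C j k

/-- The stage-2 score `U₂(θ₂; y, z, v)` of the Gaussian linear structural equation model. -/
def score2 (par : Vec p₂ → Stage2Param m p l r) (θ₂ : Vec p₂) (y : Vec m) (z : Vec r)
    (v : Vec l) : Vec p₂ :=
  gradient (fun t => (par t).logLik y z v) θ₂

/-- The simultaneous score contribution: the predictions at the stage-1 parameter `θ₁` are plugged
into the stage-2 score. -/
def score (par : Vec p₂ → Stage2Param m p l r) (φs : Vec p₁ → Vec h × Vec r → Vec l)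
    (θ₁ : Vec p₁) (θ₂ : Vec p₂) (o : Obs m h r) : Vec p₂ :=
  score2 par θ₂ o.1 o.2.2 (φs θ₁ o.2)

end NonlinearSEM

/-! ### Score equations, influence functions, variance estimators -/

section Asymptotics

variable {m h r p₁ p₂ d : ℕ} {Ω : Type*} [MeasurableSpace Ω]

/-- Empirical mean `n⁻¹ ∑_{i<n} f(Oᵢ)`. -/
def empMean {A E : Type*} [AddCommGroup E] [Module ℝ E] (O : ℕ → Ω → A) (n : ℕ) (ω : Ω)
    (f : A → E) : E :=
  (n : ℝ)⁻¹ • ∑ i ∈ Finset.range n, f (O i ω)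

/-- Partial derivative `∇_{θ₁} U`. -/
def gradOne (U : Vec p₁ → Vec p₂ → Obs m h r → Vec p₂) (θ₁ : Vec p₁) (θ₂ : Vec p₂)
    (o : Obs m h r) : Vec p₁ →L[ℝ] Vec p₂ :=
  fderiv ℝ (fun t => U t θ₂ o) θ₁

/-- Partial derivative `∇_{θ₂} U`. -/
def gradTwo (U : Vec p₁ → Vec p₂ → Obs m h r → Vec p₂) (θ₁ : Vec p₁) (θ₂ : Vec p₂)
    (o : Obs m h r) : Vec p₂ →L[ℝ] Vec p₂ :=
  fderiv ℝ (fun t => U θ₁ t o) θ₂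

/-- Full derivative `∇ U` with respect to `(θ₁, θ₂)`. -/
def gradFull (U : Vec p₁ → Vec p₂ → Obs m h r → Vec p₂) (θ : Vec p₁ × Vec p₂)
    (o : Obs m h r) : Vec p₁ × Vec p₂ →L[ℝ] Vec p₂ :=
  fderiv ℝ (fun t => U t.1 t.2 o) θ

/-- `E[-∇_{θ₂} U]`. -/
def sens (U : Vec p₁ → Vec p₂ → Obs m h r → Vec p₂) (Q : Measure (Obs m h r))
    (θ₁ : Vec p₁) (θ₂ : Vec p₂) : Vec p₂ →L[ℝ] Vec p₂ :=
  ∫ o, -gradTwo U θ₁ θ₂ o ∂Q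

/-- `E[∇_{θ₁} U]`. -/
def cross (U : Vec p₁ → Vec p₂ → Obs m h r → Vec p₂) (Q : Measure (Obs m h r))
    (θ₁ : Vec p₁) (θ₂ : Vec p₂) : Vec p₁ →L[ℝ] Vec p₂ :=
  ∫ o, gradOne U θ₁ θ₂ o ∂Q

/-- `IF₂ = E[-∇_{θ₂} U]⁻¹ U`, the stage-2 influence function for known `θ₁`. -/
def IF2 (U : Vec p₁ → Vec p₂ → Obs m h r → Vec p₂) (Q : Measure (Obs m h r))
    (θ₁ : Vec p₁) (θ₂ : Vec p₂) (o : Obs m h r) : Vec p₂ :=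
  (sens U Q θ₁ θ₂).inverse (U θ₁ θ₂ o)

/-- `IF₃ = IF₂ + E[-∇_{θ₂} U]⁻¹ E[∇_{θ₁} U] IF₁`. -/
def IF3 (U : Vec p₁ → Vec p₂ → Obs m h r → Vec p₂) (Q : Measure (Obs m h r))
    (IF1 : Vec h × Vec r → Vec p₁) (θ₁ : Vec p₁) (θ₂ : Vec p₂) (o : Obs m h r) : Vec p₂ :=
  IF2 U Q θ₁ θ₂ o + (sens U Q θ₁ θ₂).inverse (cross U Q θ₁ θ₂ (IF1 o.2))

/-- `IF₃` with the two expected derivatives replaced by their empirical counterparts. -/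
def IF3emp (U : Vec p₁ → Vec p₂ → Obs m h r → Vec p₂) (O : ℕ → Ω → Obs m h r)
    (IF1 : Vec h × Vec r → Vec p₁) (θ₁ : Vec p₁) (θ₂ : Vec p₂) (n : ℕ) (ω : Ω)
    (o : Obs m h r) : Vec p₂ :=
  (empMean O n ω fun o' => -gradTwo U θ₁ θ₂ o').inverse
    (U θ₁ θ₂ o + (empMean O n ω fun o' => gradOne U θ₁ θ₂ o') (IF1 o.2))

/-- The second moment matrix `E[f f^T]`. -/
def secondMoment {A : Type*} [MeasurableSpace A] (Q : Measure A) (f : A → Vec d) :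
    Matrix (Fin d) (Fin d) ℝ :=
  Matrix.of fun j k => ∫ a, f a j * f a k ∂Q

/-- The empirical second moment matrix `n⁻¹ ∑_{i<n} f(Oᵢ) f(Oᵢ)^T`. -/
def empSecondMoment {A : Type*} (O : ℕ → Ω → A) (n : ℕ) (ω : Ω) (f : A → Vec d) :
    Matrix (Fin d) (Fin d) ℝ :=
  Matrix.of fun j k => empMean O n ω fun a => f a j * f a k

/-- With probability tending to one, the score equation `∑_{i<n} u(θ; Oᵢ) = 0` (with a score `u`
that may depend on `n` and `ω` through plugged-in estimates) has exactly one root in the closed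
ball of radius `ρ` around `θ₀`. -/
def UniqueLocalRoot {A : Type*} (P : Measure Ω) (O : ℕ → Ω → A)
    (u : ℕ → Ω → Vec d → A → Vec d) (θ₀ : Vec d) (ρ : ℝ) : Prop :=
  Tendsto (fun n => P {ω | ¬ ∃! t, t ∈ Metric.closedBall θ₀ ρ ∧
    ∑ i ∈ Finset.range n, u n ω t (O i ω) = 0}) atTop (𝓝 0)

/-- With probability tending to one, `T n` solves the score equation and lies in the closed ball
of radius `ρ` around `θ₀`. -/
def IsLocalRoot {A : Type*} (P : Measure Ω) (O : ℕ → Ω → A)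
    (u : ℕ → Ω → Vec d → A → Vec d) (θ₀ : Vec d) (ρ : ℝ) (T : ℕ → Ω → Vec d) : Prop :=
  Tendsto (fun n => P {ω | ¬ (T n ω ∈ Metric.closedBall θ₀ ρ ∧
    ∑ i ∈ Finset.range n, u n ω (T n ω) (O i ω) = 0)}) atTop (𝓝 0)

/-- `√n (T n - θ₀) = n^{-1/2} ∑_{i<n} ψ(Oᵢ) + o_p(1)`. -/
def AsympLinear {A : Type*} (P : Measure Ω) (O : ℕ → Ω → A) (θ₀ : Vec d) (ψ : A → Vec d)
    (T : ℕ → Ω → Vec d) : Prop :=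
  TendstoInMeasure P (fun (n : ℕ) ω => Real.sqrt n • (T n ω - θ₀)
    - (Real.sqrt n)⁻¹ • ∑ i ∈ Finset.range n, ψ (O i ω)) atTop (fun _ => 0)

/-- `ψ` is measurable, centred and square integrable under `Q`. -/
def IsInfluence {A : Type*} [MeasurableSpace A] (Q : Measure A) (ψ : A → Vec d) : Prop :=
  AEMeasurable ψ Q ∧ MemLp ψ 2 Q ∧ ∫ a, ψ a ∂Q = 0

/-- `√n (T n - θ₀)` converges in distribution to `N(0, C)`, for measurable `T n`. -/
def AsympNormal (P : Measure Ω) [IsProbabilityMeasure P] (θ₀ : Vec d)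
    (C : Matrix (Fin d) (Fin d) ℝ) (T : ℕ → Ω → Vec d) : Prop :=
  (∀ n, AEMeasurable (T n) P) →
    TendstoInDistribution (fun (n : ℕ) ω => Real.sqrt n • (T n ω - θ₀)) atTop
      (id : Vec d → Vec d) (fun _ => P) (multivariateGaussian 0 C)

/-- `T` is consistent for `θ₀` and asymptotically linear with influence function `ψ`, and
`√n (T n - θ₀)` is asymptotically normal with mean zero and variance `E[ψ ψ^T]`. -/
def HasInfluence {A : Type*} [MeasurableSpace A] (P : Measure Ω) [IsProbabilityMeasure P]
    (O : ℕ → Ω → A) (Q : Measure A) (θ₀ : Vec d) (ψ : A → Vec d) (T : ℕ → Ω → Vec d) : Prop :=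
  TendstoInMeasure P T atTop (fun _ => θ₀) ∧ IsInfluence Q ψ ∧ AsympLinear P O θ₀ ψ T ∧
    (secondMoment Q ψ).PosSemidef ∧ AsympNormal P θ₀ (secondMoment Q ψ) T

/-- The empirical second moment of the estimated influence function `IF₃`, at the estimates
`T₁ n`, `T₂ n` and with the estimate `IF1hat` of `IF₁`, converges in probability to `E[IF₃ IF₃^T]`;
this is stated both when the expected derivatives in `IF₃` are replaced by empirical ones and when
they are kept as functions of the parameter and evaluated at the estimates. -/
def VarianceConsistent (P : Measure Ω) (O : ℕ → Ω → Obs m h r)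
    (U : Vec p₁ → Vec p₂ → Obs m h r → Vec p₂) (Q : Measure (Obs m h r))
    (θ₀₁ : Vec p₁) (θ₀₂ : Vec p₂) (IF1 : Vec h × Vec r → Vec p₁)
    (IF1hat : ℕ → Ω → Vec h × Vec r → Vec p₁) (T₁ : ℕ → Ω → Vec p₁) (T₂ : ℕ → Ω → Vec p₂) :
    Prop :=
  ∀ j k,
    TendstoInMeasure P (fun n ω => empSecondMoment O n ω
      (IF3emp U O (IF1hat n ω) (T₁ n ω) (T₂ n ω) n ω) j k) atTop
      (fun _ => secondMoment Q (IF3 U Q IF1 θ₀₁ θ₀₂) j k) ∧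
    TendstoInMeasure P (fun n ω => empSecondMoment O n ω
      (IF3 U Q (IF1hat n ω) (T₁ n ω) (T₂ n ω)) j k) atTop
      (fun _ => secondMoment Q (IF3 U Q IF1 θ₀₁ θ₀₂) j k)

/-- A family `ψ θ` of functions that, for `θ` near `θ₀`, is measurable, continuous in `θ`, and
dominated by a square-integrable function. -/
def LocallyRegular {A : Type*} [MeasurableSpace A] (Q : Measure A) (θ₀ : Vec d)
    (ψ : Vec d → A → Vec d) : Prop :=
  ∃ ρ > 0, ∃ F : A → ℝ, MemLp F 2 Q ∧ (∀ θ ∈ Metric.ball θ₀ ρ, Measurable (ψ θ)) ∧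
    ∀ᵐ a ∂Q, ContinuousOn (fun θ => ψ θ a) (Metric.ball θ₀ ρ) ∧
      ∀ θ ∈ Metric.ball θ₀ ρ, ‖ψ θ a‖ ≤ F a

/-- Smoothness of the score contributions on a neighbourhood of the true parameters and uniform
convergence in probability of their averaged derivative. -/
def ScoreRegular (P : Measure Ω) (O : ℕ → Ω → Obs m h r)
    (U : Vec p₁ → Vec p₂ → Obs m h r → Vec p₂) (Q : Measure (Obs m h r))
    (θ₀₁ : Vec p₁) (θ₀₂ : Vec p₂) : Prop :=
  ∃ N : Set (Vec p₁ × Vec p₂), IsOpen N ∧ (θ₀₁, θ₀₂) ∈ N ∧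
    (∀ᵐ o ∂Q, ContDiffOn ℝ 2 (fun θ : Vec p₁ × Vec p₂ => U θ.1 θ.2 o) N) ∧
    (∀ θ ∈ N, Integrable (gradFull U θ) Q) ∧
    ∀ δ > 0, Tendsto (fun n => P {ω | ∃ θ ∈ N,
      δ ≤ ‖empMean O n ω (gradFull U θ) - ∫ o, gradFull U θ o ∂Q‖}) atTop (𝓝 0)

end Asymptotics

/-! ### Gaussian mixtures in stage 1 -/

/-- Stage-1 model in which `ξ` belongs to class `k` with probability `π k`, and then
`ξ = α k + B ξ + Γ Z + ζ` with `ζ ∼ N(0, Ψ k)`; in all classes `X = ν + Λ ξ + K Z + ε` with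
`ε ∼ N(0, Ω)`. -/
structure MixtureParam (c q h r : ℕ) where
  π : Fin c → ℝ
  α : Fin c → Vec q
  Ψ : Fin c → Matrix (Fin q) (Fin q) ℝ
  B : Matrix (Fin q) (Fin q) ℝ
  Γ : Matrix (Fin q) (Fin r) ℝ
  ν : Vec h
  Λ : Matrix (Fin h) (Fin q) ℝ
  K : Matrix (Fin h) (Fin r) ℝ
  Ω : Matrix (Fin h) (Fin h) ℝ

namespace MixtureParam

variable {c q h r p₁ : ℕ}

/-- The mixture as a stage-1 model: the class intercept is part of the residual law. -/
def toStage1 (M : MixtureParam c q h r) : Stage1Model q h r where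
  α := 0
  B := M.B
  Γ := M.Γ
  ν := M.ν
  Λ := M.Λ
  K := M.K
  lawζ := ∑ k, ENNReal.ofReal (M.π k) • multivariateGaussian (M.α k) (M.Ψ k)
  lawε := multivariateGaussian 0 M.Ω

/-- Mean of `X` given `Z = z` in class `k`. -/
def meanX (M : MixtureParam c q h r) (k : Fin c) (z : Vec r) : Vec h :=
  M.ν + mv M.Λ (mv (1 - M.B)⁻¹ (M.α k + mv M.Γ z)) + mv M.K z

/-- Variance of `X` given `Z` in class `k`. -/
def varX (M : MixtureParam c q h r) (k : Fin c) : Matrix (Fin h) (Fin h) ℝ :=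
  M.Λ * (1 - M.B)⁻¹ * M.Ψ k * ((1 - M.B)⁻¹)ᵀ * M.Λᵀ + M.Ω

/-- Conditional density of `X` given `Z = z`; the argument is `(x, z)`. -/
def density (M : MixtureParam c q h r) (w : Vec h × Vec r) : ℝ :=
  ∑ k, M.π k * mvnPDF (M.meanX k w.2) (M.varX k) w.1

/-- The parameters define a mixture model with non-degenerate component distributions of `X`. -/
def Valid (M : MixtureParam c q h r) : Prop :=
  (∀ k, 0 ≤ M.π k) ∧ ∑ k, M.π k = 1 ∧ (∀ k, (M.Ψ k).PosSemidef) ∧ M.Ω.PosSemidef ∧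
    IsUnit (1 - M.B).det ∧ ∀ k, (M.varX k).PosDef

/-- The score `∇_{θ₁} log p(x | z; θ₁)` of the mixture model. -/
def score1 (mix : Vec p₁ → MixtureParam c q h r) (θ : Vec p₁) (w : Vec h × Vec r) : Vec p₁ :=
  gradient (fun t => Real.log ((mix t).density w)) θ

/-- The Fisher information `E[S S^T]` at `θ`, as a linear map. -/
def fisherInfo (mix : Vec p₁ → MixtureParam c q h r) (PZ : Measure (Vec r)) (θ : Vec p₁) :
    Vec p₁ →L[ℝ] Vec p₁ :=
  ∫ w, (innerSL ℝ (score1 mix θ w)).smulRight (score1 mix θ w) ∂((mix θ).toStage1.lawXZ PZ)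

/-- Regularity conditions for maximum likelihood in mixture models: near the true parameter `θ₀`
the density is three times continuously differentiable, with integrable bounds for the first two
derivatives of the density and the third derivative of its logarithm, and the Fisher information
at `θ₀` is well defined and positive definite. -/
def Regular (mix : Vec p₁ → MixtureParam c q h r) (PZ : Measure (Vec r)) (θ₀ : Vec p₁) : Prop :=
  (∃ N : Set (Vec p₁), IsOpen N ∧ θ₀ ∈ N ∧ (∀ θ ∈ N, (mix θ).Valid) ∧
    ∃ f₁ f₂ f₃ : Vec h × Vec r → ℝ,
      Integrable f₁ ((volume : Measure (Vec h)).prod PZ) ∧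
      Integrable f₂ ((volume : Measure (Vec h)).prod PZ) ∧
      Integrable f₃ ((mix θ₀).toStage1.lawXZ PZ) ∧
      ∀ᵐ w ∂((volume : Measure (Vec h)).prod PZ),
        ContDiffOn ℝ 3 (fun θ => (mix θ).density w) N ∧
        ∀ θ ∈ N,
          ‖iteratedFDeriv ℝ 1 (fun t => (mix t).density w) θ‖ ≤ f₁ w ∧
          ‖iteratedFDeriv ℝ 2 (fun t => (mix t).density w) θ‖ ≤ f₂ w ∧
          ‖iteratedFDeriv ℝ 3 (fun t => Real.log ((mix t).density w)) θ‖ ≤ f₃ w) ∧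
  MemLp (score1 mix θ₀) 2 ((mix θ₀).toStage1.lawXZ PZ) ∧
  ∀ v, v ≠ 0 → 0 < ⟪v, fisherInfo mix PZ θ₀ v⟫

/-- The influence function `I(θ)⁻¹ S(θ; x, z)` of the maximum likelihood estimator. -/
def mleIF (mix : Vec p₁ → MixtureParam c q h r) (PZ : Measure (Vec r)) (θ : Vec p₁)
    (w : Vec h × Vec r) : Vec p₁ :=
  (fisherInfo mix PZ θ).inverse (score1 mix θ w)

/-- The estimate of the influence function at `θ`: inverse observed information matrix times the
score. -/
def mleIFhat {Ω : Type*} (mix : Vec p₁ → MixtureParam c q h r) (XZ : ℕ → Ω → Vec h × Vec r)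
    (θ : Vec p₁) (n : ℕ) (ω : Ω) (w : Vec h × Vec r) : Vec p₁ :=
  (empMean XZ n ω fun w' => -fderiv ℝ (fun t => score1 mix t w') θ).inverse (score1 mix θ w)

end MixtureParam

end

end TwoStage

open TwoStage

/-! Stage 2 is an estimating equation. By the uniform law for `∇U`, the random map `θ₂ ↦ n⁻¹ ∑
U(θ̂₁, θ₂; Oᵢ)` has a derivative close to `-A` near `θ₀₂`. A map sufficiently close to a linear
isomorphism is injective on a ball and has a zero there once its value at the centre is small; this
gives the unique local root. The same estimate with a finer tolerance gives `√n (θ̂₂ - θ₀₂) = A⁻¹ √n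
Ūₙ(θ̂₁, θ₀₂) + o_p(1)` (`exists_radius_root`). Expanding the right side in `θ₁`
(`tendsto_linearization`) contributes `E[∇_{θ₁} U] IF₁`, and the central limit theorem finishes the
distributional claim. Statements in probability are handled as limits along one filter, `whp`.

The score is centred although the working model is wrong: `Y` need not be Gaussian and a prediction
replaces `φ(ξ)`. In each direction the score is a quadratic form in the residual plus residuals
times affine functions of the covariates, so only two facts matter: the residual is orthogonal to
functions of `(X, Z)`, and its second moment is exactly the modelled variance, because `Ψ` has been
inflated by the prediction error (`integral_score2_eq_zero`).

The delicate point is consistency of `Σ̂`, since no square-integrable envelope of `∇U` is assumed. A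
uniform law in probability forces the local envelope `D` to satisfy `t Q(D > t) → 0`
(`IsSample.smallTail_of_uniform`), by an argument in which one large summand makes the whole sum
large. This implies `n⁻² ∑ D(Oᵢ)² → 0` in probability, which is just enough: `‖U(θ̂) - U(θ₀)‖ ≤ D
‖θ̂ - θ₀‖`, and the squared error of the parameter is of order `1/n`.

In a Gaussian mixture, `(X, Z)` has an explicit density with respect to `dx P_Z(dz)`.
Differentiating its total mass twice under the integral gives a centred score and the information
identity; the bound on the third derivative makes the derivative of the score Lipschitz. The root
theorem then applies to the likelihood equation, and its solution is an admissible stage-1 estimator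
(`exists_radius_score`, `Regular.exists_radius_mle`). -/

namespace TwoStage

noncomputable section

/-! ### Events whose probability tends to one -/

section Whp

variable {Ω : Type*} [MeasurableSpace Ω] {P : Measure Ω}

/-- The filter on `ℕ × Ω` of events that hold with (inner) probability tending to one. -/
def whp (P : Measure Ω) : Filter (ℕ × Ω) where
  sets := {S | Tendsto (fun n => P {ω | (n, ω) ∉ S}) atTop (𝓝 0)}
  univ_sets := by simp
  sets_of_superset {S T} hS hST :=
    tendsto_of_tendsto_of_tendsto_of_le_of_le tendsto_const_nhds hS (fun _ => zero_le)
      fun _ => measure_mono fun _ hω h => hω (hST h)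
  inter_sets {S T} hS hT := by
    have h := Tendsto.add hS hT
    rw [add_zero] at h
    refine tendsto_of_tendsto_of_tendsto_of_le_of_le tendsto_const_nhds h (fun _ => zero_le)
      fun n => (measure_mono ?_).trans (measure_union_le _ _)
    intro ω hω
    by_contra hc
    simp only [Set.mem_union, Set.mem_ofPred_eq, not_or, not_not] at hc
    exact hω ⟨hc.1, hc.2⟩

lemma eventually_whp {p : ℕ → Ω → Prop} :
    (∀ᶠ x in whp P, p x.1 x.2) ↔ Tendsto (fun n => P {ω | ¬ p n ω}) atTop (𝓝 0) := Iff.rfl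

lemma eventually_whp_of_atTop {p : ℕ → Prop} (h : ∀ᶠ n in atTop, p n) :
    ∀ᶠ x in whp P, p x.1 := by
  rw [eventually_whp (p := fun n _ => p n)]
  refine tendsto_const_nhds.congr' ?_
  filter_upwards [h] with n hn
  simp [hn]

lemma tendsto_fst_whp : Tendsto Prod.fst (whp P) atTop :=
  fun _ hs => eventually_whp_of_atTop hs

lemma eventually_whp_of_ae {p : ℕ → Ω → Prop} (h : ∀ n, ∀ᵐ ω ∂P, p n ω) :
    ∀ᶠ x in whp P, p x.1 x.2 := by
  rw [eventually_whp]
  have : ∀ n, P {ω | ¬ p n ω} = 0 := fun n => ae_iff.1 (h n)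
  simp [this]

/-- Events of probability tending to one contain an actual point `(n, ω)`, so deterministic facts
can be read off from a single sample; `UniformDeriv.continuousAt_integral` uses this. -/
instance [IsProbabilityMeasure P] : (whp P).NeBot := by
  refine ⟨fun h => ?_⟩
  have h0 : ∀ᶠ _ in whp P, False := by rw [h]; exact eventually_bot
  rw [eventually_whp (p := fun _ _ => False)] at h0
  simp at h0

/-- The dictionary that turns convergence in probability into a limit along a filter. Nothing needs
to be measurable, as `P` is an outer measure on arbitrary sets. -/
lemma tendstoInMeasure_iff_whp {E : Type*} [PseudoMetricSpace E] {X : ℕ → Ω → E} {c : E} :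
    TendstoInMeasure P X atTop (fun _ => c) ↔
      Tendsto (fun x : ℕ × Ω => X x.1 x.2) (whp P) (𝓝 c) := by
  rw [tendstoInMeasure_iff_dist, Metric.tendsto_nhds]
  refine forall₂_congr fun ε hε => ?_
  rw [eventually_whp (p := fun n ω => dist (X n ω) c < ε)]
  simp

/-- `X` is bounded in probability: its product with any sequence converging to zero in
probability converges to zero in probability. -/
def BddInProb {E : Type*} [NormedAddCommGroup E] (P : Measure Ω) (X : ℕ × Ω → E) : Prop :=
  ∀ Y : ℕ × Ω → ℝ, Tendsto Y (whp P) (𝓝 0) → Tendsto (fun x => Y x * ‖X x‖) (whp P) (𝓝 0)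

namespace BddInProb

variable {E E' : Type*} [NormedAddCommGroup E] [NormedAddCommGroup E']

lemma of_le {X : ℕ × Ω → E} {W : ℕ × Ω → E'} (hX : BddInProb P X) (C : ℝ)
    (h : ∀ᶠ x in whp P, ‖W x‖ ≤ C * ‖X x‖) : BddInProb P W := by
  intro Y hY
  have h1 := (hX Y hY).norm.const_mul C
  simp only [norm_zero, mul_zero] at h1
  refine squeeze_zero_norm' ?_ h1
  filter_upwards [h] with x hx
  simp only [norm_mul, norm_norm]
  nlinarith [norm_nonneg (Y x)]

lemma add {X W : ℕ × Ω → E} (hX : BddInProb P X) (hW : BddInProb P W) :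
    BddInProb P (X + W) := by
  intro Y hY
  have h1 := (hX Y hY).norm.add (hW Y hY).norm
  simp only [norm_zero, add_zero] at h1
  refine squeeze_zero_norm (fun x => ?_) h1
  simp only [norm_mul, norm_norm, Pi.add_apply]
  nlinarith [norm_nonneg (Y x), norm_add_le (X x) (W x)]

lemma of_tendsto {X : ℕ × Ω → E} {c : E} (hX : Tendsto X (whp P) (𝓝 c)) : BddInProb P X := by
  intro Y hY
  simpa using hY.mul hX.norm

/-- Chebyshev's criterion. -/
lemma of_second_moment {X : ℕ × Ω → E} {C : ℝ≥0∞} (hC : C ≠ ∞)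
    (h : ∀ n (M : ℝ), 0 < M → P {ω | M ≤ ‖X (n, ω)‖} ≤ C / ENNReal.ofReal (M ^ 2)) :
    BddInProb P X := by
  intro Y hY
  rw [Metric.tendsto_nhds]
  intro ε hε
  change Tendsto (fun n => P {ω | ¬ dist (Y (n, ω) * ‖X (n, ω)‖) 0 < ε}) atTop (𝓝 0)
  rw [ENNReal.tendsto_nhds_zero]
  intro δ hδ
  -- The product can reach `ε` only if `‖X‖ ≥ M` or `|Y| ≥ ε / M`; each event gets half of `δ`.
  obtain ⟨M, hM0, hM⟩ : ∃ M : ℝ, 0 < M ∧ C / ENNReal.ofReal (M ^ 2) ≤ δ / 2 := by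
    have : Tendsto (fun M : ℝ => C / ENNReal.ofReal (M ^ 2)) atTop (𝓝 0) := by
      have h1 : Tendsto (fun M : ℝ => ENNReal.ofReal (M ^ 2)) atTop (𝓝 ∞) :=
        ENNReal.tendsto_ofReal_atTop.comp (tendsto_pow_atTop two_ne_zero)
      simpa using ENNReal.Tendsto.const_div h1 (Or.inr hC)
    have h2 := (ENNReal.tendsto_nhds_zero.1 this (δ / 2) (ENNReal.half_pos hδ.ne')).and
      (eventually_gt_atTop 0)
    obtain ⟨M, h3, h4⟩ := h2.exists
    exact ⟨M, h4, h3⟩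
  have hY' : Tendsto (fun n => P {ω | ¬ dist (Y (n, ω)) 0 < ε / M}) atTop (𝓝 0) :=
    (Metric.tendsto_nhds.1 hY) (ε / M) (by positivity)
  filter_upwards [ENNReal.tendsto_nhds_zero.1 hY' (δ / 2) (ENNReal.half_pos hδ.ne')] with n hn
  rw [← ENNReal.add_halves δ]
  refine le_trans ?_ (add_le_add hn ((h n M hM0).trans hM))
  refine (measure_mono ?_).trans (measure_union_le _ _)
  intro ω hω
  by_contra hc
  simp only [Set.mem_union, Set.mem_ofPred_eq, not_or, not_not, not_le] at hc
  apply hω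
  obtain ⟨h1, h2⟩ := hc
  rw [Real.dist_eq, sub_zero] at h1 ⊢
  rw [abs_mul, abs_norm]
  calc |Y (n, ω)| * ‖X (n, ω)‖ ≤ |Y (n, ω)| * M := by gcongr
    _ < ε / M * M := by gcongr
    _ = ε := by field_simp

lemma tendsto_zero_of_le {X : ℕ × Ω → E} {W : ℕ × Ω → E'} (hX : BddInProb P X)
    {Y : ℕ × Ω → ℝ} (hY : Tendsto Y (whp P) (𝓝 0))
    (h : ∀ᶠ x in whp P, ‖W x‖ ≤ Y x * ‖X x‖) : Tendsto W (whp P) (𝓝 0) :=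
  squeeze_zero_norm' h (hX Y hY)

end BddInProb

end Whp

/-! ### Independent identically distributed samples -/

section Sample

variable {Ω A B : Type*} [MeasurableSpace Ω] [MeasurableSpace A] [MeasurableSpace B]
  {P : Measure Ω} {O : ℕ → Ω → A} {Q : Measure A}

/-- The `O i` are independent with law `Q`. -/
structure IsSample (P : Measure Ω) (O : ℕ → Ω → A) (Q : Measure A) : Prop where
  meas : ∀ i, Measurable (O i)
  indep : iIndepFun O P
  law : ∀ i, P.map (O i) = Q

namespace IsSample

lemma measurePreserving (h : IsSample P O Q) (i : ℕ) : MeasurePreserving (O i) P Q :=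
  ⟨h.meas i, h.law i⟩

lemma comp (h : IsSample P O Q) {g : A → B} (hg : Measurable g) :
    IsSample P (fun i ω => g (O i ω)) (Q.map g) where
  meas i := hg.comp (h.meas i)
  indep := h.indep.comp (fun _ => g) fun _ => hg
  law i := by
    rw [← h.law i, Measure.map_map hg (h.meas i)]
    rfl

lemma ae (h : IsSample P O Q) {p : A → Prop} (hp : ∀ᵐ a ∂Q, p a) :
    ∀ᵐ ω ∂P, ∀ i, p (O i ω) :=
  ae_all_iff.2 fun i => (h.measurePreserving i).quasiMeasurePreserving.ae hp

lemma whp_ae (h : IsSample P O Q) {p : A → Prop} (hp : ∀ᵐ a ∂Q, p a) :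
    ∀ᶠ x in whp P, ∀ i, p (O i x.2) :=
  eventually_whp_of_ae (p := fun _ ω => ∀ i, p (O i ω)) fun _ => h.ae hp

lemma identDistrib (h : IsSample P O Q) {f : A → B} (hf : AEMeasurable f Q) (i : ℕ) :
    IdentDistrib (fun ω => f (O i ω)) (fun ω => f (O 0 ω)) P P := by
  have h0 : IdentDistrib (O i) (O 0) P P :=
    ⟨(h.meas i).aemeasurable, (h.meas 0).aemeasurable, by rw [h.law, h.law]⟩
  exact h0.comp_of_aemeasurable (by rwa [h.law])

lemma iIndepFun_comp (h : IsSample P O Q) {f : A → B} (hf : AEMeasurable f Q) :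
    iIndepFun (fun i ω => f (O i ω)) P :=
  h.indep.comp₀ (fun _ => f) (fun i => (h.meas i).aemeasurable) fun i => by rwa [h.law]

/-- The law of large numbers. -/
lemma tendsto_empMean (h : IsSample P O Q) [IsProbabilityMeasure P] {E : Type*}
    [NormedAddCommGroup E] [NormedSpace ℝ E] [CompleteSpace E] {f : A → E}
    (hf : Integrable f Q) :
    Tendsto (fun x : ℕ × Ω => empMean O x.1 x.2 f) (whp P) (𝓝 (∫ a, f a ∂Q)) := by
  borelize E
  have hm := hf.aestronglyMeasurable
  have hX : ∀ i, AEStronglyMeasurable (fun ω => f (O i ω)) P := fun i =>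
    hm.comp_quasiMeasurePreserving (h.measurePreserving i).quasiMeasurePreserving
  have hi : Integrable (fun ω => f (O 0 ω)) P :=
    (h.measurePreserving 0).integrable_comp_of_integrable hf
  have hind := h.iIndepFun_comp hm.aemeasurable
  have h1 := strong_law_ae (μ := P) (fun i ω => f (O i ω)) hi
    (fun i j hij => hind.indepFun hij) (h.identDistrib hm.aemeasurable)
  have h2 : ∫ ω, f (O 0 ω) ∂P = ∫ a, f a ∂Q := by
    rw [← h.law 0, integral_map (h.meas 0).aemeasurable (by rwa [h.law])]
  rw [h2] at h1
  have h3 : ∀ n, AEStronglyMeasurable (fun ω => empMean O n ω f) P := by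
    intro n
    unfold empMean
    exact (Finset.aestronglyMeasurable_fun_sum _ fun i _ => hX i).const_smul _
  exact (tendstoInMeasure_iff_whp (X := fun n ω => empMean O n ω f)).1
    (tendstoInMeasure_of_tendsto_ae h3 h1)

end IsSample

end Sample

end

end TwoStage

namespace TwoStage

noncomputable section

/-! ### Central limit theorem and asymptotically linear estimators. -/

section CentralLimit

variable {Ω A : Type*} [MeasurableSpace Ω] [MeasurableSpace A]
  {P : Measure Ω} {O : ℕ → Ω → A} {Q : Measure A} {d : ℕ}

lemma BddInProb.of_coord {X : ℕ × Ω → Vec d} (h : ∀ j, BddInProb P fun x => X x j) :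
    BddInProb P X := by
  intro Y hY
  have h1 : Tendsto (fun x => ∑ j, ‖Y x * ‖X x j‖‖) (whp P) (𝓝 0) := by
    simpa using tendsto_finsetSum Finset.univ fun j _ => ((h j) Y hY).norm
  refine squeeze_zero_norm (fun x => ?_) h1
  simp only [norm_mul, norm_norm]
  rw [← Finset.mul_sum]
  gcongr
  calc ‖X x‖ = ‖∑ j, X x j • EuclideanSpace.basisFun (Fin d) ℝ j‖ := by
        conv_lhs => rw [← (EuclideanSpace.basisFun (Fin d) ℝ).sum_repr (X x)]
        simp
    _ ≤ ∑ j, ‖X x j‖ := by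
        refine (norm_sum_le _ _).trans (Finset.sum_le_sum fun j _ => ?_)
        rw [norm_smul, (EuclideanSpace.basisFun (Fin d) ℝ).orthonormal.1 j, mul_one]

lemma tendsto_sqrt_inv_whp : Tendsto (fun x : ℕ × Ω => (Real.sqrt x.1)⁻¹) (whp P) (𝓝 0) :=
  (tendsto_inv_atTop_zero.comp (Real.tendsto_sqrt_atTop.comp tendsto_natCast_atTop_atTop)).comp
    tendsto_fst_whp

/-- A `√n`-rate implies consistency: `1 / √n` serves as the null sequence. -/
lemma BddInProb.tendsto_of_sqrt {E : Type*} [NormedAddCommGroup E] [NormedSpace ℝ E]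
    {X : ℕ × Ω → E} (hX : BddInProb P fun x => Real.sqrt x.1 • X x) :
    Tendsto X (whp P) (𝓝 0) := by
  refine hX.tendsto_zero_of_le tendsto_sqrt_inv_whp ?_
  filter_upwards [eventually_whp_of_atTop (eventually_gt_atTop 0)] with x hx
  rw [norm_smul, Real.norm_of_nonneg (Real.sqrt_nonneg _), ← mul_assoc, inv_mul_cancel₀, one_mul]
  exact (Real.sqrt_pos.2 (by exact_mod_cast hx)).ne'

variable [IsProbabilityMeasure P]

lemma IsSample.bddInProb_real (h : IsSample P O Q) {f : A → ℝ} (hf : MemLp f 2 Q)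
    (h0 : ∫ a, f a ∂Q = 0) :
    BddInProb P fun x : ℕ × Ω => (Real.sqrt x.1)⁻¹ * ∑ i ∈ Finset.range x.1, f (O i x.2) := by
  have hm := hf.aestronglyMeasurable.aemeasurable
  have hL : ∀ i, MemLp (fun ω => f (O i ω)) 2 P := fun i =>
    hf.comp_measurePreserving (h.measurePreserving i)
  have hI : ∀ i, ∫ ω, f (O i ω) ∂P = 0 := fun i => by
    rw [← h0, ← h.law i, integral_map (h.meas i).aemeasurable]
    rw [h.law]
    exact hf.aestronglyMeasurable
  have hind := h.iIndepFun_comp hm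
  refine BddInProb.of_second_moment (C := ENNReal.ofReal (Var[fun ω => f (O 0 ω); P]))
    ENNReal.ofReal_ne_top fun n M hM => ?_
  have hS : MemLp (fun ω => (Real.sqrt n)⁻¹ * ∑ i ∈ Finset.range n, f (O i ω)) 2 P :=
    (memLp_finsetSum _ fun i _ => hL i).const_mul _
  have hES : ∫ ω, (Real.sqrt n)⁻¹ * ∑ i ∈ Finset.range n, f (O i ω) ∂P = 0 := by
    rw [integral_const_mul, integral_finsetSum _ fun i _ => (hL i).integrable one_le_two]
    simp [hI]
  -- Equality holds for positive `n`; at `n = 0` the left side is zero.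
  have hV : Var[fun ω => (Real.sqrt n)⁻¹ * ∑ i ∈ Finset.range n, f (O i ω); P]
      ≤ Var[fun ω => f (O 0 ω); P] := by
    have h1 := IndepFun.variance_sum (μ := P) (s := Finset.range n)
      (X := fun i ω => f (O i ω)) (fun i _ => hL i) (fun i _ j _ hij => hind.indepFun hij)
    have h2 : (∑ i ∈ Finset.range n, fun ω => f (O i ω)) =
      fun ω => ∑ i ∈ Finset.range n, f (O i ω) := by ext ω; simp
    rw [h2] at h1
    rw [variance_const_mul, h1]
    simp only [fun i => (h.identDistrib hm i).variance_eq, Finset.sum_const, Finset.card_range,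
      nsmul_eq_mul, inv_pow, Real.sq_sqrt (Nat.cast_nonneg n)]
    rcases eq_or_ne n 0 with rfl | hn
    · simp
    · rw [inv_mul_cancel_left₀ (by exact_mod_cast hn)]
  have h3 := meas_ge_le_variance_div_sq hS hM
  simp only [hES, sub_zero] at h3
  refine h3.trans ?_
  rw [ENNReal.ofReal_div_of_pos (by positivity)]
  gcongr

lemma memLp_euclidean_apply {f : A → Vec d} {q : ℝ≥0∞} (hf : MemLp f q Q) (j : Fin d) :
    MemLp (fun a => f a j) q Q :=
  (EuclideanSpace.proj (𝕜 := ℝ) j).comp_memLp' hf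

lemma integral_euclidean_apply {f : A → Vec d} (hf : Integrable f Q) (j : Fin d) :
    ∫ a, f a j ∂Q = (∫ a, f a ∂Q) j :=
  (EuclideanSpace.proj (𝕜 := ℝ) j).integral_comp_comm hf

lemma IsSample.isProbabilityMeasure (h : IsSample P O Q) : IsProbabilityMeasure Q := by
  rw [← h.law 0]
  exact Measure.isProbabilityMeasure_map (h.meas 0).aemeasurable

lemma IsSample.bddInProb (h : IsSample P O Q) {f : A → Vec d} (hf : IsInfluence Q f) :
    BddInProb P fun x : ℕ × Ω => (Real.sqrt x.1)⁻¹ • ∑ i ∈ Finset.range x.1, f (O i x.2) := by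
  have := h.isProbabilityMeasure
  refine BddInProb.of_coord fun j => ?_
  have h1 : ∫ a, f a j ∂Q = 0 := by
    rw [integral_euclidean_apply (hf.2.1.integrable one_le_two), hf.2.2]
    rfl
  simpa using h.bddInProb_real (memLp_euclidean_apply hf.2.1 j) h1

/-- Links the covariance matrix to the variances of the projections, as needed for positivity and
for the reduction of the central limit theorem to dimension one. -/
lemma dotProduct_secondMoment {f : A → Vec d} (hf : MemLp f 2 Q) (t : Vec d) :
    t ⬝ᵥ secondMoment Q f *ᵥ t = ∫ a, ⟪f a, t⟫ ^ 2 ∂Q := by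
  have h1 : ∀ a, ⟪f a, t⟫ ^ 2 = ∑ j, ∑ k, t j * t k * (f a j * f a k) := by
    intro a
    rw [PiLp.inner_apply, sq, Finset.sum_mul_sum]
    refine Finset.sum_congr rfl fun j _ => Finset.sum_congr rfl fun k _ => ?_
    simp only [RCLike.inner_apply, conj_trivial]
    ring
  have h2 : ∀ j k, Integrable (fun a => f a j * f a k) Q := fun j k =>
    (memLp_euclidean_apply hf j).integrable_mul (memLp_euclidean_apply hf k)
  simp_rw [h1]
  rw [integral_finsetSum _ fun j _ => integrable_finsetSum _ fun k _ => (h2 j k).const_mul _]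
  simp only [dotProduct, Matrix.mulVec, secondMoment, Matrix.of_apply]
  refine Finset.sum_congr rfl fun j _ => ?_
  rw [integral_finsetSum _ fun k _ => (h2 j k).const_mul _, Finset.mul_sum]
  refine Finset.sum_congr rfl fun k _ => ?_
  rw [integral_const_mul]
  ring

lemma posSemidef_secondMoment {f : A → Vec d} (hf : MemLp f 2 Q) :
    (secondMoment Q f).PosSemidef := by
  refine Matrix.PosSemidef.of_dotProduct_mulVec_nonneg ?_ fun x => ?_
  · ext j k
    simp [secondMoment, mul_comm]
  · have h := dotProduct_secondMoment hf (WithLp.toLp 2 x)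
    simp only [star_trivial]
    exact le_of_le_of_eq (integral_nonneg fun a => sq_nonneg _) h.symm

/-- The multivariate central limit theorem. -/
lemma IsSample.clt (h : IsSample P O Q) {f : A → Vec d} (hf : IsInfluence Q f) :
    TendstoInDistribution
      (fun (n : ℕ) ω => (Real.sqrt n)⁻¹ • ∑ i ∈ Finset.range n, f (O i ω)) atTop
      (id : Vec d → Vec d) (fun _ => P) (multivariateGaussian 0 (secondMoment Q f)) := by
  have := h.isProbabilityMeasure
  obtain ⟨hfm, hf2, hf0⟩ := hf
  have hm : ∀ i, AEMeasurable (fun ω => f (O i ω)) P := fun i =>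
    (AEMeasurable.comp_measurable (by rwa [h.law]) (h.meas i))
  have hms : ∀ n : ℕ, AEMeasurable (fun ω => (Real.sqrt n)⁻¹ • ∑ i ∈ Finset.range n, f (O i ω)) P :=
    fun n => (Finset.aemeasurable_fun_sum (Finset.range n) fun i _ => hm i).fun_const_smul _
  refine ⟨hms, aemeasurable_id, ?_⟩
  -- Cramér–Wold by characteristic functions: the value at `t` for the vector sum is the value at
  -- `1` for the sum of the real variables `⟪f (O i), t⟫`.
  refine ProbabilityMeasure.tendsto_iff_tendsto_charFun.2 fun t => ?_
  simp only [ProbabilityMeasure.coe_mk, Measure.map_id]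
  have hgm : AEMeasurable (fun a => ⟪f a, t⟫) Q := hfm.inner_const
  have hg2 : MemLp (fun a => ⟪f a, t⟫) 2 Q := hf2.inner_const t
  have hg0 : ∫ ω, ⟪f (O 0 ω), t⟫ ∂P = 0 := by
    have h1 : ∫ a, ⟪f a, t⟫ ∂Q = 0 := by
      have h2 := integral_inner (𝕜 := ℝ) (hf2.integrable one_le_two) t
      simp only [real_inner_comm t, hf0, inner_zero_right] at h2 ⊢
      simpa [real_inner_comm] using h2
    rw [← h1, ← h.law 0, integral_map (h.meas 0).aemeasurable]
    rw [h.law]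
    exact hg2.aestronglyMeasurable
  have hVar : Var[fun ω => ⟪f (O 0 ω), t⟫; P] = t ⬝ᵥ secondMoment Q f *ᵥ t := by
    rw [variance_of_integral_eq_zero (hm 0).inner_const hg0, dotProduct_secondMoment hf2, ← h.law 0,
      integral_map (h.meas 0).aemeasurable]
    rw [h.law]
    exact (hg2.aestronglyMeasurable.pow 2)
  have key := tendstoInDistribution_inv_sqrt_mul_sum_sub (P := P)
    (X := fun i ω => ⟪f (O i ω), t⟫) (Y := (id : ℝ → ℝ))
    (P' := gaussianReal 0 Var[fun ω => ⟪f (O 0 ω), t⟫; P].toNNReal) HasLaw.id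
    (hg2.comp_measurePreserving (h.measurePreserving 0)) (h.iIndepFun_comp hgm)
    (h.identDistrib hgm)
  have key2 := ProbabilityMeasure.tendsto_iff_tendsto_charFun.1 key.tendsto 1
  simp only [ProbabilityMeasure.coe_mk, Measure.map_id, hg0, mul_zero, sub_zero] at key2
  rw [charFun_multivariateGaussian (posSemidef_secondMoment hf2), ← hVar]
  rw [charFun_gaussianReal] at key2
  convert key2 using 1
  · ext n
    rw [charFun_apply, charFun_apply, integral_map (hms n) (by fun_prop), integral_map]
    · refine integral_congr_ae (Eventually.of_forall fun ω => ?_)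
      simp only [real_inner_smul_left, sum_inner]
      simp
    · exact (Finset.aemeasurable_fun_sum _ fun i _ => (hm i).inner_const).const_mul _
    · fun_prop
  · simp [variance_nonneg]

/-- Valid at `n = 0` too, where both scalars vanish by the convention `0⁻¹ = 0`. -/
lemma sqrt_mul_inv_smul {E : Type*} [NormedAddCommGroup E] [NormedSpace ℝ E] (n : ℕ) (x : E) :
    (Real.sqrt n)⁻¹ • x = Real.sqrt n • (n : ℝ)⁻¹ • x := by
  rcases eq_or_ne n 0 with rfl | hn
  · simp
  · rw [smul_smul]
    congr 1
    have : (0 : ℝ) < n := by positivity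
    have h2 := Real.sqrt_pos.2 this
    have h3 := Real.sq_sqrt this.le
    field_simp
    rw [h3]

variable {θ₀ : Vec d} {ψ : A → Vec d} {T : ℕ → Ω → Vec d}

lemma AsympLinear.tendsto (hT : AsympLinear P O θ₀ ψ T) :
    Tendsto (fun x : ℕ × Ω => Real.sqrt x.1 • (T x.1 x.2 - θ₀)
      - (Real.sqrt x.1)⁻¹ • ∑ i ∈ Finset.range x.1, ψ (O i x.2)) (whp P) (𝓝 0) :=
  (tendstoInMeasure_iff_whp (X := fun n ω => Real.sqrt n • (T n ω - θ₀)
      - (Real.sqrt n)⁻¹ • ∑ i ∈ Finset.range n, ψ (O i ω))).1 hT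

lemma AsympLinear.bddInProb (h : IsSample P O Q) (hψ : IsInfluence Q ψ)
    (hT : AsympLinear P O θ₀ ψ T) :
    BddInProb P fun x : ℕ × Ω => Real.sqrt x.1 • (T x.1 x.2 - θ₀) := by
  have h1 := (BddInProb.of_tendsto hT.tendsto).add (h.bddInProb hψ)
  convert h1 using 1
  ext1 x
  simp

lemma AsympLinear.consistent (h : IsSample P O Q) (hψ : IsInfluence Q ψ)
    (hT : AsympLinear P O θ₀ ψ T) :
    Tendsto (fun x : ℕ × Ω => T x.1 x.2) (whp P) (𝓝 θ₀) := by
  simpa using (BddInProb.tendsto_of_sqrt (hT.bddInProb h hψ)).add_const θ₀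

/-- An asymptotically linear estimator is consistent and asymptotically normal. -/
lemma AsympLinear.hasInfluence (h : IsSample P O Q) (hψ : IsInfluence Q ψ)
    (hT : AsympLinear P O θ₀ ψ T) : HasInfluence P O Q θ₀ ψ T := by
  refine ⟨tendstoInMeasure_iff_whp.2 (hT.consistent h hψ), hψ, hT,
    posSemidef_secondMoment hψ.2.1, fun hTm => ?_⟩
  exact tendstoInDistribution_of_tendstoInMeasure_sub _ _ (h.clt hψ) hT fun n =>
    ((hTm n).sub_const θ₀).fun_const_smul (Real.sqrt n)

end CentralLimit

end

end TwoStage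

namespace TwoStage

noncomputable section

/-! ### Roots of approximately linear random maps -/

section Roots

open scoped NNReal

variable {Ω : Type*} [MeasurableSpace Ω] {P : Measure Ω}

/-- The quotient `‖W‖ / ‖X‖` is the null sequence. Where `X = 0` it is zero by convention, and the
bound with `ε = 1` gives `W = 0`. -/
lemma BddInProb.tendsto_zero_of_forall_le {E E' : Type*} [NormedAddCommGroup E]
    [NormedAddCommGroup E'] {X : ℕ × Ω → E} {W : ℕ × Ω → E'} (hX : BddInProb P X)
    (h : ∀ ε : ℝ, 0 < ε → ∀ᶠ x in whp P, ‖W x‖ ≤ ε * ‖X x‖) : Tendsto W (whp P) (𝓝 0) := by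
  have hY : Tendsto (fun x => ‖W x‖ / ‖X x‖) (whp P) (𝓝 0) := by
    rw [Metric.tendsto_nhds]
    intro ε hε
    filter_upwards [h (ε / 2) (by positivity)] with x hx
    rw [Real.dist_eq, sub_zero, abs_of_nonneg (by positivity)]
    rcases (norm_nonneg (X x)).eq_or_lt with h0 | h0
    · rw [← h0, div_zero]
      exact hε
    · rw [div_lt_iff₀ h0]
      nlinarith
  refine hX.tendsto_zero_of_le hY ?_
  filter_upwards [h 1 one_pos] with x hx
  rcases (norm_nonneg (X x)).eq_or_lt with h0 | h0
  · rw [← h0] at hx ⊢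
    simpa using hx
  · rw [div_mul_cancel₀ _ h0.ne']

variable {E : Type*} [NormedAddCommGroup E] [NormedSpace ℝ E]

lemma approximatesLinearOn_of_hasFDerivAt {f : E → E} {f' : E → E →L[ℝ] E} {L : E →L[ℝ] E}
    {s : Set E} (hs : Convex ℝ s) {ε : ℝ≥0} (hf : ∀ x ∈ s, HasFDerivAt f (f' x) x)
    (hL : ∀ x ∈ s, ‖f' x - L‖ ≤ ε) : ApproximatesLinearOn f L s ε := fun _ hx _ hy =>
  hs.norm_image_sub_le_of_norm_hasFDerivWithin_le' (fun z hz => (hf z hz).hasFDerivWithinAt) hL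
    hy hx

/-- Up to sign, `e (x - y)` differs from `f x - f y` by at most `c ‖x - y‖`; after applying `e.symm`
this error is at most `‖x - y‖ / 2` and is absorbed. It yields both uniqueness of the root and its
distance from `θ₀`. -/
lemma norm_sub_le_of_approximatesLinearOn {f : E → E} (e : E ≃L[ℝ] E) {s : Set E} {K c : ℝ≥0}
    (hK : ∀ x, ‖e.symm x‖ ≤ K * ‖x‖) (hc : K * c ≤ 1 / 2)
    (hf : ApproximatesLinearOn f (-(e : E →L[ℝ] E)) s c) {x y : E} (hx : x ∈ s) (hy : y ∈ s) :
    ‖x - y‖ ≤ 2 * K * ‖f x - f y‖ := by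
  have h1 := hf x hx y hy
  have h2 : ‖x - y‖ ≤ K * ‖e (x - y)‖ := by simpa using hK (e (x - y))
  have h3 : ‖e (x - y)‖ ≤ c * ‖x - y‖ + ‖f x - f y‖ := by
    have : e (x - y) = (f x - f y - (-(e : E →L[ℝ] E)) (x - y)) - (f x - f y) := by simp
    rw [this]
    exact (norm_sub_le _ _).trans (by gcongr)
  have h4 : ‖x - y‖ ≤ K * (c * ‖x - y‖ + ‖f x - f y‖) := h2.trans (by gcongr)
  have h5 : (K : ℝ) * c ≤ 1 / 2 := by exact_mod_cast hc
  nlinarith [norm_nonneg (x - y)]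

/-- Existence is the quantitative open mapping part of the inverse function theorem: the image of
the ball covers a ball of radius `(K⁻¹ - c) ρ ≥ ρ / (2K)` around `f θ₀`, which contains zero. -/
lemma existsUnique_root [CompleteSpace E] {f : E → E} (e : E ≃L[ℝ] E) {θ₀ : E} {ρ : ℝ}
    (hρ : 0 ≤ ρ) {K c : ℝ≥0} (hK0 : 0 < K) (hK : ∀ x, ‖e.symm x‖ ≤ K * ‖x‖)
    (hc : K * c ≤ 1 / 2)
    (hf : ApproximatesLinearOn f (-(e : E →L[ℝ] E)) (Metric.closedBall θ₀ ρ) c)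
    (h0 : 2 * K * ‖f θ₀‖ ≤ ρ) :
    ∃! t, t ∈ Metric.closedBall θ₀ ρ ∧ f t = 0 := by
  let R : (-(e : E →L[ℝ] E)).NonlinearRightInverse :=
    { toFun := fun x => -e.symm x
      nnnorm := K
      bound' := fun x => by simpa using hK x
      right_inv' := fun x => by simp }
  have h1 := hf.surjOn_closedBall_of_nonlinearRightInverse R hρ subset_rfl
  have hK0' : (0 : ℝ) < K := by exact_mod_cast hK0
  have h5 : (K : ℝ) * c ≤ 1 / 2 := by exact_mod_cast hc
  have h2 : (0 : E) ∈ Metric.closedBall (f θ₀) (((R.nnnorm : ℝ)⁻¹ - c) * ρ) := by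
    rw [mem_closedBall_iff_norm, zero_sub, norm_neg]
    change _ ≤ ((K : ℝ)⁻¹ - c) * ρ
    have h6 : (1 : ℝ) / 2 ≤ K * ((K : ℝ)⁻¹ - c) := by
      rw [mul_sub, mul_inv_cancel₀ hK0'.ne']
      linarith
    have h7 : (K : ℝ) * ‖f θ₀‖ ≤ K * (((K : ℝ)⁻¹ - c) * ρ) := by nlinarith
    exact le_of_mul_le_mul_left h7 hK0'
  obtain ⟨t, ht, hft⟩ := h1 h2
  refine ⟨t, ⟨ht, hft⟩, fun s hs => ?_⟩
  have h3 := norm_sub_le_of_approximatesLinearOn e hK hc hf hs.1 ht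
  rw [hs.2, hft, sub_self, norm_zero, mul_zero] at h3
  exact sub_eq_zero.1 (norm_eq_zero.1 (le_antisymm h3 (norm_nonneg _)))

/-- Existence, uniqueness, consistency and asymptotic linearisation of local roots of random maps
that are, near `θ₀`, uniformly close to a linear isomorphism. -/
theorem exists_radius_root [CompleteSpace E] {H : ℕ × Ω → E → E} {A : E →L[ℝ] E}
    (hA : A.IsInvertible) {θ₀ : E}
    (hloc : ∀ ε : ℝ≥0, 0 < ε → ∃ r > 0, ∀ᶠ x in whp P,
      ApproximatesLinearOn (H x) (-A) (Metric.closedBall θ₀ r) ε)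
    (hbdd : BddInProb P fun x : ℕ × Ω => Real.sqrt x.1 • H x θ₀) :
    ∃ ρ > 0, (∀ᶠ x in whp P, ∃! t, t ∈ Metric.closedBall θ₀ ρ ∧ H x t = 0) ∧
      ∀ T : ℕ × Ω → E, (∀ᶠ x in whp P, T x ∈ Metric.closedBall θ₀ ρ ∧ H x (T x) = 0) →
        Tendsto (fun x => Real.sqrt x.1 • (T x - θ₀) - A.inverse (Real.sqrt x.1 • H x θ₀))
          (whp P) (𝓝 0) := by
  obtain ⟨e, rfl⟩ := hA
  -- Adding one keeps `K` positive when the space is trivial.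
  set K : ℝ≥0 := ‖(e.symm : E →L[ℝ] E)‖₊ + 1 with hKdef
  have hK0 : 0 < K := by positivity
  have hK0' : (0 : ℝ) < K := by exact_mod_cast hK0
  have hK : ∀ x, ‖e.symm x‖ ≤ K * ‖x‖ := fun x =>
    ((e.symm : E →L[ℝ] E).le_opNorm x).trans (by
      gcongr
      simp [hKdef])
  have hKc : K * (K⁻¹ / 2) ≤ 1 / 2 := by
    rw [← mul_div_assoc, mul_inv_cancel₀ hK0.ne']
  obtain ⟨ρ, hρ, hlin⟩ := hloc (K⁻¹ / 2) (by positivity)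
  have h0 : Tendsto (fun x => H x θ₀) (whp P) (𝓝 0) := hbdd.tendsto_of_sqrt
  refine ⟨ρ, hρ, ?_, fun T hT => ?_⟩
  · have h1 : ∀ᶠ x in whp P, 2 * K * ‖H x θ₀‖ < ρ := by
      have := (h0.norm.const_mul (2 * (K : ℝ)))
      rw [norm_zero, mul_zero] at this
      exact this.eventually_lt_const hρ
    filter_upwards [h1, hlin] with x hx hx2
    exact existsUnique_root e hρ.le hK0 hK hKc hx2 hx.le
  · have hbd : ∀ᶠ x in whp P, ‖T x - θ₀‖ ≤ 2 * K * ‖H x θ₀‖ := by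
      filter_upwards [hT, hlin] with x hx hx2
      have := norm_sub_le_of_approximatesLinearOn e hK hKc hx2 hx.1
        (Metric.mem_closedBall_self hρ.le)
      rwa [hx.2, zero_sub, norm_neg] at this
    have hcons : Tendsto (fun x => T x - θ₀) (whp P) (𝓝 0) := by
      have := (h0.norm.const_mul (2 * (K : ℝ)))
      rw [norm_zero, mul_zero] at this
      exact squeeze_zero_norm' hbd this
    refine hbdd.tendsto_zero_of_forall_le fun ε hε => ?_
    -- One factor `K` is lost in applying `e.symm`, and `2 * K` in bounding `‖T - θ₀‖` by `‖H θ₀‖`.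
    obtain ⟨r, hr, hlr⟩ := hloc (ε / (2 * K * K)).toNNReal
      (Real.toNNReal_pos.2 (by positivity))
    have hTr : ∀ᶠ x in whp P, ‖T x - θ₀‖ < r := by
      have := hcons.norm
      rw [norm_zero] at this
      exact this.eventually_lt_const hr
    filter_upwards [hT, hbd, hlr, hTr] with x hx hbx hlx hrx
    have h1 := hlx (T x) (mem_closedBall_iff_norm.2 hrx.le) θ₀ (Metric.mem_closedBall_self hr.le)
    rw [hx.2] at h1
    simp only [zero_sub, neg_apply, sub_neg_eq_add, ContinuousLinearEquiv.coe_coe] at h1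
    rw [Real.coe_toNNReal _ (by positivity)] at h1
    rw [ContinuousLinearMap.inverse_equiv]
    have h2 : Real.sqrt x.1 • (T x - θ₀) - (e.symm : E →L[ℝ] E) (Real.sqrt x.1 • H x θ₀)
        = Real.sqrt x.1 • e.symm (-H x θ₀ + e (T x - θ₀)) := by
      simp only [map_add, map_neg, map_smul, ContinuousLinearEquiv.symm_apply_apply, smul_add,
        smul_neg, ContinuousLinearEquiv.coe_coe]
      abel
    rw [h2, norm_smul, norm_smul, mul_left_comm]
    gcongr
    refine (hK _).trans ?_
    calc (K : ℝ) * ‖-H x θ₀ + e (T x - θ₀)‖ ≤ K * (ε / (2 * K * K) * ‖T x - θ₀‖) := by gcongr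
      _ ≤ K * (ε / (2 * K * K) * (2 * K * ‖H x θ₀‖)) := by gcongr
      _ = ε * ‖H x θ₀‖ := by field_simp

end Roots

end

end TwoStage

namespace TwoStage

noncomputable section

/-! ### Empirical means and convergence in empirical `L²` -/

section EmpMean

variable {Ω A : Type*} {O : ℕ → Ω → A} {n : ℕ} {ω : Ω}

lemma empMean_mono {f g : A → ℝ} (h : ∀ i, f (O i ω) ≤ g (O i ω)) :
    empMean O n ω f ≤ empMean O n ω g := by
  unfold empMean
  rw [smul_eq_mul, smul_eq_mul]
  gcongr with i
  exact h i

lemma empMean_nonneg {f : A → ℝ} (h : ∀ i, 0 ≤ f (O i ω)) : 0 ≤ empMean O n ω f :=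
  mul_nonneg (by positivity) (Finset.sum_nonneg fun i _ => h i)

lemma empMean_congr {E : Type*} [AddCommGroup E] [Module ℝ E] {f g : A → E}
    (h : ∀ i, f (O i ω) = g (O i ω)) : empMean O n ω f = empMean O n ω g := by
  unfold empMean
  rw [Finset.sum_congr rfl fun i _ => h i]

lemma empMean_add {E : Type*} [AddCommGroup E] [Module ℝ E] (f g : A → E) :
    empMean O n ω (fun a => f a + g a) = empMean O n ω f + empMean O n ω g := by
  simp [empMean, Finset.sum_add_distrib]

lemma empMean_sub {E : Type*} [AddCommGroup E] [Module ℝ E] (f g : A → E) :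
    empMean O n ω (fun a => f a - g a) = empMean O n ω f - empMean O n ω g := by
  simp [empMean, Finset.sum_sub_distrib, smul_sub]

lemma empMean_neg {E : Type*} [AddCommGroup E] [Module ℝ E] (f : A → E) :
    empMean O n ω (fun a => -f a) = -empMean O n ω f := by
  simp [empMean]

lemma empMean_mul (c : ℝ) (f : A → ℝ) :
    empMean O n ω (fun a => c * f a) = c * empMean O n ω f := by
  simp only [empMean, smul_eq_mul, ← Finset.mul_sum]
  ring

lemma map_empMean {E E' : Type*} [AddCommGroup E] [Module ℝ E] [AddCommGroup E'] [Module ℝ E']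
    (L : E →ₗ[ℝ] E') (f : A → E) :
    L (empMean O n ω f) = empMean O n ω fun a => L (f a) := by
  simp [empMean]

lemma norm_empMean_le {E : Type*} [NormedAddCommGroup E] [NormedSpace ℝ E] (f : A → E) :
    ‖empMean O n ω f‖ ≤ empMean O n ω fun a => ‖f a‖ := by
  unfold empMean
  rw [norm_smul, smul_eq_mul, norm_inv, Real.norm_natCast]
  gcongr
  exact norm_sum_le _ _

end EmpMean

/-- The mixed terms `2 ‖x - y‖ ‖y‖` are split by Young's inequality with weight `η`, so that
`L²`-closeness controls second moments while `‖y‖²` is merely bounded on average. -/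
lemma abs_mul_sub_mul_le {d : ℕ} {η : ℝ} (hη : 0 < η) (x y : Vec d) (j k : Fin d) :
    |x j * x k - y j * y k| ≤ (1 + η⁻¹) * ‖x - y‖ ^ 2 + η * ‖y‖ ^ 2 := by
  have hcoord : ∀ (v : Vec d) l, |v l| ≤ ‖v‖ := fun v l => by
    simpa using PiLp.norm_apply_le v l
  have e1 := hcoord (x - y) j
  have e2 := hcoord (x - y) k
  have e3 := hcoord y j
  have e4 := hcoord y k
  have e5 : x j * x k - y j * y k
      = (x - y) j * (x - y) k + y j * (x - y) k + (x - y) j * y k := by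
    simp only [PiLp.sub_apply]
    ring
  rw [e5]
  generalize (x - y) j = a, (x - y) k = b, y j = a', y k = b' at *
  generalize hu' : ‖x - y‖ = u at *
  generalize hv' : ‖y‖ = v at *
  have hu : 0 ≤ u := hu' ▸ norm_nonneg _
  have hv : 0 ≤ v := hv' ▸ norm_nonneg _
  have e6 : |a * b + a' * b + a * b'| ≤ u * u + v * u + u * v := by
    refine (abs_add_le _ _).trans (add_le_add ((abs_add_le _ _).trans (add_le_add ?_ ?_)) ?_) <;>
    · rw [abs_mul]
      gcongr
  have e7 : η⁻¹ * (u - η * v) ^ 2 = η⁻¹ * u ^ 2 + η * v ^ 2 - 2 * (u * v) := by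
    field_simp
    ring
  have e8 : 0 ≤ η⁻¹ * (u - η * v) ^ 2 := by positivity
  linarith

set_option linter.unusedSectionVars false

section EmpL2

variable {Ω A : Type*} [MeasurableSpace Ω] [MeasurableSpace A] {P : Measure Ω}
  {O : ℕ → Ω → A} {Q : Measure A} {E E' : Type*} [NormedAddCommGroup E] [NormedSpace ℝ E]
  [NormedAddCommGroup E'] [NormedSpace ℝ E']

/-- The random functions `F` converge to `f` in the empirical `L²`-norm, in probability. -/
def EmpL2 (P : Measure Ω) (O : ℕ → Ω → A) (F : ℕ × Ω → A → E) (f : A → E) : Prop :=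
  Tendsto (fun x : ℕ × Ω => empMean O x.1 x.2 fun a => ‖F x a - f a‖ ^ 2) (whp P) (𝓝 0)

namespace EmpL2

lemma of_le {F : ℕ × Ω → A → E} {f : A → E} {R : ℕ × Ω → ℝ} (hR : Tendsto R (whp P) (𝓝 0))
    (h : ∀ᶠ x in whp P, (empMean O x.1 x.2 fun a => ‖F x a - f a‖ ^ 2) ≤ R x) :
    EmpL2 P O F f :=
  squeeze_zero' (Eventually.of_forall fun _ => empMean_nonneg fun _ => by positivity) h hR

lemma congr {F F' : ℕ × Ω → A → E} {f f' : A → E} (h : EmpL2 P O F f)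
    (hF : ∀ᶠ x in whp P, ∀ i, F x (O i x.2) = F' x (O i x.2))
    (hf : ∀ᶠ x in whp P, ∀ i, f (O i x.2) = f' (O i x.2)) : EmpL2 P O F' f' := by
  refine of_le h ?_
  filter_upwards [hF, hf] with x h1 h2
  exact empMean_mono fun i => by rw [h1, h2]

lemma add {F G : ℕ × Ω → A → E} {f g : A → E} (hF : EmpL2 P O F f) (hG : EmpL2 P O G g) :
    EmpL2 P O (fun x a => F x a + G x a) (fun a => f a + g a) := by
  have h := (Tendsto.const_mul 2 hF).add (Tendsto.const_mul 2 hG)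
  rw [mul_zero, add_zero] at h
  refine of_le h (Eventually.of_forall fun x => ?_)
  rw [← empMean_mul, ← empMean_mul, ← empMean_add]
  refine empMean_mono fun i => ?_
  rw [add_sub_add_comm]
  have := norm_add_le (F x (O i x.2) - f (O i x.2)) (G x (O i x.2) - g (O i x.2))
  nlinarith [norm_nonneg (F x (O i x.2) - f (O i x.2) + (G x (O i x.2) - g (O i x.2))),
    sq_nonneg (‖F x (O i x.2) - f (O i x.2)‖ - ‖G x (O i x.2) - g (O i x.2)‖)]

/-- Permits estimated matrices in front of estimated functions: the error is `L (F - f) + (L - L₀)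
f`, and the empirical second moment of `f` converges. -/
lemma clm_apply [IsProbabilityMeasure P] (hO : IsSample P O Q) {F : ℕ × Ω → A → E} {f : A → E}
    (hF : EmpL2 P O F f) (hf : MemLp f 2 Q) {L : ℕ × Ω → E →L[ℝ] E'} {L₀ : E →L[ℝ] E'}
    (hL : Tendsto L (whp P) (𝓝 L₀)) :
    EmpL2 P O (fun x a => L x (F x a)) (fun a => L₀ (f a)) := by
  have h1 := hO.tendsto_empMean ((memLp_two_iff_integrable_sq_norm hf.1).1 hf)
  have h2 : Tendsto (fun x => ‖L x - L₀‖) (whp P) (𝓝 0) := by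
    simpa using (hL.sub_const L₀).norm
  have h := (((hL.norm.pow 2).const_mul 2).mul hF).add (((h2.pow 2).const_mul 2).mul h1)
  simp only [mul_zero, ne_eq, OfNat.ofNat_ne_zero, not_false_eq_true, zero_pow, zero_mul,
    add_zero] at h
  refine of_le h (Eventually.of_forall fun x => ?_)
  rw [← empMean_mul, ← empMean_mul, ← empMean_add]
  refine empMean_mono fun i => ?_
  set a := O i x.2
  have e : L x (F x a) - L₀ (f a) = L x (F x a - f a) + (L x - L₀) (f a) := by simp
  have h3 : ‖L x (F x a) - L₀ (f a)‖ ≤ ‖L x‖ * ‖F x a - f a‖ + ‖L x - L₀‖ * ‖f a‖ := by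
    rw [e]
    exact (norm_add_le _ _).trans (add_le_add (ContinuousLinearMap.le_opNorm _ _)
      (ContinuousLinearMap.le_opNorm _ _))
  calc ‖L x (F x a) - L₀ (f a)‖ ^ 2
      ≤ (‖L x‖ * ‖F x a - f a‖ + ‖L x - L₀‖ * ‖f a‖) ^ 2 := by gcongr
    _ ≤ 2 * ‖L x‖ ^ 2 * ‖F x a - f a‖ ^ 2 + 2 * ‖L x - L₀‖ ^ 2 * ‖f a‖ ^ 2 := by
        nlinarith [sq_nonneg (‖L x‖ * ‖F x a - f a‖ - ‖L x - L₀‖ * ‖f a‖)]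

lemma tendsto_empSecondMoment [IsProbabilityMeasure P] (hO : IsSample P O Q) {d : ℕ}
    {F : ℕ × Ω → A → Vec d} {f : A → Vec d} (hF : EmpL2 P O F f) (hf : MemLp f 2 Q)
    (j k : Fin d) :
    Tendsto (fun x : ℕ × Ω => empSecondMoment O x.1 x.2 (F x) j k) (whp P)
      (𝓝 (secondMoment Q f j k)) := by
  have hjk : Integrable (fun a => f a j * f a k) Q :=
    (memLp_euclidean_apply hf j).integrable_mul (memLp_euclidean_apply hf k)
  have h0 := hO.tendsto_empMean hjk
  have h1 := hO.tendsto_empMean ((memLp_two_iff_integrable_sq_norm hf.1).1 hf)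
  set c : ℝ := ∫ a, ‖f a‖ ^ 2 ∂Q with hc
  have hc0 : 0 ≤ c := integral_nonneg fun a => by positivity
  suffices h : Tendsto (fun x : ℕ × Ω => empMean O x.1 x.2 (fun a => F x a j * F x a k)
      - empMean O x.1 x.2 fun a => f a j * f a k) (whp P) (𝓝 0) by
    simpa [empSecondMoment, secondMoment] using h.add h0
  rw [Metric.tendsto_nhds]
  intro ε hε
  -- The bound from `abs_mul_sub_mul_le` tends to `η * c`, which is below `ε`; `c + 1` avoids a zero
  -- denominator.
  set η : ℝ := ε / (2 * (c + 1)) with hη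
  have hη0 : 0 < η := by positivity
  have h2 := (Tendsto.const_mul (1 + η⁻¹) hF).add (h1.const_mul η)
  simp only [mul_zero, zero_add] at h2
  have h3 : η * c < ε := by
    rw [hη, div_mul_eq_mul_div, div_lt_iff₀ (by positivity)]
    nlinarith
  filter_upwards [h2.eventually_lt_const h3] with x hx
  rw [Real.dist_eq, sub_zero, ← empMean_sub, ← Real.norm_eq_abs]
  refine lt_of_le_of_lt ((norm_empMean_le _).trans ?_) hx
  rw [← empMean_mul, ← empMean_mul, ← empMean_add]
  refine empMean_mono fun i => ?_
  rw [Real.norm_eq_abs]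
  exact abs_mul_sub_mul_le hη0 _ _ j k

end EmpL2

end EmpL2

/-! ### Functions with negligible truncated second moment -/

section Tail

variable {Ω A : Type*} [MeasurableSpace Ω] [MeasurableSpace A] {P : Measure Ω}
  [IsProbabilityMeasure P] {O : ℕ → Ω → A} {Q : Measure A}

/-- Markov's inequality. -/
lemma tendsto_whp_of_integral {W : ℕ → Ω → ℝ} (h0 : ∀ n ω, 0 ≤ W n ω)
    (hi : ∀ n, Integrable (W n) P) (h : Tendsto (fun n => ∫ ω, W n ω ∂P) atTop (𝓝 0)) :
    Tendsto (fun x : ℕ × Ω => W x.1 x.2) (whp P) (𝓝 0) := by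
  refine (tendstoInMeasure_iff_whp (X := W)).1 ?_
  rw [tendstoInMeasure_iff_norm]
  intro ε hε
  have h1 : Tendsto (fun n => ENNReal.ofReal (∫ ω, W n ω ∂P) / ENNReal.ofReal ε) atTop (𝓝 0) := by
    have := ENNReal.Tendsto.div_const (ENNReal.tendsto_ofReal h)
      (Or.inr (ENNReal.ofReal_pos.2 hε).ne')
    simpa using this
  refine tendsto_of_tendsto_of_tendsto_of_le_of_le tendsto_const_nhds h1 (fun _ => zero_le)
    fun n => ?_
  simp only [sub_zero, Real.norm_of_nonneg (h0 _ _)]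
  have h2 := meas_ge_le_lintegral_div (μ := P) (f := fun ω => ENNReal.ofReal (W n ω))
    (hi n).aestronglyMeasurable.aemeasurable.ennreal_ofReal (ENNReal.ofReal_pos.2 hε).ne'
    ENNReal.ofReal_ne_top
  rw [← ofReal_integral_eq_lintegral_ofReal (hi n) (Eventually.of_forall (h0 n))] at h2
  refine le_trans (measure_mono fun ω hω => ?_) h2
  exact ENNReal.ofReal_le_ofReal hω

/-- The tails of `D` are `o(1 / t)`. -/
def SmallTail (Q : Measure A) (D : A → ℝ) : Prop :=
  Measurable D ∧ (∀ a, 0 ≤ D a) ∧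
    Tendsto (fun n : ℕ => (n : ℝ) * Q.real {a | (n : ℝ) < D a}) atTop (𝓝 0)

/-- A discrete layer-cake formula: `1 + 3 + ⋯ + (2m - 1) = m²` with `m = ⌈y⌉₊`. It expresses
truncated second moments through tail probabilities. -/
lemma sq_le_sum_indicator {y : ℝ} {n : ℕ} (hy0 : 0 ≤ y) (hyn : y ≤ n) :
    y ^ 2 ≤ ∑ k ∈ Finset.range n, (2 * (k : ℝ) + 1) * Set.indicator {z : ℝ | (k : ℝ) < z} 1 y := by
  have hsum : ∀ m : ℕ, ∑ k ∈ Finset.range m, (2 * (k : ℝ) + 1) = (m : ℝ) ^ 2 := by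
    intro m
    induction m with
    | zero => simp
    | succ m ih =>
      rw [Finset.sum_range_succ, ih]
      push_cast
      ring
  have hm : ⌈y⌉₊ ≤ n := Nat.ceil_le.2 hyn
  calc y ^ 2 ≤ (⌈y⌉₊ : ℝ) ^ 2 := by
        have := Nat.le_ceil y
        gcongr
    _ = ∑ k ∈ Finset.range ⌈y⌉₊, (2 * (k : ℝ) + 1) := (hsum _).symm
    _ = ∑ k ∈ Finset.range ⌈y⌉₊, (2 * (k : ℝ) + 1) * Set.indicator {z : ℝ | (k : ℝ) < z} 1 y := by
        refine Finset.sum_congr rfl fun k hk => ?_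
        have : (k : ℝ) < y := Nat.lt_ceil.1 (Finset.mem_range.1 hk)
        rw [Set.indicator_of_mem (by exact this)]
        simp
    _ ≤ _ := by
        refine Finset.sum_le_sum_of_subset_of_nonneg (Finset.range_mono hm) fun k _ _ => ?_
        exact mul_nonneg (by positivity) (Set.indicator_nonneg (fun _ _ => zero_le_one) _)

lemma IsSample.measureReal_preimage (hO : IsSample P O Q) (i : ℕ) {s : Set A}
    (hs : MeasurableSet s) : P.real {ω | O i ω ∈ s} = Q.real s := by
  rw [← hO.law i, map_measureReal_apply (hO.meas i) hs]
  rfl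

/-- A weak law: averages of squares grow slower than linearly. -/
lemma SmallTail.tendsto_empMean_sq (hO : IsSample P O Q) {D : A → ℝ} (hD : SmallTail Q D) :
    Tendsto (fun x : ℕ × Ω => (x.1 : ℝ)⁻¹ * empMean O x.1 x.2 fun a => D a ^ 2) (whp P)
      (𝓝 0) := by
  obtain ⟨hm, h0, ht⟩ := hD
  have := hO.isProbabilityMeasure
  have hset : ∀ k : ℕ, MeasurableSet {a | (k : ℝ) < D a} := fun k =>
    measurableSet_lt measurable_const hm
  -- Truncation at `n` costs nothing: by the union bound the exceptional event has probability at
  -- most `n Q(D > n)`.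
  have hmax : ∀ᶠ x in whp P, ∀ i < x.1, D (O i x.2) ≤ x.1 := by
    rw [eventually_whp (p := fun n ω => ∀ i < n, D (O i ω) ≤ n)]
    have h1 : Tendsto (fun n : ℕ => ENNReal.ofReal ((n : ℝ) * Q.real {a | (n : ℝ) < D a}))
        atTop (𝓝 0) := by simpa using ENNReal.tendsto_ofReal ht
    refine tendsto_of_tendsto_of_tendsto_of_le_of_le tendsto_const_nhds h1 (fun _ => zero_le)
      fun n => ?_
    have h2 : {ω | ¬ ∀ i < n, D (O i ω) ≤ n} ⊆
        ⋃ i ∈ Finset.range n, {ω | O i ω ∈ {a | (n : ℝ) < D a}} := by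
      intro ω hω
      simp only [Set.mem_ofPred_eq, not_forall, not_le] at hω
      obtain ⟨i, hi, h⟩ := hω
      exact Set.mem_biUnion (Finset.mem_coe.2 (Finset.mem_range.2 hi)) h
    refine (measure_mono h2).trans ((measure_biUnion_finset_le _ _).trans ?_)
    rw [ENNReal.ofReal_mul (by positivity), ENNReal.ofReal_natCast]
    have h3 : ∀ i, P {ω | O i ω ∈ {a | (n : ℝ) < D a}} =
        ENNReal.ofReal (Q.real {a | (n : ℝ) < D a}) := fun i => by
      rw [← hO.measureReal_preimage i (hset n), ofReal_measureReal]
    rw [Finset.sum_congr rfl fun i _ => h3 i, Finset.sum_const, Finset.card_range, nsmul_eq_mul]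
  -- Dominates `D ^ 2` wherever `D ≤ n`, and has an integral given by tail probabilities alone; `D`
  -- itself may fail to be integrable.
  set V : ℕ → A → ℝ := fun n a => ∑ k ∈ Finset.range n,
    (2 * (k : ℝ) + 1) * Set.indicator {a | (k : ℝ) < D a} 1 a with hV
  have hVi : ∀ n, Integrable (V n) Q := fun n => integrable_finsetSum _ fun k _ =>
    (((integrable_const (1 : ℝ)).indicator (hset k))).const_mul _
  have hV0 : ∀ n a, 0 ≤ V n a := fun n a => Finset.sum_nonneg fun k _ =>
    mul_nonneg (by positivity) (Set.indicator_nonneg (fun _ _ => zero_le_one) _)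
  have hVint : ∀ n, ∫ a, V n a ∂Q =
      ∑ k ∈ Finset.range n, (2 * (k : ℝ) + 1) * Q.real {a | (k : ℝ) < D a} := by
    intro n
    have h4 : ∀ k ∈ Finset.range n, Integrable
        (fun a => (2 * (k : ℝ) + 1) * Set.indicator {a | (k : ℝ) < D a} 1 a) Q := fun k _ =>
      ((integrable_const (1 : ℝ)).indicator (hset k)).const_mul _
    change ∫ a, ∑ k ∈ Finset.range n, _ ∂Q = _
    rw [integral_finsetSum _ h4]
    refine Finset.sum_congr rfl fun k _ => ?_
    rw [integral_const_mul, integral_indicator_one (hset k)]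
  have hWint : ∀ n : ℕ, ∫ ω, (n : ℝ)⁻¹ * empMean O n ω (V n) ∂P
      = (n : ℝ)⁻¹ * ∑ k ∈ Finset.range n, (2 * (k : ℝ) + 1) * Q.real {a | (k : ℝ) < D a} := by
    intro n
    rw [integral_const_mul, ← hVint]
    simp only [empMean, smul_eq_mul]
    have h4 : ∀ i ∈ Finset.range n, Integrable (fun ω => V n (O i ω)) P := fun i _ =>
      (hO.measurePreserving i).integrable_comp_of_integrable (hVi n)
    rw [integral_const_mul, integral_finsetSum _ h4]
    have h3 : ∀ i, ∫ ω, V n (O i ω) ∂P = ∫ a, V n a ∂Q := fun i => by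
      rw [← hO.law i, integral_map (hO.meas i).aemeasurable]
      rw [hO.law]
      exact (hVi n).aestronglyMeasurable
    rcases eq_or_ne n 0 with rfl | hn
    · simp
    · simp only [h3, Finset.sum_const, Finset.card_range, nsmul_eq_mul]
      rw [inv_mul_cancel_left₀ (by exact_mod_cast hn)]
  -- A Cesàro mean of `(2k + 1) Q(D > k)`, which is at most `3 k Q(D > k)` for `k ≥ 1` and hence
  -- tends to zero.
  have hces : Tendsto (fun n : ℕ => (n : ℝ)⁻¹ *
      ∑ k ∈ Finset.range n, (2 * (k : ℝ) + 1) * Q.real {a | (k : ℝ) < D a}) atTop (𝓝 0) := by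
    refine Tendsto.cesaro ?_
    have h5 : Tendsto (fun n : ℕ => (3 : ℝ) * ((n : ℝ) * Q.real {a | (n : ℝ) < D a})) atTop
        (𝓝 0) := by simpa using ht.const_mul 3
    refine squeeze_zero' (Eventually.of_forall fun k => by positivity) ?_ h5
    filter_upwards [eventually_ge_atTop 1] with k hk
    have hk' : (1 : ℝ) ≤ k := by exact_mod_cast hk
    have := measureReal_nonneg (μ := Q) (s := {a | (k : ℝ) < D a})
    nlinarith
  have hW := tendsto_whp_of_integral (P := P)
    (W := fun n ω => (n : ℝ)⁻¹ * empMean O n ω (V n))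
    (fun n ω => mul_nonneg (by positivity) (empMean_nonneg fun i => hV0 n _))
    (fun n => by
      simp only [empMean, smul_eq_mul]
      have h4 : ∀ i ∈ Finset.range n, Integrable (fun ω => V n (O i ω)) P := fun i _ =>
        (hO.measurePreserving i).integrable_comp_of_integrable (hVi n)
      exact ((integrable_finsetSum _ h4).const_mul _).const_mul _)
    (by simpa only [hWint] using hces)
  refine squeeze_zero' (Eventually.of_forall fun x =>
    mul_nonneg (by positivity) (empMean_nonneg fun i => by positivity)) ?_ hW
  filter_upwards [hmax] with x hx
  unfold empMean
  simp only [smul_eq_mul]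
  gcongr with i hi
  exact sq_le_sum_indicator (h0 _) (hx i (Finset.mem_range.1 hi))

lemma SmallTail.tendsto_empMean_add_sq (hO : IsSample P O Q) {D : A → ℝ} (hD : SmallTail Q D)
    (C : ℝ) :
    Tendsto (fun x : ℕ × Ω => (x.1 : ℝ)⁻¹ * empMean O x.1 x.2 fun a => (D a + C) ^ 2) (whp P)
      (𝓝 0) := by
  have hinv : Tendsto (fun x : ℕ × Ω => (x.1 : ℝ)⁻¹) (whp P) (𝓝 0) :=
    (tendsto_inv_atTop_zero.comp tendsto_natCast_atTop_atTop).comp tendsto_fst_whp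
  have h := ((hD.tendsto_empMean_sq hO).const_mul 2).add (hinv.mul_const (2 * C ^ 2))
  rw [mul_zero, zero_mul, add_zero] at h
  refine squeeze_zero' (Eventually.of_forall fun x =>
    mul_nonneg (by positivity) (empMean_nonneg fun i => by positivity)) ?_ h
  filter_upwards [eventually_whp_of_atTop (eventually_gt_atTop 0)] with x hn
  have hn' : (0 : ℝ) < x.1 := by exact_mod_cast hn
  have hc : empMean O x.1 x.2 (fun _ => 2 * C ^ 2) = 2 * C ^ 2 := by
    simp [empMean, hn'.ne']
  have h1 : (empMean O x.1 x.2 fun a => (D a + C) ^ 2) ≤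
      2 * (empMean O x.1 x.2 fun a => D a ^ 2) + 2 * C ^ 2 := by
    conv_rhs => rw [← hc, ← empMean_mul, ← empMean_add]
    refine empMean_mono fun i => ?_
    nlinarith [sq_nonneg (D (O i x.2) - C)]
  calc _ ≤ (x.1 : ℝ)⁻¹ * (2 * (empMean O x.1 x.2 fun a => D a ^ 2) + 2 * C ^ 2) := by gcongr
    _ = _ := by ring

/-- Markov's inequality on the tail: `n Q(D > n)` is at most the integral of `D` over `{D > n}`. -/
lemma SmallTail.of_integrable [IsFiniteMeasure Q] {D : A → ℝ} (hm : Measurable D) (h0 : ∀ a, 0 ≤ D a)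
    (hi : Integrable D Q) : SmallTail Q D := by
  refine ⟨hm, h0, ?_⟩
  have hset : ∀ k : ℕ, MeasurableSet {a | (k : ℝ) < D a} := fun k =>
    measurableSet_lt measurable_const hm
  have h1 : Tendsto (fun n : ℕ => ∫ a, Set.indicator {a | (n : ℝ) < D a} D a ∂Q) atTop
      (𝓝 (∫ _, (0 : ℝ) ∂Q)) := by
    refine tendsto_integral_of_dominated_convergence D
      (fun n => (hi.indicator (hset n)).aestronglyMeasurable) hi
      (fun n => Eventually.of_forall fun a => ?_) (Eventually.of_forall fun a => ?_)
    · rw [Real.norm_of_nonneg (Set.indicator_nonneg (fun a _ => h0 a) _)]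
      exact Set.indicator_le_self' (fun _ _ => h0 a) a
    · refine tendsto_const_nhds.congr' ?_
      filter_upwards [eventually_ge_atTop ⌈D a⌉₊] with n hn
      rw [Set.indicator_of_notMem]
      exact not_lt.2 (Nat.ceil_le.1 hn)
  rw [integral_zero] at h1
  refine squeeze_zero (fun n => by positivity) (fun n => ?_) h1
  rw [integral_indicator (hset n)]
  exact setIntegral_ge_of_const_le_real (hset n) (measure_ne_top _ _) (fun a ha => le_of_lt ha)
    hi.integrableOn

/-- Functions whose distance to `f` is at most `D` times a quantity of order `n ^ (-1/2)` converge
to `f` in empirical `L²`. -/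
lemma EmpL2.of_lipschitz {D : A → ℝ}
    (hD : Tendsto (fun x : ℕ × Ω => (x.1 : ℝ)⁻¹ * empMean O x.1 x.2 fun a => D a ^ 2) (whp P)
      (𝓝 0))
    {E E' : Type*} [NormedAddCommGroup E] [NormedSpace ℝ E] [NormedAddCommGroup E']
    [NormedSpace ℝ E'] {F : ℕ × Ω → A → E} {f : A → E} {R : ℕ × Ω → E'}
    (hR : BddInProb P fun x => Real.sqrt x.1 • R x)
    (h : ∀ᶠ x in whp P, ∀ i, ‖F x (O i x.2) - f (O i x.2)‖ ≤ D (O i x.2) * ‖R x‖) :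
    EmpL2 P O F f := by
  -- Boundedness in probability is used twice, once for each factor `‖√n R‖` of the square.
  refine EmpL2.of_le (hR _ (hR _ hD)) ?_
  filter_upwards [h, eventually_whp_of_atTop (eventually_gt_atTop 0)] with x hx hn
  have hn' : (0 : ℝ) < x.1 := by exact_mod_cast hn
  have h1 : (empMean O x.1 x.2 fun a => ‖F x a - f a‖ ^ 2) ≤
      ‖R x‖ ^ 2 * empMean O x.1 x.2 fun a => D a ^ 2 := by
    rw [← empMean_mul]
    refine empMean_mono fun i => ?_
    rw [mul_comm, ← mul_pow]
    have := hx i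
    gcongr
  refine h1.trans (le_of_eq ?_)
  rw [norm_smul, Real.norm_of_nonneg (Real.sqrt_nonneg _)]
  have h2 := Real.sq_sqrt hn'.le
  calc ‖R x‖ ^ 2 * empMean O x.1 x.2 (fun a => D a ^ 2)
      = ((x.1 : ℝ)⁻¹ * x.1) * ‖R x‖ ^ 2 * empMean O x.1 x.2 (fun a => D a ^ 2) := by
        rw [inv_mul_cancel₀ hn'.ne', one_mul]
    _ = ((x.1 : ℝ)⁻¹ * Real.sqrt x.1 ^ 2) * ‖R x‖ ^ 2 * empMean O x.1 x.2 (fun a => D a ^ 2) := by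
        rw [h2]
    _ = _ := by ring

end Tail

end

end TwoStage

namespace TwoStage

noncomputable section

set_option linter.unusedSectionVars false

/-! ### A uniform law of large numbers forces small tails of the envelope. -/

section UniformLaw

variable {Ω A : Type*} [MeasurableSpace Ω] [MeasurableSpace A] {P : Measure Ω}
  [IsProbabilityMeasure P] {O : ℕ → Ω → A} {Q : Measure A}

/-- If `n p ≤ 1/4`, the bracket at `m = n` exceeds `1/2` and the claim follows. Otherwise `m p`
would have to cross a forbidden zone just below `1/4` in steps of size `p ≤ 1/16`, which are too
short to jump over it. -/
lemma nat_mul_le_of_quadratic {n : ℕ} {a p p₁ : ℝ} (hp0 : 0 ≤ p) (hp : p ≤ p₁)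
    (hp₁ : p₁ ≤ 1 / 16) (ha : a ≤ 1 / 32)
    (h : ∀ m : ℕ, m ≤ n → m * p * (1 - a - p₁ - m * p) ≤ a) : n * p ≤ 2 * a := by
  rcases le_or_gt (n * p) (1 / 4) with h1 | h1
  · have h2 := h n le_rfl
    have h3 : 0 ≤ (n : ℝ) * p := by positivity
    nlinarith
  · exfalso
    have hp' : 0 < p := by
      rcases hp0.eq_or_lt with h0 | h0
      · rw [← h0] at h1
        norm_num at h1
      · exact h0
    -- The last `m` with `m p ≤ 1/4`; then `m p > 1/4 - p ≥ 3/16`, which contradicts the inequality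
    -- for `m`.
    set m := ⌊1 / (4 * p)⌋₊
    have h2 : (m : ℝ) ≤ 1 / (4 * p) := Nat.floor_le (by positivity)
    have h3 : 1 / (4 * p) < m + 1 := Nat.lt_floor_add_one _
    rw [le_div_iff₀ (by positivity)] at h2
    rw [div_lt_iff₀ (by positivity)] at h3
    have hmn : m ≤ n := by
      have : (m : ℝ) < n := by nlinarith
      exact_mod_cast this.le
    have h4 := h m hmn
    nlinarith

variable {G : Type*} [NormedAddCommGroup G] [NormedSpace ℝ G] [MeasurableSpace G] [BorelSpace G]
  [SecondCountableTopology G] {ι : Type*} [Countable ι]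

lemma measurable_iSup_enorm {g : ι → A → G} (hg : ∀ j, Measurable (g j)) :
    Measurable fun a => ⨆ j, ‖g j a‖ₑ :=
  .iSup fun j => (hg j).enorm

lemma measurable_iSup_enorm_sum {κ : Type*} [Fintype κ] {g : ι → A → G}
    (hg : ∀ j, Measurable (g j)) : Measurable fun u : κ → A => ⨆ j, ‖∑ i, g j (u i)‖ₑ :=
  .iSup fun j => (Finset.measurable_fun_sum _ fun i _ =>
    (hg j).comp (measurable_pi_apply i)).enorm

/-- One big jump: if the envelope of observation `i` exceeds `4t` while the sum of the other
observations has supremum at most `2t`, the full sum has supremum above `t`. Asking that `i` be the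
only large one among the first `m` makes these events disjoint, and independence makes their
probabilities products. -/
lemma IsSample.mul_le_measureReal_iSup (hO : IsSample P O Q) {g : ι → A → G}
    (hg : ∀ j, Measurable (g j)) {n m : ℕ} (hmn : m ≤ n) (t : ℝ≥0∞) :
    m * Q.real {a | 4 * t < ⨆ j, ‖g j a‖ₑ} *
      (1 - P.real {ω | t < ⨆ j, ‖∑ i ∈ Finset.range n, g j (O i ω)‖ₑ}
        - Q.real {a | t < ⨆ j, ‖g j a‖ₑ} - m * Q.real {a | 4 * t < ⨆ j, ‖g j a‖ₑ})
      ≤ P.real {ω | t < ⨆ j, ‖∑ i ∈ Finset.range n, g j (O i ω)‖ₑ} := by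
  set D : A → ℝ≥0∞ := fun a => ⨆ j, ‖g j a‖ₑ with hD
  have hDm : Measurable D := measurable_iSup_enorm hg
  set N : Finset ℕ → Ω → ℝ≥0∞ := fun s ω => ⨆ j, ‖∑ i ∈ s, g j (O i ω)‖ₑ with hN
  have hNm : ∀ s, Measurable (N s) := fun s => .iSup fun j =>
    (Finset.measurable_fun_sum _ fun i _ => (hg j).comp (hO.meas i)).enorm
  have hset : ∀ c, MeasurableSet {a | c < D a} := fun c => measurableSet_lt measurable_const hDm
  set a := P.real {ω | t < N (Finset.range n) ω}
  set p := Q.real {a | 4 * t < D a}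
  set p₁ := Q.real {a | t < D a}
  set T : ℕ → Finset ℕ := fun i => (Finset.range n).erase i with hT
  -- This event does not involve `O i`. The full sum and the envelope of `O i` being at most `t`,
  -- together with no envelope above `4t` among the first `m`, imply it, whence the lower bound on
  -- its probability.
  set F : ℕ → Set Ω := fun i =>
    {ω | N (T i) ω ≤ 2 * t ∧ ∀ j < m, j ≠ i → D (O j ω) ≤ 4 * t} with hF
  have hsplit : ∀ i < n, ∀ ω j, ∑ k ∈ Finset.range n, g j (O k ω)
      = g j (O i ω) + ∑ k ∈ T i, g j (O k ω) := fun i hi ω j =>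
    (Finset.add_sum_erase _ (fun k => g j (O k ω)) (Finset.mem_range.2 hi)).symm
  have hle1 : ∀ i < n, ∀ ω, N (T i) ω ≤ N (Finset.range n) ω + D (O i ω) := by
    intro i hi ω
    refine iSup_le fun j => ?_
    have e : ∑ k ∈ T i, g j (O k ω) = ∑ k ∈ Finset.range n, g j (O k ω) - g j (O i ω) := by
      rw [hsplit i hi]
      abel
    rw [e]
    refine enorm_sub_le.trans (add_le_add ?_ ?_)
    · exact le_iSup (fun j => ‖∑ k ∈ Finset.range n, g j (O k ω)‖ₑ) j
    · exact le_iSup (fun j => ‖g j (O i ω)‖ₑ) j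
  have hle2 : ∀ i < n, ∀ ω, D (O i ω) ≤ N (Finset.range n) ω + N (T i) ω := by
    intro i hi ω
    refine iSup_le fun j => ?_
    have e : g j (O i ω) = ∑ k ∈ Finset.range n, g j (O k ω) - ∑ k ∈ T i, g j (O k ω) := by
      rw [hsplit i hi]
      abel
    rw [e]
    refine enorm_sub_le.trans (add_le_add ?_ ?_)
    · exact le_iSup (fun j => ‖∑ k ∈ Finset.range n, g j (O k ω)‖ₑ) j
    · exact le_iSup (fun j => ‖∑ k ∈ T i, g j (O k ω)‖ₑ) j
  have hFm : ∀ i, MeasurableSet (F i) := by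
    intro i
    have e : F i = {ω | N (T i) ω ≤ 2 * t} ∩ ⋂ j, ⋂ (_ : j < m), ⋂ (_ : j ≠ i),
        {ω | D (O j ω) ≤ 4 * t} := by
      ext ω
      simp [hF]
    rw [e]
    refine (measurableSet_le (hNm _) measurable_const).inter ?_
    exact MeasurableSet.iInter fun j => .iInter fun _ => .iInter fun _ =>
      measurableSet_le (hDm.comp (hO.meas j)) measurable_const
  have hFP : ∀ i < m, 1 - a - p₁ - m * p ≤ P.real (F i) := by
    intro i hi
    have h1 : (F i)ᶜ ⊆ ({ω | t < N (Finset.range n) ω} ∪ {ω | O i ω ∈ {a | t < D a}}) ∪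
        ⋃ j ∈ Finset.range m, {ω | O j ω ∈ {a | 4 * t < D a}} := by
      intro ω hω
      by_contra hc
      simp only [Set.mem_union, Set.mem_ofPred_eq, Set.mem_iUnion, not_or, not_lt,
        not_exists, Finset.mem_range] at hc
      obtain ⟨⟨h2, h3⟩, h4⟩ := hc
      refine hω ⟨(hle1 i (hi.trans_le hmn) ω).trans ?_, fun j hj _ => h4 j hj⟩
      rw [two_mul]
      exact add_le_add h2 h3
    have h2 : P.real (F i)ᶜ ≤ a + p₁ + m * p := by
      refine (measureReal_mono h1).trans ((measureReal_union_le _ _).trans (add_le_add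
        ((measureReal_union_le _ _).trans (add_le_add le_rfl ?_))
        ((measureReal_biUnion_finset_le _ _).trans ?_)))
      · rw [hO.measureReal_preimage i (hset _)]
      · rw [Finset.sum_congr rfl fun j _ => hO.measureReal_preimage j (hset _)]
        simp [p]
    rw [probReal_compl_eq_one_sub (hFm i)] at h2
    linarith
  have hind : ∀ i < m, P.real ({ω | O i ω ∈ {a | 4 * t < D a}} ∩ F i) = p * P.real (F i) := by
    intro i hi
    have hdisj : Disjoint {i} (T i) := by
      rw [Finset.disjoint_singleton_left, hT]
      exact Finset.notMem_erase _ _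
    have h1 := hO.indep.indepFun_finset {i} (T i) hdisj hO.meas
    set S₁ : Set (↥({i} : Finset ℕ) → A) := {u | 4 * t < D (u ⟨i, Finset.mem_singleton_self i⟩)}
    set S₂ : Set (↥(T i) → A) := {u | (⨆ j, ‖∑ k, g j (u k)‖ₑ) ≤ 2 * t ∧
      ∀ k : ↥(T i), k.1 < m → D (u k) ≤ 4 * t}
    have hS₁ : MeasurableSet S₁ :=
      measurableSet_lt measurable_const (hDm.comp (measurable_pi_apply _))
    have hS₂ : MeasurableSet S₂ := by
      have e : S₂ = {u | (⨆ j, ‖∑ k, g j (u k)‖ₑ) ≤ 2 * t} ∩ ⋂ k : ↥(T i), ⋂ (_ : k.1 < m),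
          {u | D (u k) ≤ 4 * t} := by
        ext ω
        simp [S₂]
      rw [e]
      refine (measurableSet_le (measurable_iSup_enorm_sum hg) measurable_const).inter ?_
      exact MeasurableSet.iInter fun k => .iInter fun _ =>
        measurableSet_le (hDm.comp (measurable_pi_apply k)) measurable_const
    have h2 := h1.measure_inter_preimage_eq_mul S₁ S₂ hS₁ hS₂
    have e1 : (fun ω (k : ↥({i} : Finset ℕ)) => O k ω) ⁻¹' S₁ = {ω | O i ω ∈ {a | 4 * t < D a}} :=
      rfl
    have e2 : (fun ω (k : ↥(T i)) => O k ω) ⁻¹' S₂ = F i := by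
      ext ω
      simp only [S₂, hF, Set.mem_preimage, Set.mem_ofPred_eq, hN]
      refine and_congr ?_ ⟨fun h j hj hji => h ⟨j, ?_⟩ hj, fun h k hk => h k.1 hk ?_⟩
      · have e3 : ∀ j, ∑ k : ↥(T i), g j (O k ω) = ∑ k ∈ T i, g j (O k ω) := fun j =>
          Finset.sum_coe_sort (T i) (fun k => g j (O k ω))
        simp only [e3]
      · exact Finset.mem_erase.2 ⟨hji, Finset.mem_range.2 (hj.trans_le hmn)⟩
      · exact Finset.ne_of_mem_erase k.2
    rw [e1, e2] at h2
    rw [measureReal_def, h2, ENNReal.toReal_mul, ← measureReal_def, ← measureReal_def,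
      hO.measureReal_preimage i (hset _)]
  have hdisj : Set.PairwiseDisjoint (Finset.range m : Set ℕ)
      fun i => {ω | O i ω ∈ {a | 4 * t < D a}} ∩ F i := by
    intro i hi j hj hij
    refine Set.disjoint_left.2 fun ω h1 h2 => ?_
    exact absurd (h2.2.2 i (Finset.mem_range.1 hi) hij) (not_le.2 h1.1)
  have hsub : (⋃ i ∈ Finset.range m, {ω | O i ω ∈ {a | 4 * t < D a}} ∩ F i) ⊆
      {ω | t < N (Finset.range n) ω} := by
    intro ω hω
    simp only [Set.mem_iUnion, Finset.mem_range] at hω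
    obtain ⟨i, hi, h1, h2⟩ := hω
    by_contra hc
    have hc' : N (Finset.range n) ω ≤ t := not_lt.1 hc
    refine absurd (hle2 i (hi.trans_le hmn) ω) (not_le.2 (lt_of_le_of_lt ?_ h1))
    calc N (Finset.range n) ω + N (T i) ω ≤ t + 2 * t := add_le_add hc' h2.1
      _ ≤ 4 * t := by
          rw [← one_add_mul]
          gcongr
          norm_num
  have hmeas := measureReal_mono (μ := P) hsub
  rw [measureReal_biUnion_finset hdisj fun i _ => ((hO.meas i) (hset _)).inter (hFm i)] at hmeas
  refine le_trans ?_ hmeas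
  rw [Finset.sum_congr rfl fun i hi => hind i (Finset.mem_range.1 hi)]
  calc (m : ℝ) * p * (1 - a - p₁ - m * p) = ∑ i ∈ Finset.range m, p * (1 - a - p₁ - m * p) := by
        simp [mul_assoc]
    _ ≤ _ := Finset.sum_le_sum fun i hi =>
        mul_le_mul_of_nonneg_left (hFP i (Finset.mem_range.1 hi)) measureReal_nonneg

/-- If a uniform law of large numbers holds in probability, then the envelope has small tails. -/
lemma IsSample.smallTail_of_uniform (hO : IsSample P O Q) {g : ι → A → G}
    (hg : ∀ j, Measurable (g j)) (hfin : ∀ᵐ a ∂Q, ⨆ j, ‖g j a‖ₑ < ∞)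
    (hu : ∀ δ > 0, ∀ᶠ x in whp P, ∀ j, ‖empMean O x.1 x.2 (g j)‖ < δ) :
    SmallTail Q fun a => (⨆ j, ‖g j a‖ₑ).toReal := by
  have := hO.isProbabilityMeasure
  have hDm : Measurable fun a => ⨆ j, ‖g j a‖ₑ := measurable_iSup_enorm hg
  refine ⟨hDm.ennreal_toReal, fun _ => ENNReal.toReal_nonneg, ?_⟩
  -- The level is `t = n / 4`: then `4t = n` is the level in the tail of the envelope, and `a n` is
  -- the probability that some average exceeds `1/4` in norm.
  set a : ℕ → ℝ := fun n =>
    P.real {ω | (n / 4 : ℝ≥0∞) < ⨆ j, ‖∑ i ∈ Finset.range n, g j (O i ω)‖ₑ}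
  set p₁ : ℕ → ℝ := fun n => Q.real {a | (n / 4 : ℝ≥0∞) < ⨆ j, ‖g j a‖ₑ}
  set p : ℕ → ℝ := fun n => Q.real {a | (4 * (n / 4) : ℝ≥0∞) < ⨆ j, ‖g j a‖ₑ}
  have hn4 : ∀ n : ℕ, (4 * (n / 4) : ℝ≥0∞) = n := fun n =>
    ENNReal.mul_div_cancel (by norm_num) (by norm_num)
  have ha : Tendsto a atTop (𝓝 0) := by
    have h1 := hu (1 / 4) (by norm_num)
    rw [eventually_whp (p := fun n ω => ∀ j, ‖empMean O n ω (g j)‖ < 1 / 4)] at h1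
    have h2 : Tendsto (fun n => P.real {ω | ¬ ∀ j, ‖empMean O n ω (g j)‖ < 1 / 4}) atTop (𝓝 0) :=
      (ENNReal.tendsto_toReal ENNReal.zero_ne_top).comp h1
    refine squeeze_zero' (Eventually.of_forall fun n => measureReal_nonneg) ?_ h2
    filter_upwards [eventually_gt_atTop 0] with n hn
    refine measureReal_mono fun ω hω hc => ?_
    have hn' : (0 : ℝ) < n := by exact_mod_cast hn
    rw [Set.mem_ofPred_eq] at hω
    refine absurd hω (not_lt.2 (iSup_le fun j => ?_))
    have h3 := hc j
    rw [empMean, norm_smul, norm_inv, Real.norm_natCast, inv_mul_lt_iff₀ hn'] at h3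
    rw [← ofReal_norm, show (n / 4 : ℝ≥0∞) = ENNReal.ofReal (n / 4) by
      rw [ENNReal.ofReal_div_of_pos (by norm_num), ENNReal.ofReal_natCast]; norm_num]
    exact ENNReal.ofReal_le_ofReal (by linarith)
  -- Only here is almost sure finiteness of the envelope needed.
  have hp₁ : Tendsto p₁ atTop (𝓝 0) := by
    have h1 := tendsto_measure_of_ae_tendsto_indicator_of_isFiniteMeasure (μ := Q) atTop
      (A := ∅) (As := fun n : ℕ => {a | (n / 4 : ℝ≥0∞) < ⨆ j, ‖g j a‖ₑ}) MeasurableSet.empty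
      (fun n => measurableSet_lt measurable_const hDm) ?_
    · rw [measure_empty] at h1
      exact (ENNReal.tendsto_toReal ENNReal.zero_ne_top).comp h1
    · filter_upwards [hfin] with b hb
      have h2 : Tendsto (fun n : ℕ => (n / 4 : ℝ≥0∞)) atTop (𝓝 ∞) := by
        have := ENNReal.Tendsto.div_const (b := 4) ENNReal.tendsto_nat_nhds_top
          (Or.inr (by norm_num))
        rwa [ENNReal.top_div_of_ne_top (by norm_num)] at this
      filter_upwards [h2.eventually_const_lt hb] with n hn
      simpa using fun i => (le_iSup (fun j => ‖g j b‖ₑ) i).trans hn.le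
  have key : Tendsto (fun n : ℕ => (n : ℝ) * p n) atTop (𝓝 0) := by
    have h0 : Tendsto (fun n => 2 * a n) atTop (𝓝 0) := by simpa using ha.const_mul 2
    refine squeeze_zero' (Eventually.of_forall fun n => by positivity) ?_ h0
    filter_upwards [ha.eventually_le_const (show (0 : ℝ) < 1 / 32 by norm_num),
      hp₁.eventually_le_const (show (0 : ℝ) < 1 / 16 by norm_num)] with n h1 h2
    refine nat_mul_le_of_quadratic (p₁ := p₁ n) measureReal_nonneg ?_ h2 h1 fun m hm =>
      hO.mul_le_measureReal_iSup hg hm _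
    refine measureReal_mono fun b hb => ?_
    rw [Set.mem_ofPred_eq] at hb ⊢
    refine lt_of_le_of_lt ?_ hb
    rw [hn4]
    exact ENNReal.div_le_of_le_mul (le_mul_of_one_le_right zero_le (by norm_num))
  refine squeeze_zero (fun n => by positivity) (fun n => ?_) key
  gcongr
  refine measureReal_mono fun b hb => ?_
  rw [Set.mem_ofPred_eq] at hb ⊢
  rw [hn4]
  by_contra hc
  have h1 : (⨆ j, ‖g j b‖ₑ).toReal ≤ ((n : ℝ≥0∞)).toReal :=
    ENNReal.toReal_mono (ENNReal.natCast_ne_top n) (not_lt.1 hc)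
  rw [ENNReal.toReal_natCast] at h1
  exact absurd hb (not_lt.2 h1)

end UniformLaw

end

end TwoStage

namespace TwoStage

noncomputable section

set_option linter.unusedSectionVars false

/-! ### Measurable suprema and plug-in estimates for dominated continuous families. -/

section DenseSup

open TopologicalSpace

variable {A E₀ G : Type*} [NormedAddCommGroup E₀] [SeparableSpace E₀] [NormedAddCommGroup G]

/-- The supremum of `‖f θ a‖` over a countable dense subset of the `θ`, restricted to `s`. -/
def denseSup (s : Set E₀) (f : E₀ → A → G) (a : A) : ℝ≥0∞ :=
  ⨆ j : {n // denseSeq E₀ n ∈ s}, ‖f (denseSeq E₀ j) a‖ₑ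

/-- Openness of `s` lets dense points inside `s` approach every point of `s`; with continuity, a
countable and hence measurable supremum bounds all parameters. -/
lemma enorm_le_denseSup {s : Set E₀} (hs : IsOpen s) {f : E₀ → A → G} {a : A}
    (hf : ContinuousOn (fun θ => f θ a) s) {θ : E₀} (hθ : θ ∈ s) :
    ‖f θ a‖ₑ ≤ denseSup s f a := by
  have h1 : θ ∈ closure (s ∩ Set.range (denseSeq E₀)) :=
    (denseRange_denseSeq E₀).open_subset_closure_inter hs hθ
  have := mem_closure_iff_nhdsWithin_neBot.1 h1
  have h2 : Tendsto (fun θ => ‖f θ a‖ₑ) (𝓝[s ∩ Set.range (denseSeq E₀)] θ) (𝓝 ‖f θ a‖ₑ) :=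
    ((hf θ hθ).mono Set.inter_subset_left).enorm
  refine le_of_tendsto h2 ?_
  filter_upwards [self_mem_nhdsWithin] with t ht
  obtain ⟨hts, n, rfl⟩ := ht
  exact le_iSup (fun j : {n // denseSeq E₀ n ∈ s} => ‖f (denseSeq E₀ j) a‖ₑ) ⟨n, hts⟩

lemma denseSup_le {s : Set E₀} {f : E₀ → A → G} {a : A} {C : ℝ≥0∞}
    (h : ∀ θ ∈ s, ‖f θ a‖ₑ ≤ C) : denseSup s f a ≤ C :=
  iSup_le fun j => h _ j.2

lemma measurable_denseSup [MeasurableSpace A] [MeasurableSpace G] [BorelSpace G] {s : Set E₀}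
    {f : E₀ → A → G} (hf : ∀ θ ∈ s, Measurable (f θ)) : Measurable (denseSup s f) :=
  .iSup fun j => (hf _ j.2).enorm

end DenseSup

section LocallyRegular

variable {Ω A : Type*} [MeasurableSpace Ω] [MeasurableSpace A] {P : Measure Ω}
  [IsProbabilityMeasure P] {O : ℕ → Ω → A} {Q : Measure A} {d : ℕ}

/-- The oscillation of `ψ` over shrinking balls tends to zero pointwise and is dominated by `2F`, so
its second moment vanishes. The law of large numbers is applied for one fixed small ball, which
contains `T` with probability tending to one; no rate for `T` is required. -/
lemma LocallyRegular.empL2 (hO : IsSample P O Q) {θ₀ : Vec d} {ψ : Vec d → A → Vec d}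
    (hψ : LocallyRegular Q θ₀ ψ) {T : ℕ × Ω → Vec d} (hT : Tendsto T (whp P) (𝓝 θ₀)) :
    EmpL2 P O (fun x => ψ (T x)) (ψ θ₀) := by
  obtain ⟨ρ, hρ, F, hF2, hm, hae⟩ := hψ
  have hQ := hO.isProbabilityMeasure
  set r : ℕ → ℝ := fun k => ρ / (k + 1) with hr
  have hr0 : ∀ k, 0 < r k := fun k => by positivity
  have hrρ : ∀ k, r k ≤ ρ := fun k => div_le_self hρ.le (by simp)
  have hsub : ∀ k, Metric.ball θ₀ (r k) ⊆ Metric.ball θ₀ ρ := fun k =>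
    Metric.ball_subset_ball (hrρ k)
  have hθ₀ : θ₀ ∈ Metric.ball θ₀ ρ := Metric.mem_ball_self hρ
  set f : Vec d → A → Vec d := fun θ a => ψ θ a - ψ θ₀ a
  set w : ℕ → A → ℝ≥0∞ := fun k => denseSup (Metric.ball θ₀ (r k)) f
  have hwm : ∀ k, Measurable (w k) := fun k =>
    measurable_denseSup fun θ hθ => (hm θ (hsub k hθ)).sub (hm θ₀ hθ₀)
  have hwF : ∀ᵐ a ∂Q, ∀ k, w k a ≤ ENNReal.ofReal (2 * F a) := by
    filter_upwards [hae] with a ha k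
    refine denseSup_le fun θ hθ => ?_
    rw [← ofReal_norm]
    refine ENNReal.ofReal_le_ofReal ((norm_sub_le _ _).trans ?_)
    linarith [ha.2 θ (hsub k hθ), ha.2 θ₀ hθ₀]
  have hle : ∀ᵐ a ∂Q, ∀ k, ∀ θ ∈ Metric.ball θ₀ (r k), ‖ψ θ a - ψ θ₀ a‖ ≤ (w k a).toReal := by
    filter_upwards [hae, hwF] with a ha haF k θ hθ
    rw [← toReal_enorm]
    refine ENNReal.toReal_mono (ne_top_of_le_ne_top ENNReal.ofReal_ne_top (haF k)) ?_
    exact enorm_le_denseSup (f := f) Metric.isOpen_ball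
      ((ha.1.mono (hsub k)).sub continuousOn_const) hθ
  have hlim : ∀ᵐ a ∂Q, Tendsto (fun k => (w k a).toReal) atTop (𝓝 0) := by
    filter_upwards [hae] with a ha
    rw [Metric.tendsto_nhds]
    intro ε hε
    have hc : ContinuousAt (fun θ => ψ θ a) θ₀ :=
      ha.1.continuousAt (Metric.isOpen_ball.mem_nhds hθ₀)
    obtain ⟨η, hη, hη'⟩ := Metric.continuousAt_iff.1 hc (ε / 2) (by positivity)
    have hrk : Tendsto r atTop (𝓝 0) := by
      have := (tendsto_one_div_add_atTop_nhds_zero_nat (𝕜 := ℝ)).const_mul ρ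
      simpa [hr, div_eq_mul_inv] using this
    filter_upwards [hrk.eventually_lt_const hη] with k hk
    rw [Real.dist_eq, sub_zero, abs_of_nonneg ENNReal.toReal_nonneg]
    refine lt_of_le_of_lt ?_ (half_lt_self hε)
    refine ENNReal.toReal_le_of_le_ofReal (by positivity) (denseSup_le fun θ hθ => ?_)
    rw [← ofReal_norm]
    refine ENNReal.ofReal_le_ofReal ?_
    have := hη' ((Metric.mem_ball.1 hθ).trans hk)
    rw [dist_eq_norm] at this
    exact this.le
  have hbound : ∀ k, ∀ᵐ a ∂Q, ‖(w k a).toReal ^ 2‖ ≤ (2 * F a) ^ 2 := by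
    intro k
    filter_upwards [hwF, hae] with a ha ha'
    have hF0 : 0 ≤ 2 * F a := by linarith [(norm_nonneg _).trans (ha'.2 θ₀ hθ₀)]
    rw [Real.norm_of_nonneg (by positivity)]
    have := ENNReal.toReal_le_of_le_ofReal hF0 (ha k)
    gcongr
  have hFi : Integrable (fun a => (2 * F a) ^ 2) Q := (hF2.const_mul 2).integrable_sq
  have hwi : ∀ k, Integrable (fun a => (w k a).toReal ^ 2) Q := fun k =>
    hFi.mono' ((hwm k).ennreal_toReal.pow_const 2).aestronglyMeasurable (hbound k)
  have hint : Tendsto (fun k => ∫ a, (w k a).toReal ^ 2 ∂Q) atTop (𝓝 (∫ _, (0 : ℝ) ∂Q)) := by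
    refine tendsto_integral_of_dominated_convergence _ (fun k => (hwi k).aestronglyMeasurable) hFi
      hbound ?_
    filter_upwards [hlim] with a ha
    simpa using ha.pow 2
  rw [integral_zero] at hint
  rw [EmpL2, Metric.tendsto_nhds]
  intro ε hε
  obtain ⟨k, hk⟩ := (hint.eventually_lt_const hε).exists
  filter_upwards [(hO.tendsto_empMean (hwi k)).eventually_lt_const hk, hO.whp_ae hle,
    hT (Metric.ball_mem_nhds θ₀ (hr0 k))] with x h1 h2 h3
  rw [Real.dist_eq, sub_zero, abs_of_nonneg (empMean_nonneg fun i => by positivity)]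
  refine lt_of_le_of_lt (empMean_mono fun i => ?_) h1
  have := h2 i k (T x) h3
  gcongr

end LocallyRegular

/-! ### Consequences of a uniform law for derivatives. -/

section UniformDerivative

variable {Ω A : Type*} [MeasurableSpace Ω] [MeasurableSpace A] {P : Measure Ω}
  [IsProbabilityMeasure P] {O : ℕ → Ω → A} {Q : Measure A}
  {E₀ G : Type*} [NormedAddCommGroup E₀] [NormedSpace ℝ E₀] [FiniteDimensional ℝ E₀]
  [NormedAddCommGroup G] [NormedSpace ℝ G] [FiniteDimensional ℝ G]

lemma hasFDerivAt_empMean {u : E₀ → A → G} {u' : A → E₀ →L[ℝ] G} {n : ℕ} {ω : Ω} {θ : E₀}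
    (h : ∀ i, HasFDerivAt (fun t => u t (O i ω)) (u' (O i ω)) θ) :
    HasFDerivAt (fun t => empMean O n ω (u t)) (empMean O n ω u') θ := by
  unfold empMean
  exact (HasFDerivAt.fun_sum fun i _ => h i).const_smul _

/-- The contributions `u θ` are twice continuously differentiable in `θ ∈ N`, with integrable
derivative whose averages converge uniformly in probability. -/
structure UniformDeriv (P : Measure Ω) (O : ℕ → Ω → A) (Q : Measure A) (u : E₀ → A → G)
    (N : Set E₀) : Prop where
  isOpen : IsOpen N
  contDiffOn : ∀ᵐ a ∂Q, ContDiffOn ℝ 2 (fun θ => u θ a) N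
  integrable : ∀ θ ∈ N, Integrable (fun a => fderiv ℝ (fun t => u t a) θ) Q
  uniform : ∀ δ > 0, ∀ᶠ x in whp P, ∀ θ ∈ N,
    ‖empMean O x.1 x.2 (fun a => fderiv ℝ (fun t => u t a) θ)
      - ∫ a, fderiv ℝ (fun t => u t a) θ ∂Q‖ < δ

namespace UniformDeriv

variable {u : E₀ → A → G} {N : Set E₀} {θ₀ : E₀}

lemma ae_differentiableAt (h : UniformDeriv P O Q u N) :
    ∀ᵐ a ∂Q, ∀ θ ∈ N, DifferentiableAt ℝ (fun θ => u θ a) θ := by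
  filter_upwards [h.contDiffOn] with a ha θ hθ
  exact (ha.contDiffAt (h.isOpen.mem_nhds hθ)).differentiableAt two_ne_zero

lemma ae_continuousOn (h : UniformDeriv P O Q u N) :
    ∀ᵐ a ∂Q, ContinuousOn (fun θ => fderiv ℝ (fun t => u t a) θ) N := by
  filter_upwards [h.contDiffOn] with a ha
  exact ha.continuousOn_fderiv_of_isOpen h.isOpen one_le_two

/-- A uniform limit of continuous functions is continuous: a single `(n, ω)` with uniformly close
and continuous empirical mean suffices. No domination of the derivative is assumed. -/
lemma continuousAt_integral (hO : IsSample P O Q) (h : UniformDeriv P O Q u N) (hθ₀ : θ₀ ∈ N) :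
    ContinuousAt (fun θ => ∫ a, fderiv ℝ (fun t => u t a) θ ∂Q) θ₀ := by
  rw [Metric.continuousAt_iff']
  intro ε hε
  obtain ⟨x, hx1, hx2⟩ := ((h.uniform (ε / 3) (by positivity)).and
    (hO.whp_ae h.ae_continuousOn)).exists
  have hc : ContinuousAt (fun θ => empMean O x.1 x.2 fun a => fderiv ℝ (fun t => u t a) θ) θ₀ := by
    unfold empMean
    exact (tendsto_finsetSum _ fun i _ =>
      ((hx2 i).continuousAt (h.isOpen.mem_nhds hθ₀))).const_smul _
  filter_upwards [Metric.continuousAt_iff'.1 hc (ε / 3) (by positivity),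
    h.isOpen.mem_nhds hθ₀] with θ h1 h2
  have h3 := hx1 θ h2
  have h4 := hx1 θ₀ hθ₀
  rw [← dist_eq_norm] at h3 h4
  rw [dist_comm] at h3
  calc _ ≤ _ + _ + _ := dist_triangle4 _ _ _ _
    _ < ε / 3 + ε / 3 + ε / 3 := by gcongr
    _ = ε := by ring

lemma exists_ball (hO : IsSample P O Q) (h : UniformDeriv P O Q u N) (hθ₀ : θ₀ ∈ N) {ε : ℝ}
    (hε : 0 < ε) :
    ∃ r > 0, Metric.ball θ₀ r ⊆ N ∧ ∀ᶠ x in whp P, ∀ θ ∈ Metric.ball θ₀ r,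
      ‖empMean O x.1 x.2 (fun a => fderiv ℝ (fun t => u t a) θ)
        - ∫ a, fderiv ℝ (fun t => u t a) θ₀ ∂Q‖ < ε := by
  obtain ⟨r₁, hr₁, h1⟩ := Metric.isOpen_iff.1 h.isOpen θ₀ hθ₀
  obtain ⟨r₂, hr₂, h2⟩ := Metric.continuousAt_iff.1 (h.continuousAt_integral hO hθ₀) (ε / 2)
    (by positivity)
  refine ⟨min r₁ r₂, lt_min hr₁ hr₂, (Metric.ball_subset_ball (min_le_left _ _)).trans h1, ?_⟩
  filter_upwards [h.uniform (ε / 2) (by positivity)] with x hx θ hθ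
  have h3 := hx θ (h1 (Metric.ball_subset_ball (min_le_left _ _) hθ))
  have h4 := h2 (Metric.ball_subset_ball (min_le_right _ _) hθ)
  rw [← dist_eq_norm] at h3 ⊢
  calc _ ≤ _ + _ := dist_triangle _ _ _
    _ < ε / 2 + ε / 2 := by gcongr
    _ = ε := by ring

/-- The derivative has an envelope near `θ₀` whose empirical second moments are `o(n)`. -/
lemma exists_envelope (hO : IsSample P O Q) (h : UniformDeriv P O Q u N) (hθ₀ : θ₀ ∈ N) :
    ∃ r > 0, Metric.ball θ₀ r ⊆ N ∧ ∃ D : A → ℝ,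
      Tendsto (fun x : ℕ × Ω => (x.1 : ℝ)⁻¹ * empMean O x.1 x.2 fun a => D a ^ 2) (whp P)
        (𝓝 0) ∧
      ∀ᵐ a ∂Q, ∀ θ ∈ Metric.ball θ₀ r, ‖fderiv ℝ (fun t => u t a) θ‖ ≤ D a := by
  have hc := h.continuousAt_integral hO hθ₀
  set g : E₀ → E₀ →L[ℝ] G := fun θ => ∫ a, fderiv ℝ (fun t => u t a) θ ∂Q
  obtain ⟨r₁, hr₁, h1⟩ := Metric.isOpen_iff.1 h.isOpen θ₀ hθ₀
  obtain ⟨r₂, hr₂, h2⟩ := Metric.continuousAt_iff.1 hc 1 one_pos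
  -- Halving keeps a compact closed ball inside `N`, on which the derivative is bounded for almost
  -- every `a`; `r₂` keeps the expected derivative bounded.
  set r := min (r₁ / 2) r₂ with hr
  have hr0 : 0 < r := lt_min (by positivity) hr₂
  have hcb : Metric.closedBall θ₀ r ⊆ N :=
    (Metric.closedBall_subset_ball ((min_le_left _ _).trans_lt (half_lt_self hr₁))).trans h1
  have hbN : Metric.ball θ₀ r ⊆ N := Metric.ball_subset_closedBall.trans hcb
  set s := Metric.ball θ₀ r
  set ι := {n // TopologicalSpace.denseSeq E₀ n ∈ s}
  set θs : ι → E₀ := fun j => TopologicalSpace.denseSeq E₀ j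
  have hθs : ∀ j, θs j ∈ N := fun j => hbN j.2
  borelize (E₀ →L[ℝ] G)
  -- Derivatives are only almost everywhere measurable. Measurable versions are taken at countably
  -- many parameters, so one null set covers all.
  set w : ι → A → (E₀ →L[ℝ] G) := fun j => (h.integrable (θs j) (hθs j)).1.mk _
  have hwm : ∀ j, Measurable (w j) := fun j =>
    (h.integrable (θs j) (hθs j)).1.stronglyMeasurable_mk.measurable
  have hw : ∀ᵐ a ∂Q, ∀ j, w j a = fderiv ℝ (fun t => u t a) (θs j) :=
    ae_all_iff.2 fun j => (h.integrable (θs j) (hθs j)).1.ae_eq_mk.symm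
  set C := ‖g θ₀‖ + 1
  have hgC : ∀ θ ∈ s, ‖g θ‖ ≤ C := by
    intro θ hθ
    have h3 := h2 (Metric.ball_subset_ball (min_le_right _ _) hθ)
    rw [dist_eq_norm] at h3
    have := norm_le_norm_add_norm_sub' (g θ) (g θ₀)
    linarith
  have hgm : ∀ j, Measurable fun a => w j a - g (θs j) := fun j => (hwm j).sub_const _
  have hfin : ∀ᵐ a ∂Q, ⨆ j, ‖w j a - g (θs j)‖ₑ < ∞ := by
    filter_upwards [hw, h.ae_continuousOn] with a ha hca
    obtain ⟨B, hB⟩ := (isCompact_closedBall θ₀ r).exists_bound_of_continuousOn (hca.mono hcb)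
    refine lt_of_le_of_lt (iSup_le fun j => ?_) (ENNReal.ofReal_lt_top (r := B + C))
    rw [← ofReal_norm, ha]
    exact ENNReal.ofReal_le_ofReal ((norm_sub_le _ _).trans (add_le_add
      (hB _ (Metric.ball_subset_closedBall j.2)) (hgC _ j.2)))
  have hu : ∀ δ > 0, ∀ᶠ x in whp P, ∀ j, ‖empMean O x.1 x.2 (fun a => w j a - g (θs j))‖ < δ := by
    intro δ hδ
    filter_upwards [h.uniform δ hδ, hO.whp_ae hw,
      eventually_whp_of_atTop (eventually_gt_atTop 0)] with x hx hx2 hn j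
    have hn' : (x.1 : ℝ) ≠ 0 := by
      have : 0 < x.1 := hn
      positivity
    have e1 : empMean O x.1 x.2 (w j)
        = empMean O x.1 x.2 fun a => fderiv ℝ (fun t => u t a) (θs j) :=
      empMean_congr fun i => hx2 i j
    have e2 : empMean O x.1 x.2 (fun _ => g (θs j)) = g (θs j) := by
      simp only [empMean, Finset.sum_const, Finset.card_range]
      rw [← Nat.cast_smul_eq_nsmul ℝ, inv_smul_smul₀ hn']
    rw [empMean_sub, e1, e2]
    exact hx (θs j) (hθs j)
  have hST := hO.smallTail_of_uniform hgm hfin hu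
  -- The small tails are those of the centred derivatives; adding the constant `C` undoes the
  -- centring.
  refine ⟨r, hr0, hbN, _, hST.tendsto_empMean_add_sq hO C, ?_⟩
  filter_upwards [hw, h.ae_continuousOn, hfin] with a ha hca hfa θ hθ
  have h5 : ‖fderiv ℝ (fun t => u t a) θ‖ₑ ≤
      (⨆ j, ‖w j a - g (θs j)‖ₑ) + ENNReal.ofReal C := by
    refine (enorm_le_denseSup (f := fun θ a => fderiv ℝ (fun t => u t a) θ) Metric.isOpen_ball
      (hca.mono hbN) hθ).trans (iSup_le fun j => ?_)
    have e : fderiv ℝ (fun t => u t a) (θs j) = (w j a - g (θs j)) + g (θs j) := by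
      rw [ha]
      abel
    have h7 : ‖fderiv ℝ (fun t => u t a) (θs j)‖ ≤ ‖w j a - g (θs j)‖ + C := by
      rw [e]
      exact (norm_add_le _ _).trans (add_le_add le_rfl (hgC _ j.2))
    change ‖fderiv ℝ (fun t => u t a) (θs j)‖ₑ ≤ _
    rw [← ofReal_norm]
    refine (ENNReal.ofReal_le_ofReal h7).trans ?_
    rw [ENNReal.ofReal_add (norm_nonneg _) (by positivity), ofReal_norm]
    exact add_le_add (le_iSup (fun j => ‖w j a - g (θs j)‖ₑ) j) le_rfl
  have h6 := ENNReal.toReal_mono (ENNReal.add_ne_top.2 ⟨hfa.ne, ENNReal.ofReal_ne_top⟩) h5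
  rwa [toReal_enorm, ENNReal.toReal_add hfa.ne ENNReal.ofReal_ne_top,
    ENNReal.toReal_ofReal (by positivity)] at h6

end UniformDeriv

/-- Plugging a `√n`-consistent estimate into contributions that are differentiable in the
parameter, with an envelope for the derivative. -/
lemma EmpL2.of_envelope (hO : IsSample P O Q) {u : E₀ → A → G} {θ₀ : E₀} {r : ℝ} (hr : 0 < r)
    {D : A → ℝ}
    (hD : Tendsto (fun x : ℕ × Ω => (x.1 : ℝ)⁻¹ * empMean O x.1 x.2 fun a => D a ^ 2) (whp P)
      (𝓝 0))
    (hd : ∀ᵐ a ∂Q, ∀ θ ∈ Metric.ball θ₀ r, DifferentiableAt ℝ (fun t => u t a) θ)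
    (hle : ∀ᵐ a ∂Q, ∀ θ ∈ Metric.ball θ₀ r, ‖fderiv ℝ (fun t => u t a) θ‖ ≤ D a)
    {T : ℕ × Ω → E₀} (hT : BddInProb P fun x => Real.sqrt x.1 • (T x - θ₀)) :
    EmpL2 P O (fun x => u (T x)) (u θ₀) := by
  refine EmpL2.of_lipschitz hD hT ?_
  have hT' : Tendsto T (whp P) (𝓝 θ₀) := by simpa using hT.tendsto_of_sqrt.add_const θ₀
  filter_upwards [hO.whp_ae hd, hO.whp_ae hle, hT' (Metric.ball_mem_nhds θ₀ hr)] with x h1 h2 h3 i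
  exact (convex_ball θ₀ r).norm_image_sub_le_of_norm_fderiv_le (𝕜 := ℝ) (h1 i) (h2 i)
    (Metric.mem_ball_self hr) h3

end UniformDerivative

end

end TwoStage

namespace TwoStage

noncomputable section

set_option linter.unusedSectionVars false

section UniformDerivative

variable {Ω A : Type*} [MeasurableSpace Ω] [MeasurableSpace A] {P : Measure Ω}
  [IsProbabilityMeasure P] {O : ℕ → Ω → A} {Q : Measure A}
  {E₀ G : Type*} [NormedAddCommGroup E₀] [NormedSpace ℝ E₀] [FiniteDimensional ℝ E₀]
  [NormedAddCommGroup G] [NormedSpace ℝ G] [FiniteDimensional ℝ G]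

namespace UniformDeriv

variable {u : E₀ → A → G} {N : Set E₀} {θ₀ : E₀}

/-- The mean value inequality for the empirical mean minus its limiting linear part: the remainder
is at most `ε ‖T - θ₀‖` for every `ε`, and `T` has the `√n`-rate. -/
lemma tendsto_linearization (hO : IsSample P O Q) (h : UniformDeriv P O Q u N) (hθ₀ : θ₀ ∈ N)
    {T : ℕ × Ω → E₀} (hT : BddInProb P fun x => Real.sqrt x.1 • (T x - θ₀)) :
    Tendsto (fun x : ℕ × Ω => Real.sqrt x.1 • (empMean O x.1 x.2 (u (T x))
      - empMean O x.1 x.2 (u θ₀) - (∫ a, fderiv ℝ (fun t => u t a) θ₀ ∂Q) (T x - θ₀))) (whp P)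
      (𝓝 0) := by
  refine hT.tendsto_zero_of_forall_le fun ε hε => ?_
  have hT' : Tendsto T (whp P) (𝓝 θ₀) := by simpa using hT.tendsto_of_sqrt.add_const θ₀
  obtain ⟨r, hr, hrN, hw⟩ := h.exists_ball hO hθ₀ hε
  filter_upwards [hw, hO.whp_ae h.ae_differentiableAt, hT' (Metric.ball_mem_nhds θ₀ hr)]
    with x h1 h2 h3
  rw [norm_smul, norm_smul, mul_left_comm]
  gcongr
  exact (convex_ball θ₀ r).norm_image_sub_le_of_norm_hasFDerivWithin_le'
    (f := fun t => empMean O x.1 x.2 (u t))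
    (fun θ hθ => (hasFDerivAt_empMean fun i => (h2 i θ (hrN hθ)).hasFDerivAt).hasFDerivWithinAt)
    (fun θ hθ => (h1 θ hθ).le) (Metric.mem_ball_self hr) h3

lemma tendsto_empMean_fderiv (hO : IsSample P O Q) (h : UniformDeriv P O Q u N) (hθ₀ : θ₀ ∈ N)
    {T : ℕ × Ω → E₀} (hT : Tendsto T (whp P) (𝓝 θ₀)) :
    Tendsto (fun x : ℕ × Ω => empMean O x.1 x.2 fun a => fderiv ℝ (fun t => u t a) (T x)) (whp P)
      (𝓝 (∫ a, fderiv ℝ (fun t => u t a) θ₀ ∂Q)) := by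
  rw [Metric.tendsto_nhds]
  intro ε hε
  obtain ⟨r, hr, hrN, hw⟩ := h.exists_ball hO hθ₀ hε
  filter_upwards [hw, hT (Metric.ball_mem_nhds θ₀ hr)] with x h1 h3
  rw [dist_eq_norm]
  exact h1 _ h3

end UniformDeriv

end UniformDerivative

/-! ### Score sums versus averages, and inversion of linear maps. -/

section RootConversion

variable {Ω A : Type*} [MeasurableSpace Ω] {P : Measure Ω} {O : ℕ → Ω → A} {d : ℕ}
  {u : ℕ → Ω → Vec d → A → Vec d} {θ₀ : Vec d} {ρ : ℝ}

lemma empMean_eq_zero_iff {E : Type*} [AddCommGroup E] [Module ℝ E] {n : ℕ} (hn : 0 < n) {ω : Ω}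
    {f : A → E} : empMean O n ω f = 0 ↔ ∑ i ∈ Finset.range n, f (O i ω) = 0 := by
  have : (n : ℝ)⁻¹ ≠ 0 := by positivity
  rw [empMean, smul_eq_zero_iff_right this]

lemma uniqueLocalRoot_of_whp (h : ∀ᶠ x in whp P, ∃! t, t ∈ Metric.closedBall θ₀ ρ ∧
    empMean O x.1 x.2 (u x.1 x.2 t) = 0) : UniqueLocalRoot P O u θ₀ ρ := by
  rw [UniqueLocalRoot, ← eventually_whp (p := fun n ω => ∃! t, t ∈ Metric.closedBall θ₀ ρ ∧
    ∑ i ∈ Finset.range n, u n ω t (O i ω) = 0)]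
  filter_upwards [h, eventually_whp_of_atTop (eventually_gt_atTop 0)] with x hx hn
  simpa only [empMean_eq_zero_iff hn] using hx

lemma IsLocalRoot.whp {T : ℕ → Ω → Vec d} (h : IsLocalRoot P O u θ₀ ρ T) :
    ∀ᶠ x in whp P, T x.1 x.2 ∈ Metric.closedBall θ₀ ρ ∧
      empMean O x.1 x.2 (u x.1 x.2 (T x.1 x.2)) = 0 := by
  rw [IsLocalRoot, ← eventually_whp (p := fun n ω => T n ω ∈ Metric.closedBall θ₀ ρ ∧
    ∑ i ∈ Finset.range n, u n ω (T n ω) (O i ω) = 0)] at h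
  filter_upwards [h, eventually_whp_of_atTop (eventually_gt_atTop 0)] with x hx hn
  rwa [empMean_eq_zero_iff hn]

lemma isInvertible_of_pos {A : Vec d →L[ℝ] Vec d} (hA : ∀ v, v ≠ 0 → 0 < ⟪v, A v⟫) :
    A.IsInvertible := by
  have hinj : Function.Injective (A : Vec d →ₗ[ℝ] Vec d) := by
    refine (injective_iff_map_eq_zero _).2 fun v hv => ?_
    by_contra h0
    have := hA v h0
    rw [show A v = 0 from hv, inner_zero_right] at this
    exact lt_irrefl _ this
  refine ⟨(LinearEquiv.ofInjectiveEndo _ hinj).toContinuousLinearEquiv, ?_⟩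
  ext v
  rfl

/-- Inversion is continuous at invertible maps, so the value of `inverse` at a non-invertible
estimate does not affect the limit. -/
lemma tendsto_inverse {E G : Type*} [NormedAddCommGroup E] [NormedSpace ℝ E] [CompleteSpace E]
    [NormedAddCommGroup G] [NormedSpace ℝ G] {ι : Type*} {l : Filter ι} {L : ι → E →L[ℝ] G}
    {A : E →L[ℝ] G} (hA : A.IsInvertible) (hL : Tendsto L l (𝓝 A)) :
    Tendsto (fun x => (L x).inverse) l (𝓝 A.inverse) :=
  (hA.contDiffAt_map_inverse (n := 0)).continuousAt.tendsto.comp hL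

end RootConversion

/-! ### The two-stage estimator and its variance estimators. -/

section TwoStageEstimation

variable {Ω : Type*} [MeasurableSpace Ω] {P : Measure Ω} [IsProbabilityMeasure P]
  {m h r p₁ p₂ : ℕ} {O : ℕ → Ω → Obs m h r} {Q : Measure (Obs m h r)}
  {U : Vec p₁ → Vec p₂ → Obs m h r → Vec p₂} {θ₀₁ : Vec p₁} {θ₀₂ : Vec p₂}
  {N : Set (Vec p₁ × Vec p₂)}

/-- Restriction of a derivative to the first block of parameters. -/
def restrictOne (p₁ p₂ : ℕ) :
    (Vec p₁ × Vec p₂ →L[ℝ] Vec p₂) →L[ℝ] (Vec p₁ →L[ℝ] Vec p₂) :=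
  (ContinuousLinearMap.compL ℝ (Vec p₁) (Vec p₁ × Vec p₂) (Vec p₂)).flip
    (ContinuousLinearMap.inl ℝ (Vec p₁) (Vec p₂))

/-- Restriction of a derivative to the second block of parameters. -/
def restrictTwo (p₁ p₂ : ℕ) :
    (Vec p₁ × Vec p₂ →L[ℝ] Vec p₂) →L[ℝ] (Vec p₂ →L[ℝ] Vec p₂) :=
  (ContinuousLinearMap.compL ℝ (Vec p₂) (Vec p₁ × Vec p₂) (Vec p₂)).flip
    (ContinuousLinearMap.inr ℝ (Vec p₁) (Vec p₂))

@[simp] lemma restrictOne_apply (L : Vec p₁ × Vec p₂ →L[ℝ] Vec p₂) (v : Vec p₁) :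
    restrictOne p₁ p₂ L v = L (v, 0) := rfl

@[simp] lemma restrictTwo_apply (L : Vec p₁ × Vec p₂ →L[ℝ] Vec p₂) (v : Vec p₂) :
    restrictTwo p₁ p₂ L v = L (0, v) := rfl

lemma norm_restrictTwo_le (L : Vec p₁ × Vec p₂ →L[ℝ] Vec p₂) : ‖restrictTwo p₁ p₂ L‖ ≤ ‖L‖ := by
  refine ContinuousLinearMap.opNorm_le_bound _ (norm_nonneg _) fun v => ?_
  rw [restrictTwo_apply]
  refine (L.le_opNorm _).trans (le_of_eq ?_)
  simp [Prod.norm_def]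

lemma gradOne_eq {θ : Vec p₁ × Vec p₂} {o : Obs m h r}
    (hd : DifferentiableAt ℝ (fun t : Vec p₁ × Vec p₂ => U t.1 t.2 o) θ) :
    gradOne U θ.1 θ.2 o = restrictOne p₁ p₂ (gradFull U θ o) :=
  (hd.hasFDerivAt.comp (f := fun t : Vec p₁ => (t, θ.2)) θ.1
    (hasFDerivAt_prodMk_left θ.1 θ.2)).fderiv

lemma hasFDerivAt_snd {θ : Vec p₁ × Vec p₂} {o : Obs m h r}
    (hd : DifferentiableAt ℝ (fun t : Vec p₁ × Vec p₂ => U t.1 t.2 o) θ) :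
    HasFDerivAt (fun t => U θ.1 t o) (restrictTwo p₁ p₂ (gradFull U θ o)) θ.2 :=
  hd.hasFDerivAt.comp (f := fun t : Vec p₂ => (θ.1, t)) θ.2 (hasFDerivAt_prodMk_right θ.1 θ.2)

lemma gradTwo_eq {θ : Vec p₁ × Vec p₂} {o : Obs m h r}
    (hd : DifferentiableAt ℝ (fun t : Vec p₁ × Vec p₂ => U t.1 t.2 o) θ) :
    gradTwo U θ.1 θ.2 o = restrictTwo p₁ p₂ (gradFull U θ o) :=
  (hasFDerivAt_snd hd).fderiv

/-- Reduces both partial derivatives to the full one, for which the uniform law is assumed. Having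
this on all of `N` allows evaluation at estimates. -/
lemma UniformDeriv.sens_eq (hU : UniformDeriv P O Q (fun θ : Vec p₁ × Vec p₂ => U θ.1 θ.2) N) {θ : Vec p₁ × Vec p₂} (hθ : θ ∈ N) :
    sens U Q θ.1 θ.2 = -restrictTwo p₁ p₂ (∫ o, gradFull U θ o ∂Q) := by
  have h1 := (restrictTwo p₁ p₂).integral_comp_comm (hU.integrable θ hθ)
  unfold gradFull
  rw [← h1, sens, ← integral_neg]
  refine integral_congr_ae ?_
  filter_upwards [hU.ae_differentiableAt] with o ho
  rw [gradTwo_eq (ho θ hθ)]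
  rfl

lemma UniformDeriv.cross_eq (hU : UniformDeriv P O Q (fun θ : Vec p₁ × Vec p₂ => U θ.1 θ.2) N) {θ : Vec p₁ × Vec p₂} (hθ : θ ∈ N) :
    cross U Q θ.1 θ.2 = restrictOne p₁ p₂ (∫ o, gradFull U θ o ∂Q) := by
  have h1 := (restrictOne p₁ p₂).integral_comp_comm (hU.integrable θ hθ)
  unfold gradFull
  rw [← h1, cross]
  refine integral_congr_ae ?_
  filter_upwards [hU.ae_differentiableAt] with o ho
  exact gradOne_eq (ho θ hθ)

lemma ScoreRegular.exists_uniformDeriv (hreg : ScoreRegular P O U Q θ₀₁ θ₀₂) :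
    ∃ N, UniformDeriv P O Q (fun θ : Vec p₁ × Vec p₂ => U θ.1 θ.2) N ∧ (θ₀₁, θ₀₂) ∈ N := by
  obtain ⟨N, hN, hmem, hc, hi, hu⟩ := hreg
  refine ⟨N, ⟨hN, hc, hi, fun δ hδ => ?_⟩, hmem⟩
  have h1 := hu δ hδ
  refine (eventually_whp (p := fun n ω => ∀ θ ∈ N, ‖empMean O n ω (gradFull U θ)
    - ∫ o, gradFull U θ o ∂Q‖ < δ)).2 ?_
  simpa only [not_forall, not_lt, exists_prop] using h1

lemma isInfluence_IF3 (hU2 : MemLp (U θ₀₁ θ₀₂) 2 Q) (hU0 : ∫ o, U θ₀₁ θ₀₂ o ∂Q = 0)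
    [IsProbabilityMeasure Q] {IF1 : Vec h × Vec r → Vec p₁}
    (hIF : IsInfluence (Q.map Prod.snd) IF1) :
    IsInfluence Q (IF3 U Q IF1 θ₀₁ θ₀₂) := by
  have hq : MeasurePreserving (Prod.snd : Obs m h r → Vec h × Vec r) Q (Q.map Prod.snd) :=
    ⟨measurable_snd, rfl⟩
  have h1 : MemLp (fun o : Obs m h r => IF1 o.2) 2 Q := hIF.2.1.comp_measurePreserving hq
  set A' := (sens U Q θ₀₁ θ₀₂).inverse
  have h2 : MemLp (fun o => A' (U θ₀₁ θ₀₂ o)) 2 Q := A'.comp_memLp' hU2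
  have h3 : MemLp (fun o : Obs m h r => A' (cross U Q θ₀₁ θ₀₂ (IF1 o.2))) 2 Q :=
    (A'.comp (cross U Q θ₀₁ θ₀₂)).comp_memLp' h1
  have h4 : MemLp (IF3 U Q IF1 θ₀₁ θ₀₂) 2 Q := h2.add h3
  refine ⟨h4.1.aemeasurable, h4, ?_⟩
  have h5 : ∫ o : Obs m h r, IF1 o.2 ∂Q = 0 := by
    rw [← hIF.2.2, integral_map measurable_snd.aemeasurable hIF.2.1.1]
  unfold IF3 IF2
  rw [integral_add (h2.integrable one_le_two) (h3.integrable one_le_two),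
    A'.integral_comp_comm (hU2.integrable one_le_two), hU0, map_zero, zero_add]
  refine ((A'.comp (cross U Q θ₀₁ θ₀₂)).integral_comp_comm (h1.integrable one_le_two)).trans ?_
  rw [h5, map_zero]

/-- Consistency of the variance estimators of a two-stage estimator. -/
lemma varianceConsistent (hO : IsSample P O Q) (hU : UniformDeriv P O Q (fun θ : Vec p₁ × Vec p₂ => U θ.1 θ.2) N)
    (hN : (θ₀₁, θ₀₂) ∈ N) (hU2 : MemLp (U θ₀₁ θ₀₂) 2 Q)
    (hA : (sens U Q θ₀₁ θ₀₂).IsInvertible) {T₁ : ℕ → Ω → Vec p₁} {T₂ : ℕ → Ω → Vec p₂}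
    {IF1 : Vec h × Vec r → Vec p₁} (hIF : MemLp IF1 2 (Q.map Prod.snd))
    (hT₁ : BddInProb P fun x => Real.sqrt x.1 • (T₁ x.1 x.2 - θ₀₁))
    (hT₂ : BddInProb P fun x => Real.sqrt x.1 • (T₂ x.1 x.2 - θ₀₂))
    {IF1hat : ℕ → Ω → Vec h × Vec r → Vec p₁}
    (hhat : EmpL2 P (fun i ω => (O i ω).2) (fun x => IF1hat x.1 x.2) IF1) :
    VarianceConsistent P O U Q θ₀₁ θ₀₂ IF1 IF1hat T₁ T₂ := by
  set θ₀ : Vec p₁ × Vec p₂ := (θ₀₁, θ₀₂)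
  set T : ℕ × Ω → Vec p₁ × Vec p₂ := fun x => (T₁ x.1 x.2, T₂ x.1 x.2)
  have hTb : BddInProb P fun x => Real.sqrt x.1 • (T x - θ₀) := by
    have h1 : BddInProb P fun x : ℕ × Ω =>
        ((Real.sqrt x.1 • (T₁ x.1 x.2 - θ₀₁), 0) : Vec p₁ × Vec p₂) :=
      hT₁.of_le 1 (Eventually.of_forall fun x => by simp [Prod.norm_def])
    have h2 : BddInProb P fun x : ℕ × Ω =>
        ((0, Real.sqrt x.1 • (T₂ x.1 x.2 - θ₀₂)) : Vec p₁ × Vec p₂) :=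
      hT₂.of_le 1 (Eventually.of_forall fun x => by simp [Prod.norm_def])
    convert h1.add h2 using 1
    ext1 x
    simp [T, θ₀]
  have hT : Tendsto T (whp P) (𝓝 θ₀) := by simpa using hTb.tendsto_of_sqrt.add_const θ₀
  have hTN : ∀ᶠ x in whp P, T x ∈ N := hT (hU.isOpen.mem_nhds hN)
  have hQ : MeasurePreserving (Prod.snd : Obs m h r → Vec h × Vec r) Q (Q.map Prod.snd) :=
    ⟨measurable_snd, rfl⟩
  have hIF' : MemLp (fun o : Obs m h r => IF1 o.2) 2 Q := hIF.comp_measurePreserving hQ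
  set g : Vec p₁ × Vec p₂ → (Vec p₁ × Vec p₂ →L[ℝ] Vec p₂) := fun θ => ∫ o, gradFull U θ o ∂Q
  have hsens : sens U Q θ₀₁ θ₀₂ = -restrictTwo p₁ p₂ (g θ₀) := hU.sens_eq hN
  have hcross : cross U Q θ₀₁ θ₀₂ = restrictOne p₁ p₂ (g θ₀) := hU.cross_eq hN
  -- Square integrability of `U` is known at the true parameter only; the envelope with small tails
  -- and the `√n`-rate replace it at the estimates.
  have hUT : EmpL2 P O (fun x => U (T x).1 (T x).2) (U θ₀₁ θ₀₂) := by
    obtain ⟨ρ, hρ, hρN, D, hD, hDle⟩ := hU.exists_envelope hO hN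
    refine EmpL2.of_envelope (u := fun θ : Vec p₁ × Vec p₂ => U θ.1 θ.2) hO hρ hD ?_ hDle hTb
    filter_upwards [hU.ae_differentiableAt] with o ho θ hθ using ho θ (hρN hθ)
  have hIFT : EmpL2 P O (fun x (o : Obs m h r) => IF1hat x.1 x.2 o.2) (fun o => IF1 o.2) := hhat
  have hIF3 : MemLp (IF3 U Q IF1 θ₀₁ θ₀₂) 2 Q :=
    ((sens U Q θ₀₁ θ₀₂).inverse.comp_memLp' hU2).add
      (((sens U Q θ₀₁ θ₀₂).inverse.comp (cross U Q θ₀₁ θ₀₂)).comp_memLp' hIF')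
  -- Treats both variance estimators at once: `L` will be the empirical or the expected derivative
  -- at the estimates.
  have key : ∀ L : ℕ × Ω → (Vec p₁ × Vec p₂ →L[ℝ] Vec p₂), Tendsto L (whp P) (𝓝 (g θ₀)) →
      EmpL2 P O (fun x o => (-restrictTwo p₁ p₂ (L x)).inverse (U (T x).1 (T x).2 o)
        + (-restrictTwo p₁ p₂ (L x)).inverse (restrictOne p₁ p₂ (L x) (IF1hat x.1 x.2 o.2)))
        (IF3 U Q IF1 θ₀₁ θ₀₂) := by
    intro L hL
    have h1 : Tendsto (fun x => (-restrictTwo p₁ p₂ (L x)).inverse) (whp P)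
        (𝓝 (sens U Q θ₀₁ θ₀₂).inverse) := by
      refine tendsto_inverse hA ?_
      rw [hsens]
      exact (((restrictTwo p₁ p₂).continuous.tendsto _).comp hL).neg
    have h2 : Tendsto (fun x => restrictOne p₁ p₂ (L x)) (whp P) (𝓝 (cross U Q θ₀₁ θ₀₂)) := by
      rw [hcross]
      exact ((restrictOne p₁ p₂).continuous.tendsto _).comp hL
    have h3 := hUT.clm_apply hO hU2 h1
    have h4 := (hIFT.clm_apply hO hIF' h2).clm_apply hO
      ((cross U Q θ₀₁ θ₀₂).comp_memLp' hIF') h1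
    exact h3.add h4
  have k1 := key (fun x => empMean O x.1 x.2 (gradFull U (T x)))
    (hU.tendsto_empMean_fderiv hO hN hT)
  have k2 := key (fun x => g (T x)) ((hU.continuousAt_integral hO hN).tendsto.comp hT)
  intro j k
  constructor
  · refine tendstoInMeasure_iff_whp.2 ?_
    refine EmpL2.tendsto_empSecondMoment hO (F := fun x => IF3emp U O (IF1hat x.1 x.2)
      (T₁ x.1 x.2) (T₂ x.1 x.2) x.1 x.2) (k1.congr ?_ (Eventually.of_forall fun _ _ => rfl)) hIF3 j k
    filter_upwards [hTN, hO.whp_ae hU.ae_differentiableAt] with x hx hd i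
    have e1 : (empMean O x.1 x.2 fun o' => -gradTwo U (T₁ x.1 x.2) (T₂ x.1 x.2) o')
        = -restrictTwo p₁ p₂ (empMean O x.1 x.2 (gradFull U (T x))) := by
      rw [empMean_neg]
      refine congrArg Neg.neg (Eq.trans ?_
        (map_empMean (restrictTwo p₁ p₂).toLinearMap (gradFull U (T x))).symm)
      exact empMean_congr fun k => gradTwo_eq (hd k (T x) hx)
    have e2 : (empMean O x.1 x.2 fun o' => gradOne U (T₁ x.1 x.2) (T₂ x.1 x.2) o')
        = restrictOne p₁ p₂ (empMean O x.1 x.2 (gradFull U (T x))) := by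
      refine Eq.trans ?_ (map_empMean (restrictOne p₁ p₂).toLinearMap (gradFull U (T x))).symm
      exact empMean_congr fun k => gradOne_eq (hd k (T x) hx)
    rw [IF3emp, e1, e2, map_add]
  · refine tendstoInMeasure_iff_whp.2 ?_
    refine EmpL2.tendsto_empSecondMoment hO (F := fun x => IF3 U Q (IF1hat x.1 x.2)
      (T₁ x.1 x.2) (T₂ x.1 x.2)) (k2.congr ?_ (Eventually.of_forall fun _ _ => rfl)) hIF3 j k
    filter_upwards [hTN] with x hx i
    have e1 : sens U Q (T₁ x.1 x.2) (T₂ x.1 x.2) = -restrictTwo p₁ p₂ (g (T x)) := hU.sens_eq hx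
    have e2 : cross U Q (T₁ x.1 x.2) (T₂ x.1 x.2) = restrictOne p₁ p₂ (g (T x)) := hU.cross_eq hx
    rw [IF3, IF2, e1, e2]

/-- Existence, uniqueness and asymptotic linearity of the two-stage estimator, with consistent
variance estimators. -/
theorem exists_radius_twoStage (hO : IsSample P O Q) (hU : UniformDeriv P O Q (fun θ : Vec p₁ × Vec p₂ => U θ.1 θ.2) N)
    (hN : (θ₀₁, θ₀₂) ∈ N) (hU2 : MemLp (U θ₀₁ θ₀₂) 2 Q) (hU0 : ∫ o, U θ₀₁ θ₀₂ o ∂Q = 0)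
    (hA : (sens U Q θ₀₁ θ₀₂).IsInvertible) {T₁ : ℕ → Ω → Vec p₁}
    {IF1 : Vec h × Vec r → Vec p₁} (hIF : IsInfluence (Q.map Prod.snd) IF1)
    (hT₁ : AsympLinear P (fun i ω => (O i ω).2) θ₀₁ IF1 T₁) :
    ∃ ρ > 0, UniqueLocalRoot P O (fun n ω => U (T₁ n ω)) θ₀₂ ρ ∧
      ∀ T₂ : ℕ → Ω → Vec p₂, IsLocalRoot P O (fun n ω => U (T₁ n ω)) θ₀₂ ρ T₂ →
        HasInfluence P O Q θ₀₂ (IF3 U Q IF1 θ₀₁ θ₀₂) T₂ ∧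
        ∀ IF1hat : ℕ → Ω → Vec h × Vec r → Vec p₁,
          EmpL2 P (fun i ω => (O i ω).2) (fun x => IF1hat x.1 x.2) IF1 →
          VarianceConsistent P O U Q θ₀₁ θ₀₂ IF1 IF1hat T₁ T₂ := by
  have hOXZ := hO.comp (g := Prod.snd) measurable_snd
  have hQ := hO.isProbabilityMeasure
  set g₀ : Vec p₁ × Vec p₂ →L[ℝ] Vec p₂ := ∫ o, gradFull U (θ₀₁, θ₀₂) o ∂Q with hg₀
  have hsens : sens U Q θ₀₁ θ₀₂ = -restrictTwo p₁ p₂ g₀ := hU.sens_eq hN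
  have hcross : cross U Q θ₀₁ θ₀₂ = restrictOne p₁ p₂ g₀ := hU.cross_eq hN
  have hT₁b := hT₁.bddInProb hOXZ hIF
  have hT₁c := hT₁.consistent hOXZ hIF
  have hIF3 := isInfluence_IF3 hU2 hU0 hIF
  set H : ℕ × Ω → Vec p₂ → Vec p₂ := fun x t => empMean O x.1 x.2 (U (T₁ x.1 x.2) t) with hH
  -- The influence function of the averaged score at `θ₀₂` with estimated `θ₁`; applying the inverse
  -- of `sens` turns it into `IF3`.
  set ψ : Obs m h r → Vec p₂ := fun o => U θ₀₁ θ₀₂ o + cross U Q θ₀₁ θ₀₂ (IF1 o.2) with hψ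
  have hlin : Tendsto (fun x : ℕ × Ω => Real.sqrt x.1 • H x θ₀₂
      - (Real.sqrt x.1)⁻¹ • ∑ i ∈ Finset.range x.1, ψ (O i x.2)) (whp P) (𝓝 0) := by
    have hb : BddInProb P fun x : ℕ × Ω => Real.sqrt x.1 •
        (((T₁ x.1 x.2, θ₀₂) : Vec p₁ × Vec p₂) - (θ₀₁, θ₀₂)) :=
      hT₁b.of_le 1 (Eventually.of_forall fun x => by
        simp [Prod.norm_def, norm_smul, mul_nonneg])
    have h1 := hU.tendsto_linearization hO hN hb
    have h2 := ((cross U Q θ₀₁ θ₀₂).continuous.tendsto 0).comp hT₁.tendsto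
    have h3 := h1.add h2
    rw [map_zero, add_zero] at h3
    refine h3.congr fun x => ?_
    have e1 : (∫ a, fderiv ℝ (fun t : Vec p₁ × Vec p₂ => U t.1 t.2 a) (θ₀₁, θ₀₂) ∂Q)
        ((T₁ x.1 x.2, θ₀₂) - (θ₀₁, θ₀₂)) = cross U Q θ₀₁ θ₀₂ (T₁ x.1 x.2 - θ₀₁) := by
      rw [hcross, restrictOne_apply]
      simp only [Prod.mk_sub_mk, sub_self]
      rfl
    have e2 : (Real.sqrt x.1)⁻¹ • ∑ i ∈ Finset.range x.1, ψ (O i x.2)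
        = Real.sqrt x.1 • empMean O x.1 x.2 (U θ₀₁ θ₀₂) + cross U Q θ₀₁ θ₀₂
          ((Real.sqrt x.1)⁻¹ • ∑ i ∈ Finset.range x.1, IF1 (O i x.2).2) := by
      rw [hψ, Finset.sum_add_distrib, smul_add, sqrt_mul_inv_smul, map_smul, map_sum]
      rfl
    simp only [Function.comp_apply]
    rw [e1, e2, hH]
    simp only [smul_sub, map_sub, map_smul]
    abel
  have hψI : IsInfluence Q ψ := by
    have h1 : MemLp (fun o : Obs m h r => IF1 o.2) 2 Q :=
      hIF.2.1.comp_measurePreserving ⟨measurable_snd, rfl⟩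
    have h2 : MemLp (fun o : Obs m h r => cross U Q θ₀₁ θ₀₂ (IF1 o.2)) 2 Q :=
      (cross U Q θ₀₁ θ₀₂).comp_memLp' h1
    refine ⟨(hU2.add h2).1.aemeasurable, hU2.add h2, ?_⟩
    rw [hψ, integral_add (hU2.integrable one_le_two) (h2.integrable one_le_two), hU0,
      (cross U Q θ₀₁ θ₀₂).integral_comp_comm (h1.integrable one_le_two)]
    have h5 : ∫ o : Obs m h r, IF1 o.2 ∂Q = 0 := by
      rw [← hIF.2.2, integral_map measurable_snd.aemeasurable hIF.2.1.1]
    rw [h5, map_zero, add_zero]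
  have hbdd : BddInProb P fun x : ℕ × Ω => Real.sqrt x.1 • H x θ₀₂ := by
    convert (BddInProb.of_tendsto hlin).add (hO.bddInProb hψI) using 1
    ext1 x
    simp
  -- On a product ball around `(θ₀₁, θ₀₂)` the full empirical derivative is uniformly close to its
  -- limit, and the section at `T₁` stays in that ball by consistency of `T₁`.
  have hloc : ∀ ε : NNReal, 0 < ε → ∃ r > 0, ∀ᶠ x in whp P,
      ApproximatesLinearOn (H x) (-sens U Q θ₀₁ θ₀₂) (Metric.closedBall θ₀₂ r) ε := by
    intro ε hε
    obtain ⟨r, hr, hrN, hw⟩ := hU.exists_ball hO hN (NNReal.coe_pos.2 hε)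
    refine ⟨r / 2, by positivity, ?_⟩
    filter_upwards [hw, hO.whp_ae hU.ae_differentiableAt, hT₁c (Metric.ball_mem_nhds θ₀₁ hr)]
      with x h1 h2 h3
    have hmem : ∀ t ∈ Metric.closedBall θ₀₂ (r / 2),
        ((T₁ x.1 x.2, t) : Vec p₁ × Vec p₂) ∈ Metric.ball (θ₀₁, θ₀₂) r := by
      intro t ht
      rw [Metric.mem_ball, Prod.dist_eq]
      exact max_lt h3 ((Metric.mem_closedBall.1 ht).trans_lt (half_lt_self hr))
    refine approximatesLinearOn_of_hasFDerivAt (convex_closedBall _ _)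
      (f' := fun t => restrictTwo p₁ p₂ (empMean O x.1 x.2 (gradFull U (T₁ x.1 x.2, t))))
      (fun t ht => ?_) (fun t ht => ?_)
    · have h4 := map_empMean (O := O) (n := x.1) (ω := x.2) (restrictTwo p₁ p₂).toLinearMap
        (gradFull U (T₁ x.1 x.2, t))
      change HasFDerivAt _ ((restrictTwo p₁ p₂).toLinearMap (empMean O x.1 x.2
        (gradFull U (T₁ x.1 x.2, t)))) t
      rw [h4, hH]
      exact hasFDerivAt_empMean (u := U (T₁ x.1 x.2)) fun i =>
        hasFDerivAt_snd (h2 i _ (hrN (hmem t ht)))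
    · rw [hsens, neg_neg, ← map_sub]
      exact (norm_restrictTwo_le _).trans (h1 _ (hmem t ht)).le
  obtain ⟨ρ, hρ, huniq, hroot⟩ := exists_radius_root hA hloc hbdd
  refine ⟨ρ, hρ, uniqueLocalRoot_of_whp huniq, fun T₂ hT₂ => ?_⟩
  have hlin₂ : AsympLinear P O θ₀₂ (IF3 U Q IF1 θ₀₁ θ₀₂) T₂ := by
    refine (tendstoInMeasure_iff_whp (X := fun (n : ℕ) ω => Real.sqrt n • (T₂ n ω - θ₀₂)
      - (Real.sqrt n)⁻¹ • ∑ i ∈ Finset.range n, IF3 U Q IF1 θ₀₁ θ₀₂ (O i ω))).2 ?_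
    have h1 := hroot (fun x => T₂ x.1 x.2) hT₂.whp
    have h2 := ((sens U Q θ₀₁ θ₀₂).inverse.continuous.tendsto 0).comp hlin
    have h3 := h1.add h2
    rw [map_zero, add_zero] at h3
    refine h3.congr fun x => ?_
    have e : ∀ o, IF3 U Q IF1 θ₀₁ θ₀₂ o = (sens U Q θ₀₁ θ₀₂).inverse (ψ o) := fun o => by
      rw [IF3, IF2, hψ, map_add]
    simp only [Function.comp_apply, e, map_sub, map_smul, map_sum]
    abel
  refine ⟨hlin₂.hasInfluence hO hIF3, fun IF1hat hhat => ?_⟩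
  exact varianceConsistent hO hU hN hU2 hA hIF.2.1 hT₁b (hlin₂.bddInProb hO hIF3) hhat

end TwoStageEstimation

end

end TwoStage

namespace TwoStage

noncomputable section

/-! ### Derivatives of determinants, inverses and Gaussian log-likelihoods -/

section MatrixCalculus

variable {E : Type*} [NormedAddCommGroup E] [NormedSpace ℝ E] {n : ℕ}
  {V : E → Matrix (Fin n) (Fin n) ℝ} {θ : E}

/-- Jacobi's formula: in the Leibniz expansion, differentiating column `i` gives the determinant
with that column replaced, which Cramer's rule writes with the adjugate. -/
lemma hasFDerivAt_det {V' : Fin n → Fin n → E →L[ℝ] ℝ}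
    (h : ∀ i j, HasFDerivAt (fun t => V t i j) (V' i j) θ) :
    HasFDerivAt (fun t => (V t).det) (∑ i, ∑ j, (V θ).adjugate i j • V' j i) θ := by
  have h1 : HasFDerivAt (fun t => (V t).det) (∑ σ : Equiv.Perm (Fin n),
      ((Equiv.Perm.sign σ : ℤ) : ℝ) • ∑ i, (∏ j ∈ Finset.univ.erase i, V θ (σ j) j) • V' (σ i) i)
      θ := by
    simp only [Matrix.det_apply']
    exact HasFDerivAt.fun_sum fun σ _ =>
      (HasFDerivAt.finsetProd fun i _ => h (σ i) i).const_mul _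
  convert h1 using 1
  simp only [Finset.smul_sum]
  rw [Finset.sum_comm (γ := Equiv.Perm (Fin n))]
  refine Finset.sum_congr rfl fun i _ => ?_
  ext w
  have h2 : ∑ j, (V θ).adjugate i j * V' j i w
      = ((V θ).updateCol i fun j => V' j i w).det := by
    rw [← Matrix.cramer_apply, Matrix.cramer_eq_adjugate_mulVec]
    rfl
  simp only [FunLike.coe_sum, Finset.sum_apply, FunLike.coe_smul,
    Pi.smul_apply, smul_eq_mul]
  rw [h2, Matrix.det_apply']
  refine Finset.sum_congr rfl fun σ _ => ?_
  rw [← Finset.prod_erase_mul _ _ (Finset.mem_univ i), Matrix.updateCol_self]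
  congr 2
  refine Finset.prod_congr rfl fun j hj => ?_
  rw [Matrix.updateCol_ne (Finset.ne_of_mem_erase hj)]

lemma differentiableAt_det (h : ∀ i j, DifferentiableAt ℝ (fun t => V t i j) θ) :
    DifferentiableAt ℝ (fun t => (V t).det) θ :=
  (hasFDerivAt_det fun i j => (h i j).hasFDerivAt).differentiableAt

lemma differentiableAt_matrix_inv (h : ∀ i j, DifferentiableAt ℝ (fun t => V t i j) θ)
    (hdet : (V θ).det ≠ 0) (i j : Fin n) : DifferentiableAt ℝ (fun t => (V t)⁻¹ i j) θ := by
  have h1 : (fun t => (V t)⁻¹ i j) =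
      fun t => ((V t).det)⁻¹ * ((V t).updateRow j (Pi.single i 1)).det := by
    ext t
    rw [Matrix.inv_def, Ring.inverse_eq_inv', Matrix.smul_apply, Matrix.adjugate_apply, smul_eq_mul]
  rw [h1]
  refine ((differentiableAt_det h).inv hdet).mul (differentiableAt_det fun a b => ?_)
  by_cases ha : a = j
  · subst ha
    simp
  · simpa [Matrix.updateRow_ne ha] using h a b

/-- Along any direction, the logarithmic derivative of the determinant is minus the trace of the
derivative of the inverse times the matrix. -/
lemma fderiv_log_det (h : ∀ i j, DifferentiableAt ℝ (fun t => V t i j) θ)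
    (hdet : (V θ).det ≠ 0) (w : E) :
    fderiv ℝ (fun t => Real.log (V t).det) θ w
      = -∑ i, ∑ j, fderiv ℝ (fun t => (V t)⁻¹ i j) θ w * V θ j i := by
  have h1 := ((hasFDerivAt_det fun i j => (h i j).hasFDerivAt).log hdet).fderiv
  have hinv := differentiableAt_matrix_inv h hdet
  have h2 : HasFDerivAt (fun t => ∑ i, ∑ j, (V t)⁻¹ i j * V t j i)
      (∑ i, ∑ j, ((V θ)⁻¹ i j • fderiv ℝ (fun t => V t j i) θ
        + V θ j i • fderiv ℝ (fun t => (V t)⁻¹ i j) θ)) θ :=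
    HasFDerivAt.fun_sum fun i _ => HasFDerivAt.fun_sum fun j _ =>
      (hinv i j).hasFDerivAt.mul (h j i).hasFDerivAt
  -- Differentiating the constant trace of `V⁻¹ V` moves the derivative from `V` to `V⁻¹`.
  have h3 : (fun t => ∑ i, ∑ j, (V t)⁻¹ i j * V t j i) =ᶠ[𝓝 θ] fun _ => (n : ℝ) := by
    filter_upwards [(differentiableAt_det h).continuousAt.eventually_ne hdet] with t ht
    have : (V t)⁻¹ * V t = 1 := Matrix.nonsing_inv_mul _ (isUnit_iff_ne_zero.2 ht)
    calc ∑ i, ∑ j, (V t)⁻¹ i j * V t j i = ((V t)⁻¹ * V t).trace := rfl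
      _ = n := by simp [this]
  have h4 := h2.unique ((hasFDerivAt_const (n : ℝ) θ).congr_of_eventuallyEq h3)
  have h5 := DFunLike.congr_fun h4 w
  rw [h1]
  simp only [FunLike.coe_sum, Finset.sum_apply, FunLike.coe_smul,
    Pi.smul_apply, smul_eq_mul, add_apply, Finset.sum_add_distrib,
    zero_apply] at h5 ⊢
  have h6 : ∑ i, ∑ j, fderiv ℝ (fun t => (V t)⁻¹ i j) θ w * V θ j i
      = ∑ i, ∑ j, V θ j i * fderiv ℝ (fun t => (V t)⁻¹ i j) θ w := by
    simp only [mul_comm]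
  rw [h6, Finset.mul_sum]
  have h7 : ∑ i, ((V θ).det)⁻¹ * ∑ j, (V θ).adjugate i j * fderiv ℝ (fun t => V t j i) θ w
      = ∑ i, ∑ j, (V θ)⁻¹ i j * fderiv ℝ (fun t => V t j i) θ w := by
    refine Finset.sum_congr rfl fun i _ => ?_
    rw [Finset.mul_sum]
    refine Finset.sum_congr rfl fun j _ => ?_
    rw [Matrix.inv_def, Ring.inverse_eq_inv', Matrix.smul_apply, smul_eq_mul, mul_assoc]
  rw [h7]
  linarith

end MatrixCalculus

lemma inner_mv {n k : ℕ} (A : Matrix (Fin n) (Fin k) ℝ) (u : Vec n) (v : Vec k) :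
    ⟪u, mv A v⟫ = ∑ i, ∑ j, A i j * (u i * v j) := by
  rw [PiLp.inner_apply]
  refine Finset.sum_congr rfl fun i _ => ?_
  simp only [mv, Matrix.toLpLin_apply, Matrix.mulVec, dotProduct, RCLike.inner_apply, conj_trivial]
  rw [Finset.sum_mul]
  exact Finset.sum_congr rfl fun j _ => by ring

lemma mv_apply {n k : ℕ} (A : Matrix (Fin n) (Fin k) ℝ) (v : Vec k) (i : Fin n) :
    mv A v i = ∑ j, A i j * v j := by
  simp [mv, Matrix.toLpLin_apply, Matrix.mulVec, dotProduct]

/-! ### Directional derivatives of the Gaussian log-likelihood. -/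

section LogLik

variable {m p l r d : ℕ}

namespace Stage2Param

/-- Separates parameters from covariates, so that the parameter derivative of the mean is visibly
affine in `v` and `z`. -/
lemma meanY_apply (S : Stage2Param m p l r) (z : Vec r) (v : Vec l) (j : Fin m) :
    S.meanY z v j = (S.ν j + ∑ a, S.Λ j a * S.α a) + ∑ i, (S.Λ * S.B) j i * v i
      + ∑ i, ((S.Λ * S.Γ) j i + S.K j i) * z i := by
  have h : ∀ k (C : Matrix (Fin p) (Fin k) ℝ) (u : Vec k),
      ∑ a, S.Λ j a * ∑ i, C a i * u i = ∑ i, (S.Λ * C) j i * u i := by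
    intro k C u
    simp only [Matrix.mul_apply, Finset.mul_sum, Finset.sum_mul]
    rw [Finset.sum_comm]
    simp only [mul_assoc]
  simp only [meanY, indicator, latent, add_zero, PiLp.add_apply, mv_apply, mul_add,
    Finset.sum_add_distrib, h, add_mul]
  ring

lemma logLik_eq (S : Stage2Param m p l r) (hS : 0 < S.varY.det) (y : Vec m) (z : Vec r)
    (v : Vec l) :
    S.logLik y z v = -(1 / 2) * (Real.log ((2 * Real.pi) ^ m) + Real.log S.varY.det)
      - 1 / 2 * ∑ j, ∑ k, S.varY⁻¹ j k * ((y j - S.meanY z v j) * (y k - S.meanY z v k)) := by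
  have hc : 0 < (2 * Real.pi) ^ m * S.varY.det := by positivity
  rw [logLik, mvnPDF, Real.log_mul (by positivity) (Real.exp_pos _).ne', Real.log_inv,
    Real.log_sqrt hc.le, Real.log_exp, Real.log_mul (by positivity) hS.ne', inner_mv]
  simp only [PiLp.sub_apply]
  ring

variable {par : Vec d → Stage2Param m p l r} {θ : Vec d}

lemma DiffAt.varY (h : DiffAt par θ) (i j : Fin m) :
    DifferentiableAt ℝ (fun t => (par t).varY i j) θ := by
  obtain ⟨-, -, -, -, hΛ, -, hΨ, hΩ⟩ := h
  simp only [Stage2Param.varY, Matrix.add_apply, Matrix.mul_apply, Matrix.transpose_apply]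
  fun_prop

/-- The directional derivative of the log-likelihood as a quadratic function of the residual. -/
lemma exists_fderiv_logLik (h : DiffAt par θ) (hV : (par θ).varY.PosDef) (w : Vec d) :
    ∃ (c : ℝ) (N : Fin m → Fin m → ℝ) (a : Fin m → ℝ) (b : Fin m → Fin l → ℝ)
      (g : Fin m → Fin r → ℝ), c + ∑ j, ∑ k, N j k * (par θ).varY j k = 0 ∧
      ∀ y z v, HasFDerivAt (fun t => (par t).logLik y z v)
          (fderiv ℝ (fun t => (par t).logLik y z v) θ) θ ∧
        fderiv ℝ (fun t => (par t).logLik y z v) θ w =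
        c + ∑ j, ∑ k, N j k * ((y j - (par θ).meanY z v j) * (y k - (par θ).meanY z v k))
          + ∑ j, (a j + ∑ i, b j i * v i + ∑ i, g j i * z i) * (y j - (par θ).meanY z v j) := by
  have hdet : 0 < (par θ).varY.det := hV.det_pos
  have hVd := h.varY
  have hdetd := differentiableAt_det hVd
  have hinv := differentiableAt_matrix_inv hVd hdet.ne'
  obtain ⟨hα, hB, hΓ, hν, hΛ, hK, -, -⟩ := h
  set fa : Fin m → Vec d → ℝ := fun j t => (par t).ν j + ∑ a, (par t).Λ j a * (par t).α a with hfa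
  set fb : Fin m → Fin l → Vec d → ℝ := fun j i t => ((par t).Λ * (par t).B) j i with hfb
  set fg : Fin m → Fin r → Vec d → ℝ :=
    fun j i t => ((par t).Λ * (par t).Γ) j i + (par t).K j i with hfg
  have hda : ∀ j, DifferentiableAt ℝ (fa j) θ := fun j => by
    simp only [hfa]
    fun_prop
  have hdb : ∀ j i, DifferentiableAt ℝ (fb j i) θ := fun j i => by
    simp only [hfb, Matrix.mul_apply]
    fun_prop
  have hdg : ∀ j i, DifferentiableAt ℝ (fg j i) θ := fun j i => by
    simp only [hfg, Matrix.mul_apply]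
    fun_prop
  set R : Matrix (Fin m) (Fin m) ℝ := (par θ).varY⁻¹ with hR
  set R' : Fin m → Fin m → ℝ := fun j k => fderiv ℝ (fun t => (par t).varY⁻¹ j k) θ w with hR'
  refine ⟨-(1 / 2) * fderiv ℝ (fun t => Real.log (par t).varY.det) θ w,
    fun j k => -(1 / 2) * R' j k,
    -- Either residual of the quadratic form may be differentiated; this symmetrised coefficient
    -- collects both terms.
    fun j => ∑ k, 1 / 2 * (R j k + R k j) * fderiv ℝ (fa k) θ w,
    fun j i => ∑ k, 1 / 2 * (R j k + R k j) * fderiv ℝ (fb k i) θ w,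
    fun j i => ∑ k, 1 / 2 * (R j k + R k j) * fderiv ℝ (fg k i) θ w, ?_, fun y z v => ?_⟩
  -- The derivative of the log-determinant is the negative trace of the derivative of the inverse
  -- times the variance, so it cancels the quadratic coefficients paired with `varY`.
  · rw [fderiv_log_det hVd hdet.ne']
    have hsymm : ∀ i j, (par θ).varY j i = (par θ).varY i j := fun i j => by
      simpa using hV.1.apply i j
    simp only [mul_assoc, ← Finset.mul_sum, hsymm]
    ring
  · set μ : Fin m → Vec d → ℝ := fun j t => fa j t + ∑ i, fb j i t * v i + ∑ i, fg j i t * z i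
      with hμ
    have hμY : ∀ j t, (par t).meanY z v j = μ j t := fun j t => meanY_apply _ _ _ _
    have hμd : ∀ j, HasFDerivAt (μ j) (fderiv ℝ (fa j) θ + ∑ i, v i • fderiv ℝ (fb j i) θ
        + ∑ i, z i • fderiv ℝ (fg j i) θ) θ := fun j =>
      ((hda j).hasFDerivAt.add (HasFDerivAt.fun_sum fun i _ =>
        (hdb j i).hasFDerivAt.mul_const (v i))).add (HasFDerivAt.fun_sum fun i _ =>
        (hdg j i).hasFDerivAt.mul_const (z i))
    set μ' : Fin m → Vec d →L[ℝ] ℝ := fun j => fderiv ℝ (fa j) θ + ∑ i, v i • fderiv ℝ (fb j i) θ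
        + ∑ i, z i • fderiv ℝ (fg j i) θ with hμ'
    have hρ : ∀ j, HasFDerivAt (fun t => y j - μ j t) (-μ' j) θ := fun j =>
      (hμd j).const_sub (y j)
    have hlog : HasFDerivAt (fun t => Real.log (par t).varY.det)
        (fderiv ℝ (fun t => Real.log (par t).varY.det) θ) θ :=
      (hdetd.log hdet.ne').hasFDerivAt
    have hmain := ((hlog.const_add (Real.log ((2 * Real.pi) ^ m))).const_mul (-(1 / 2))).sub
      ((HasFDerivAt.fun_sum fun j (_ : j ∈ Finset.univ) =>
        HasFDerivAt.fun_sum fun k (_ : k ∈ Finset.univ) =>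
          (hinv j k).hasFDerivAt.mul ((hρ j).mul (hρ k))).const_mul (1 / 2))
    have heq : (fun t => (par t).logLik y z v) =ᶠ[𝓝 θ] fun t =>
        -(1 / 2) * (Real.log ((2 * Real.pi) ^ m) + Real.log (par t).varY.det)
        - 1 / 2 * ∑ j, ∑ k, (par t).varY⁻¹ j k * ((y j - μ j t) * (y k - μ k t)) := by
      filter_upwards [hdetd.continuousAt.eventually_const_lt hdet] with t ht
      rw [logLik_eq _ ht]
      simp only [hμY]
    have hfin := hmain.congr_of_eventuallyEq heq
    refine ⟨hfin.differentiableAt.hasFDerivAt, ?_⟩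
    rw [hfin.fderiv]
    simp only [hμY]
    set ρ : Fin m → ℝ := fun j => y j - μ j θ with hρ'
    have hμ'w : ∀ k, μ' k w = fderiv ℝ (fa k) θ w + ∑ i, fderiv ℝ (fb k i) θ w * v i
        + ∑ i, fderiv ℝ (fg k i) θ w * z i := fun k => by
      simp only [hμ', add_apply, FunLike.coe_sum,
        Finset.sum_apply, FunLike.coe_smul, Pi.smul_apply, smul_eq_mul, mul_comm]
    have hcoef' : ∀ K' : Fin m → ℝ, (∑ k, K' k * fderiv ℝ (fa k) θ w)
        + (∑ i, (∑ k, K' k * fderiv ℝ (fb k i) θ w) * v i)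
        + ∑ i, (∑ k, K' k * fderiv ℝ (fg k i) θ w) * z i = ∑ k, K' k * μ' k w := by
      intro K'
      simp only [hμ'w, mul_add, Finset.sum_add_distrib, Finset.mul_sum, Finset.sum_mul, mul_assoc]
      rw [Finset.sum_comm (γ := Fin l), Finset.sum_comm (γ := Fin r)]
    have hcoef : ∀ j, (∑ k, 1 / 2 * (R j k + R k j) * fderiv ℝ (fa k) θ w)
        + (∑ i, (∑ k, 1 / 2 * (R j k + R k j) * fderiv ℝ (fb k i) θ w) * v i)
        + ∑ i, (∑ k, 1 / 2 * (R j k + R k j) * fderiv ℝ (fg k i) θ w) * z i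
        = ∑ k, 1 / 2 * (R j k + R k j) * μ' k w := fun j => hcoef' _
    simp only [hcoef]
    have hsw : ∑ j, (∑ k, 1 / 2 * (R j k + R k j) * μ' k w) * ρ j
        = 1 / 2 * (∑ j, ∑ k, R j k * (ρ j * μ' k w) + ∑ j, ∑ k, R j k * (ρ k * μ' j w)) := by
      have h1 : ∑ j, ∑ k, R j k * (ρ k * μ' j w) = ∑ j, ∑ k, R k j * (ρ j * μ' k w) :=
        Finset.sum_comm
      rw [h1, ← Finset.sum_add_distrib, Finset.mul_sum]
      refine Finset.sum_congr rfl fun j _ => ?_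
      rw [← Finset.sum_add_distrib, Finset.mul_sum, Finset.sum_mul]
      exact Finset.sum_congr rfl fun k _ => by ring
    rw [hsw]
    simp only [sub_apply, FunLike.coe_smul, Pi.smul_apply,
      FunLike.coe_sum, Finset.sum_apply, add_apply, smul_eq_mul,
      neg_apply, smul_neg]
    have hsplit : ∑ j, ∑ k, (R j k * (-(ρ j * μ' k w) + -(ρ k * μ' j w)) + ρ j * ρ k * R' j k)
        = -(∑ j, ∑ k, R j k * (ρ j * μ' k w)) - ∑ j, ∑ k, R j k * (ρ k * μ' j w)
          + ∑ j, ∑ k, ρ j * ρ k * R' j k := by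
      simp only [← Finset.sum_neg_distrib, ← Finset.sum_sub_distrib, ← Finset.sum_add_distrib]
      exact Finset.sum_congr rfl fun j _ => Finset.sum_congr rfl fun k _ => by ring
    have hN : ∑ j, ∑ k, -(1 / 2) * R' j k * (ρ j * ρ k)
        = -(1 / 2) * ∑ j, ∑ k, ρ j * ρ k * R' j k := by
      simp only [Finset.mul_sum]
      exact Finset.sum_congr rfl fun j _ => Finset.sum_congr rfl fun k _ => by ring
    rw [hN]
    refine (congrArg (fun u => -(1 / 2) * fderiv ℝ (fun t => Real.log (par t).varY.det) θ w
      - 1 / 2 * u) hsplit).trans ?_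
    ring

end Stage2Param

end LogLik

end

end TwoStage

namespace TwoStage

noncomputable section

/-! ### The stage-2 score is centred at the limiting parameter -/

section ProductMoments

set_option linter.unusedSectionVars false

variable {α β γ : Type*} [MeasurableSpace α] [MeasurableSpace β] [MeasurableSpace γ]
  {μ : Measure α} [IsProbabilityMeasure μ] {ν : Measure β} [IsProbabilityMeasure ν]
  {κ : Measure γ} [IsProbabilityMeasure κ]

lemma memLp_comp_fst {f : α → ℝ} (hf : MemLp f 2 μ) :
    MemLp (fun w : α × β => f w.1) 2 (μ.prod ν) :=
  hf.comp_measurePreserving measurePreserving_fst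

lemma memLp_comp_snd {f : β → ℝ} (hf : MemLp f 2 ν) :
    MemLp (fun w : α × β => f w.2) 2 (μ.prod ν) :=
  hf.comp_measurePreserving measurePreserving_snd

lemma integral_add_prod {f : α → ℝ} {g : β → ℝ} (hf : MemLp f 2 μ) (hg : MemLp g 2 ν) :
    ∫ w, (f w.1 + g w.2) ∂(μ.prod ν) = ∫ a, f a ∂μ + ∫ b, g b ∂ν := by
  rw [integral_add ((memLp_comp_fst hf).integrable one_le_two)
    ((memLp_comp_snd hg).integrable one_le_two), integral_fun_fst, integral_fun_snd]
  simp

/-- Mixed terms factor by independence and vanish since `g` and `g'` are centred. The means of `f`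
and `f'` are unrestricted, so `f` may be a function of the covariates. -/
lemma integral_add_mul_add_prod {f f' : α → ℝ} {g g' : β → ℝ} (hf : MemLp f 2 μ)
    (hf' : MemLp f' 2 μ) (hg : MemLp g 2 ν) (hg' : MemLp g' 2 ν) (h0 : ∫ b, g b ∂ν = 0)
    (h0' : ∫ b, g' b ∂ν = 0) :
    ∫ w, (f w.1 + g w.2) * (f' w.1 + g' w.2) ∂(μ.prod ν)
      = ∫ a, f a * f' a ∂μ + ∫ b, g b * g' b ∂ν := by
  have h1 : Integrable (fun w => f w.1 * f' w.1) (μ.prod ν) :=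
    (memLp_comp_fst hf).integrable_mul (memLp_comp_fst hf')
  have h2 : Integrable (fun w => f w.1 * g' w.2) (μ.prod ν) :=
    (memLp_comp_fst hf).integrable_mul (memLp_comp_snd hg')
  have h3 : Integrable (fun w => f' w.1 * g w.2) (μ.prod ν) :=
    (memLp_comp_fst hf').integrable_mul (memLp_comp_snd hg)
  have h4 : Integrable (fun w => g w.2 * g' w.2) (μ.prod ν) :=
    (memLp_comp_snd hg).integrable_mul (memLp_comp_snd hg')
  have e : (fun w : α × β => (f w.1 + g w.2) * (f' w.1 + g' w.2)) = fun w =>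
      ((f w.1 * f' w.1 + g w.2 * g' w.2) + f w.1 * g' w.2) + f' w.1 * g w.2 := by
    ext w
    ring
  have e1 : ∫ w, f w.1 * f' w.1 ∂(μ.prod ν) = ∫ a, f a * f' a ∂μ := by
    simpa using integral_fun_fst (μ := μ) (ν := ν) fun a => f a * f' a
  have e2 : ∫ w, g w.2 * g' w.2 ∂(μ.prod ν) = ∫ b, g b * g' b ∂ν := by
    simpa using integral_fun_snd (μ := μ) (ν := ν) fun b => g b * g' b
  have h5 : Integrable (fun w => f w.1 * f' w.1 + g w.2 * g' w.2) (μ.prod ν) := h1.add h4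
  have h6 : Integrable (fun w => f w.1 * f' w.1 + g w.2 * g' w.2 + f w.1 * g' w.2) (μ.prod ν) :=
    h5.add h2
  rw [e, integral_add h6 h3, integral_add h5 h2, integral_add h1 h4,
    integral_prod_mul, integral_prod_mul, h0, h0', e1, e2]
  ring

lemma integral_mul_prod_three {A A' : α → ℝ} {B B' : β → ℝ} {C C' : γ → ℝ} (hA : MemLp A 2 μ)
    (hA' : MemLp A' 2 μ) (hB : MemLp B 2 ν) (hB' : MemLp B' 2 ν) (hC : MemLp C 2 κ)
    (hC' : MemLp C' 2 κ) (hB0 : ∫ b, B b ∂ν = 0) (hB0' : ∫ b, B' b ∂ν = 0)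
    (hC0 : ∫ c, C c ∂κ = 0) (hC0' : ∫ c, C' c ∂κ = 0) :
    ∫ w, (A w.1 + (B w.2.1 + C w.2.2)) * (A' w.1 + (B' w.2.1 + C' w.2.2)) ∂(μ.prod (ν.prod κ))
      = ∫ a, A a * A' a ∂μ + (∫ b, B b * B' b ∂ν + ∫ c, C c * C' c ∂κ) := by
  have hg : ∀ {B : β → ℝ} {C : γ → ℝ}, MemLp B 2 ν → MemLp C 2 κ →
      MemLp (fun v : β × γ => B v.1 + C v.2) 2 (ν.prod κ) := fun hB hC =>
    (memLp_comp_fst hB).add (memLp_comp_snd hC)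
  rw [integral_add_mul_add_prod (g := fun v : β × γ => B v.1 + C v.2)
    (g' := fun v : β × γ => B' v.1 + C' v.2) hA hA' (hg hB hC) (hg hB' hC')
    (by rw [integral_add_prod hB hC, hB0, hC0, add_zero])
    (by rw [integral_add_prod hB' hC', hB0', hC0', add_zero]),
    integral_add_mul_add_prod hB hB' hC hC' hC0 hC0']

lemma memLp_mv {k n : ℕ} {X : α → Vec k} (hX : MemLp X 2 μ) (A : Matrix (Fin n) (Fin k) ℝ)
    (j : Fin n) : MemLp (fun a => mv A (X a) j) 2 μ := by
  simp only [mv_apply]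
  exact memLp_finsetSum _ fun i _ => (memLp_euclidean_apply hX i).const_mul _

lemma integral_mv {k n : ℕ} {X : α → Vec k} (hX : MemLp X 2 μ) (h0 : ∫ a, X a ∂μ = 0)
    (A : Matrix (Fin n) (Fin k) ℝ) (j : Fin n) : ∫ a, mv A (X a) j ∂μ = 0 := by
  simp only [mv_apply]
  rw [integral_finsetSum _ fun i _ =>
    ((memLp_euclidean_apply hX i).integrable one_le_two).const_mul _]
  refine Finset.sum_eq_zero fun i _ => ?_
  rw [integral_const_mul, integral_euclidean_apply (hX.integrable one_le_two), h0]
  simp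

lemma integral_mv_mul_mv {k n : ℕ} {X : α → Vec k} (hX : MemLp X 2 μ)
    (A : Matrix (Fin n) (Fin k) ℝ) (i j : Fin n) :
    ∫ a, mv A (X a) i * mv A (X a) j ∂μ = (A * secondMoment μ X * Aᵀ) i j := by
  have h2 : ∀ a b, Integrable (fun w => X w a * X w b) μ := fun a b =>
    (memLp_euclidean_apply hX a).integrable_mul (memLp_euclidean_apply hX b)
  have h1 : ∀ w, mv A (X w) i * mv A (X w) j
      = ∑ b, ∑ a, A i a * A j b * (X w a * X w b) := by
    intro w
    rw [mv_apply, mv_apply, Finset.sum_mul_sum, Finset.sum_comm]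
    exact Finset.sum_congr rfl fun b _ => Finset.sum_congr rfl fun a _ => by ring
  simp_rw [h1]
  rw [integral_finsetSum _ fun b _ => integrable_finsetSum _ fun a _ => (h2 a b).const_mul _]
  rw [Matrix.mul_apply]
  refine Finset.sum_congr rfl fun b _ => ?_
  rw [integral_finsetSum _ fun a _ => (h2 a b).const_mul _, Matrix.mul_apply, Finset.sum_mul]
  refine Finset.sum_congr rfl fun a _ => ?_
  rw [integral_const_mul, secondMoment, Matrix.of_apply, Matrix.transpose_apply]
  ring

lemma memLp_affine {k n : ℕ} {X : α → Vec k} {Y : α → Vec n} (hX : MemLp X 2 μ)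
    (hY : MemLp Y 2 μ) (a : ℝ) (b : Fin k → ℝ) (g : Fin n → ℝ) :
    MemLp (fun w => a + ∑ i, b i * X w i + ∑ i, g i * Y w i) 2 μ := by
  have h1 : MemLp (fun w => ∑ i, b i * X w i) 2 μ :=
    memLp_finsetSum _ fun i _ => (memLp_euclidean_apply hX i).const_mul _
  have h2 : MemLp (fun w => ∑ i, g i * Y w i) 2 μ :=
    memLp_finsetSum _ fun i _ => (memLp_euclidean_apply hY i).const_mul _
  exact ((memLp_const a).add h1).add h2

end ProductMoments

/-! ### Moments and orthogonality of predictions in the stage-1 model. -/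

namespace Stage1Model

variable {q h r l : ℕ} {M : Stage1Model q h r} {PZ : Measure (Vec r)}

lemma measurable_mv {a b : ℕ} (A : Matrix (Fin a) (Fin b) ℝ) : Measurable (mv A) :=
  (LinearMap.continuous_of_finiteDimensional (Matrix.toEuclideanLin A)).measurable

lemma measurable_solution (M : Stage1Model q h r) :
    Measurable fun w : Vec r × Vec q × Vec h =>
      (M.latent w.1 w.2.1, M.indicator w.1 (M.latent w.1 w.2.1) w.2.2, w.1) := by
  have h1 := measurable_mv M.Γ
  have h2 := measurable_mv (1 - M.B)⁻¹
  have h3 := measurable_mv M.Λ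
  have h4 := measurable_mv M.K
  unfold latent indicator
  fun_prop

lemma Valid.isProbabilityMeasure_law [IsProbabilityMeasure PZ] (hM : M.Valid) :
    IsProbabilityMeasure (M.law PZ) := by
  have := hM.1
  have := hM.2.1
  exact Measure.isProbabilityMeasure_map M.measurable_solution.aemeasurable

lemma Valid.memLp_covariate [IsProbabilityMeasure PZ] (hM : M.Valid) (hZ : MemLp id 2 PZ) :
    MemLp (fun w : Vec q × Vec h × Vec r => w.2.2) 2 (M.law PZ) := by
  have := hM.1
  have := hM.2.1
  have hm : Measurable fun w : Vec q × Vec h × Vec r => w.2.2 := by fun_prop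
  rw [law, memLp_map_measure_iff hm.aestronglyMeasurable M.measurable_solution.aemeasurable]
  exact hZ.comp_measurePreserving measurePreserving_fst

variable {φ : Vec q → Vec l} {f : Vec h × Vec r → Vec l}

/-- Conditional expectation maps `L²` to `L²`. -/
lemma IsPrediction.memLp (hf : M.IsPrediction PZ φ f)
    (hφ : MemLp (fun w => φ w.1) 2 (M.law PZ)) : MemLp (fun w => f w.2) 2 (M.law PZ) :=
  (memLp_congr_ae hf.2.2).2 (hφ.condExp one_le_two)

/-- Prediction errors are orthogonal to square integrable functions of `(X, Z)`. -/
lemma IsPrediction.integral_mul_sub [IsFiniteMeasure (M.law PZ)] (hf : M.IsPrediction PZ φ f)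
    (hφ : MemLp (fun w => φ w.1) 2 (M.law PZ)) {g : Vec h × Vec r → ℝ} (hg : Measurable g)
    (hg2 : MemLp (fun w => g w.2) 2 (M.law PZ)) (i : Fin l) :
    ∫ w, g w.2 * (φ w.1 - f w.2) i ∂(M.law PZ) = 0 := by
  have hφi := memLp_euclidean_apply hφ i
  have hfi := memLp_euclidean_apply (hf.memLp hφ) i
  have hgφ : Integrable (fun w => g w.2 * φ w.1 i) (M.law PZ) := hg2.integrable_mul hφi
  have hgf : Integrable (fun w => g w.2 * f w.2 i) (M.law PZ) := hg2.integrable_mul hfi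
  have hgm : StronglyMeasurable[MeasurableSpace.comap
      (Prod.snd : Vec q × Vec h × Vec r → Vec h × Vec r) inferInstance]
      fun w : Vec q × Vec h × Vec r => g w.2 :=
    (hg.comp (comap_measurable _)).stronglyMeasurable
  have h1 := (EuclideanSpace.proj (𝕜 := ℝ) i : Vec l →L[ℝ] ℝ).comp_condExp_comm (m :=
    MeasurableSpace.comap (Prod.snd : Vec q × Vec h × Vec r → Vec h × Vec r) inferInstance) hf.1
  -- The factor is a function of the conditioning variables and is pulled out of the conditional
  -- expectation.
  have h2 := condExp_mul_of_stronglyMeasurable_left hgm hgφ (hφi.integrable one_le_two)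
  have h3 : (fun w => g w.2 * f w.2 i) =ᵐ[M.law PZ] (M.law PZ)[fun w => g w.2 * φ w.1 i |
      MeasurableSpace.comap Prod.snd inferInstance] := by
    filter_upwards [h1, h2, hf.2.2] with w e1 e2 e3
    refine Eq.trans ?_ e2.symm
    simp only [Pi.mul_apply]
    rw [e3]
    exact congrArg (g w.2 * ·) e1
  simp only [PiLp.sub_apply, mul_sub]
  rw [integral_sub hgφ hgf, integral_congr_ae h3, integral_condExp measurable_snd.comap_le, sub_self]

end Stage1Model

lemma inner_gradient {d : ℕ} (f : Vec d → ℝ) (x w : Vec d) : ⟪gradient f x, w⟫ = fderiv ℝ f x w :=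
  InnerProductSpace.toDual_symm_apply

lemma mv_mul {a b c : ℕ} (A : Matrix (Fin a) (Fin b) ℝ) (B : Matrix (Fin b) (Fin c) ℝ)
    (v : Vec c) : mv (A * B) v = mv A (mv B v) := by
  simp [mv, Matrix.toLpLin_apply, Matrix.mulVec_mulVec]

section Centring

variable {m p l r q h d : ℕ}

lemma measurable_observation {φ : Vec q → Vec l} (hφ : Measurable φ) (S : Stage2Param m p l r) :
    Measurable fun w : (Vec q × Vec h × Vec r) × Vec p × Vec m =>
      ((S.indicator w.1.2.2 (S.latent w.1.2.2 (φ w.1.1) w.2.1) w.2.2, w.1.2.1, w.1.2.2) :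
        Obs m h r) := by
  have h1 := Stage1Model.measurable_mv S.Γ
  have h2 := Stage1Model.measurable_mv S.B
  have h3 := Stage1Model.measurable_mv S.Λ
  have h4 := Stage1Model.measurable_mv S.K
  unfold Stage2Param.latent Stage2Param.indicator
  fun_prop

/-- The residual of `Y` is `Λ B (φ(ξ) - φ*) + Λ ζ + ε`, a sum of independent terms. It is orthogonal
to affine functions of `φ*` and `Z`, and its second moment is the modelled variance, so each
directional score has mean `c + ∑ N · varY = 0`. No normality is involved. -/
lemma integral_score2_eq_zero {M : Stage1Model q h r} (hM : M.Valid) {PZ : Measure (Vec r)}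
    [IsProbabilityMeasure PZ] (hZ : MemLp id 2 PZ) {φ : Vec q → Vec l} (hφm : Measurable φ)
    (hφ : MemLp (fun w => φ w.1) 2 (M.law PZ)) {f : Vec h × Vec r → Vec l}
    (hf : M.IsPrediction PZ φ f) {S : Stage2Param m p l r} {lawζ : Measure (Vec p)}
    [IsProbabilityMeasure lawζ] (hζ : IsResidualLaw lawζ S.Ψ) {lawε : Measure (Vec m)}
    [IsProbabilityMeasure lawε] (hε : IsResidualLaw lawε S.Ω)
    {par : Vec d → Stage2Param m p l r} {θ : Vec d} (hd : Stage2Param.DiffAt par θ)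
    (hlim : par θ = { S with Ψ := S.Ψ + S.B * M.predVar PZ φ f * S.Bᵀ })
    (hvar : (par θ).varY.PosDef)
    (hi : Integrable (fun o : Obs m h r => score2 par θ o.1 o.2.2 (f o.2))
      (obsLaw M PZ φ S lawζ lawε)) :
    ∫ o, score2 par θ o.1 o.2.2 (f o.2) ∂(obsLaw M PZ φ S lawζ lawε) = 0 := by
  have := hM.isProbabilityMeasure_law (PZ := PZ)
  have hT := measurable_observation (h := h) hφm S
  unfold obsLaw at hi ⊢
  rw [integral_map hT.aemeasurable hi.aestronglyMeasurable]
  have hi' := (integrable_map_measure hi.aestronglyMeasurable hT.aemeasurable).1 hi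
  refine ext_inner_left ℝ fun t => ?_
  rw [inner_zero_right]
  refine (integral_inner (𝕜 := ℝ) hi' t).symm.trans ?_
  obtain ⟨c, N, a, b, g, hcN, hfd⟩ := Stage2Param.exists_fderiv_logLik hd hvar t
  set δ : Vec q × Vec h × Vec r → Vec l := fun w => φ w.1 - f w.2 with hδ
  have hδ2 : MemLp δ 2 (M.law PZ) := hφ.sub (hf.memLp hφ)
  set A : Fin m → Vec q × Vec h × Vec r → ℝ := fun j w => mv (S.Λ * S.B) (δ w) j with hA
  set B : Fin m → Vec p → ℝ := fun j e => mv S.Λ e j with hB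
  set C : Fin m → Vec m → ℝ := fun j e => e j with hC
  have hA2 : ∀ j, MemLp (A j) 2 (M.law PZ) := fun j => memLp_mv hδ2 _ j
  have hB2 : ∀ j, MemLp (B j) 2 lawζ := fun j => memLp_mv hζ.1 _ j
  have hC2 : ∀ j, MemLp (C j) 2 lawε := fun j => memLp_euclidean_apply hε.1 j
  have hB0 : ∀ j, ∫ e, B j e ∂lawζ = 0 := fun j => integral_mv hζ.1 hζ.2.1 _ j
  have hC0 : ∀ j, ∫ e, C j e ∂lawε = 0 := fun j => by
    have h1 : ∫ e, C j e ∂lawε = (∫ e, e ∂lawε) j :=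
      integral_euclidean_apply (f := id) (hε.1.integrable one_le_two) j
    rw [h1, hε.2.1]
    rfl
  have hres : ∀ (w : (Vec q × Vec h × Vec r) × Vec p × Vec m) j,
      S.indicator w.1.2.2 (S.latent w.1.2.2 (φ w.1.1) w.2.1) w.2.2 j
        - (par θ).meanY w.1.2.2 (f w.1.2) j = A j w.1 + (B j w.2.1 + C j w.2.2) := by
    intro w j
    rw [← PiLp.sub_apply]
    simp only [hA, hB, hC, hδ, hlim, mv_mul, Stage2Param.meanY, Stage2Param.indicator,
      Stage2Param.latent, mv, map_add, map_sub, PiLp.add_apply, PiLp.sub_apply, add_zero]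
    ring
  set ρ : Fin m → (Vec q × Vec h × Vec r) × Vec p × Vec m → ℝ :=
    fun j w => A j w.1 + (B j w.2.1 + C j w.2.2) with hρ
  have hρ2 : ∀ j, MemLp (ρ j) 2 ((M.law PZ).prod (lawζ.prod lawε)) := fun j =>
    (memLp_comp_fst (hA2 j)).add (memLp_comp_snd (f := fun v : Vec p × Vec m => B j v.1 + C j v.2)
      ((memLp_comp_fst (hB2 j)).add (memLp_comp_snd (hC2 j))))
  -- The inflation of `Ψ` in `hlim` supplies exactly the term contributed by the prediction error.
  have hρρ : ∀ j k, ∫ w, ρ j w * ρ k w ∂((M.law PZ).prod (lawζ.prod lawε))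
      = (par θ).varY j k := by
    intro j k
    have e2 : secondMoment lawζ (id : Vec p → Vec p) = S.Ψ := by
      ext i k
      exact hζ.2.2 i k
    have eA : ∫ w, A j w * A k w ∂(M.law PZ)
        = (S.Λ * S.B * M.predVar PZ φ f * (S.Λ * S.B)ᵀ) j k := integral_mv_mul_mv hδ2 _ j k
    have eB : ∫ e, B j e * B k e ∂lawζ = (S.Λ * S.Ψ * S.Λᵀ) j k := by
      rw [← e2]
      exact integral_mv_mul_mv hζ.1 _ j k
    have eC : ∫ e, C j e * C k e ∂lawε = S.Ω j k := hε.2.2 j k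
    refine (integral_mul_prod_three (hA2 j) (hA2 k) (hB2 j) (hB2 k) (hC2 j) (hC2 k) (hB0 j)
      (hB0 k) (hC0 j) (hC0 k)).trans ?_
    rw [eA, eB, eC, hlim, Stage2Param.varY, ← add_assoc]
    simp only [Matrix.mul_add, Matrix.add_mul, Matrix.transpose_mul, Matrix.mul_assoc,
      Matrix.add_apply]
    ring
  -- Independence and centring remove `ζ` and `ε`; the remaining prediction error is orthogonal to
  -- functions of `(X, Z)`.
  have hgρ : ∀ (G : Vec h × Vec r → ℝ), Measurable G → MemLp (fun w => G w.2) 2 (M.law PZ) →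
      ∀ j, ∫ w, G w.1.2 * ρ j w ∂((M.law PZ).prod (lawζ.prod lawε)) = 0 := by
    intro G hG hG2 j
    have h1 := integral_mul_prod_three (A := fun w => G w.2) (B := fun _ => 0) (C := fun _ => 0)
      (κ := lawε) (ν := lawζ) hG2 (hA2 j) MemLp.zero (hB2 j) MemLp.zero (hC2 j) (by simp) (hB0 j)
      (by simp) (hC0 j)
    simp only [add_zero, zero_mul, integral_zero] at h1
    refine h1.trans ?_
    simp only [hA, mv_apply, Finset.mul_sum]
    have h2 : ∀ i, Integrable (fun w => G w.2 * δ w i) (M.law PZ) := fun i =>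
      hG2.integrable_mul (memLp_euclidean_apply hδ2 i)
    have h3 : ∀ i w, G w.2 * ((S.Λ * S.B) j i * δ w i) = (S.Λ * S.B) j i * (G w.2 * δ w i) :=
      fun i w => by ring
    simp only [h3]
    rw [integral_finsetSum _ fun i _ => (h2 i).const_mul _]
    refine Finset.sum_eq_zero fun i _ => ?_
    rw [integral_const_mul, hf.integral_mul_sub hφ hG hG2 i, mul_zero]
  have hGm : ∀ j, Measurable fun x : Vec h × Vec r =>
      a j + ∑ i, b j i * f x i + ∑ i, g j i * x.2 i := fun j => by
    have := hf.2.1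
    fun_prop
  have hG2 : ∀ j, MemLp (fun w : Vec q × Vec h × Vec r =>
      a j + ∑ i, b j i * f w.2 i + ∑ i, g j i * w.2.2 i) 2 (M.law PZ) := fun j =>
    memLp_affine (hf.memLp hφ) (hM.memLp_covariate hZ) (a j) (b j) (g j)
  have hfinal : ∀ w : (Vec q × Vec h × Vec r) × Vec p × Vec m,
      ⟪t, score2 par θ (S.indicator w.1.2.2 (S.latent w.1.2.2 (φ w.1.1) w.2.1) w.2.2) w.1.2.2
        (f (w.1.2.1, w.1.2.2))⟫
      = (c + ∑ j, ∑ k, N j k * (ρ j w * ρ k w))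
        + ∑ j, (a j + ∑ i, b j i * f w.1.2 i + ∑ i, g j i * w.1.2.2 i) * ρ j w := by
    intro w
    rw [real_inner_comm, score2, inner_gradient, (hfd _ _ _).2]
    simp only [Prod.mk.eta, hres, hρ]
  refine (integral_congr_ae (ae_of_all _ hfinal)).trans ?_
  have i1 : ∀ j k, Integrable (fun w => N j k * (ρ j w * ρ k w))
      ((M.law PZ).prod (lawζ.prod lawε)) := fun j k => ((hρ2 j).integrable_mul (hρ2 k)).const_mul _
  have i2 : ∀ j, Integrable (fun w : (Vec q × Vec h × Vec r) × Vec p × Vec m =>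
      (a j + ∑ i, b j i * f w.1.2 i + ∑ i, g j i * w.1.2.2 i) * ρ j w)
      ((M.law PZ).prod (lawζ.prod lawε)) := fun j =>
    (memLp_comp_fst (hG2 j)).integrable_mul (hρ2 j)
  have i3 : Integrable (fun w => ∑ j, ∑ k, N j k * (ρ j w * ρ k w))
      ((M.law PZ).prod (lawζ.prod lawε)) :=
    integrable_finsetSum _ fun j _ => integrable_finsetSum _ fun k _ => i1 j k
  have i4 : Integrable (fun w => c + ∑ j, ∑ k, N j k * (ρ j w * ρ k w))
      ((M.law PZ).prod (lawζ.prod lawε)) := (integrable_const c).add i3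
  rw [integral_add i4 (integrable_finsetSum _ fun j _ => i2 j),
    integral_add (integrable_const _) i3, integral_finsetSum _ fun j _ => i2 j,
    integral_finsetSum _ fun j _ => integrable_finsetSum _ fun k _ => i1 j k]
  rw [Finset.sum_eq_zero fun j _ => hgρ _ (hGm j) (hG2 j) j, add_zero]
  refine Eq.trans ?_ hcN
  congr 1
  · simp
  · refine Finset.sum_congr rfl fun j _ => ?_
    rw [integral_finsetSum _ fun k _ => i1 j k]
    refine Finset.sum_congr rfl fun k _ => ?_
    rw [integral_const_mul, hρρ]

end Centring

end

end TwoStage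

namespace TwoStage

noncomputable section

/-! ### Densities of multivariate normal distributions -/

lemma inner_mv_left {n k : ℕ} (A : Matrix (Fin n) (Fin k) ℝ) (u : Vec k) (v : Vec n) :
    ⟪mv A u, v⟫ = ⟪u, mv Aᵀ v⟫ := by
  rw [real_inner_comm, inner_mv, inner_mv, Finset.sum_comm]
  refine Finset.sum_congr rfl fun i _ => Finset.sum_congr rfl fun j _ => ?_
  rw [Matrix.transpose_apply]
  ring

lemma mv_one {n : ℕ} (v : Vec n) : mv (1 : Matrix (Fin n) (Fin n) ℝ) v = v := by
  simp [mv]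

section StdGaussian

variable {n : ℕ}

/-- The density of the standard normal distribution. -/
def stdPDF (x : Vec n) : ℝ := (Real.sqrt ((2 * Real.pi) ^ n))⁻¹ * Real.exp (-‖x‖ ^ 2 / 2)

lemma integrable_stdPDF : Integrable (stdPDF : Vec n → ℝ) := by
  have h := (GaussianFourier.integrable_cexp_neg_mul_sq_norm_add (V := Vec n) (b := 1 / 2)
    (by norm_num) 0 0).re
  refine (h.const_mul (Real.sqrt ((2 * Real.pi) ^ n))⁻¹).congr (ae_of_all _ fun x => ?_)
  simp only [stdPDF]
  congr 1
  have : (-(1 / 2) * (‖x‖ : ℂ) ^ 2 + 0 * ((⟪(0 : Vec n), x⟫ : ℝ) : ℂ))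
      = ((-‖x‖ ^ 2 / 2 : ℝ) : ℂ) := by
    push_cast
    ring
  rw [this, ← Complex.ofReal_exp]
  rfl

lemma stdPDF_nonneg (x : Vec n) : 0 ≤ stdPDF x := by unfold stdPDF; positivity

lemma measurable_stdPDF : Measurable (stdPDF : Vec n → ℝ) := by unfold stdPDF; fun_prop

/-- Both measures have the same characteristic function, by the Gaussian Fourier integral, whose
factor `(2π) ^ (n / 2)` cancels the normalisation. -/
lemma stdGaussian_eq_withDensity :
    stdGaussian (Vec n) = volume.withDensity fun x => ENNReal.ofReal (stdPDF x) := by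
  have : IsFiniteMeasure (volume.withDensity fun x : Vec n => ENNReal.ofReal (stdPDF x)) :=
    isFiniteMeasure_withDensity_ofReal integrable_stdPDF.2
  refine Measure.ext_of_charFun (funext fun t => ?_)
  rw [charFun_stdGaussian, charFun_apply, integral_withDensity_eq_integral_toReal_smul
    measurable_stdPDF.ennreal_ofReal (ae_of_all _ fun _ => ENNReal.ofReal_lt_top)]
  have h := GaussianFourier.integral_cexp_neg_mul_sq_norm_add (V := Vec n) (b := 1 / 2)
    (by norm_num) Complex.I t
  have e : ∀ x : Vec n, (ENNReal.ofReal (stdPDF x)).toReal • Complex.exp (⟪x, t⟫ * Complex.I)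
      = ((Real.sqrt ((2 * Real.pi) ^ n))⁻¹ : ℝ) *
        Complex.exp (-(1 / 2) * (‖x‖ : ℂ) ^ 2 + Complex.I * ((⟪t, x⟫ : ℝ) : ℂ)) := by
    intro x
    rw [ENNReal.toReal_ofReal (stdPDF_nonneg x), stdPDF, Complex.real_smul, Complex.ofReal_mul,
      mul_assoc, Complex.ofReal_exp, ← Complex.exp_add, real_inner_comm]
    congr 2
    push_cast
    ring
  simp only [e]
  rw [integral_const_mul, h, finrank_euclideanSpace_fin]
  have hpow : ((Real.pi : ℂ) / (1 / 2)) ^ ((n : ℂ) / 2) = (Real.sqrt ((2 * Real.pi) ^ n) : ℝ) := by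
    have h1 : ((Real.pi : ℂ) / (1 / 2)) = ((2 * Real.pi : ℝ) : ℂ) := by
      push_cast
      ring
    have h2 : ((n : ℂ) / 2) = ((n / 2 : ℝ) : ℂ) := by push_cast; ring
    rw [h1, h2, ← Complex.ofReal_cpow (by positivity), Real.sqrt_eq_rpow,
      ← Real.rpow_natCast_mul (by positivity)]
    congr 2
    ring
  have h0 : ((Real.sqrt ((2 * Real.pi) ^ n) : ℝ) : ℂ) ≠ 0 := by
    exact_mod_cast (Real.sqrt_pos.2 (by positivity)).ne'
  rw [hpow, ← mul_assoc, Complex.ofReal_inv, inv_mul_cancel₀ h0, one_mul]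
  congr 1
  rw [Complex.I_sq]
  ring

end StdGaussian

section Multivariate

open scoped MatrixOrder

variable {n : ℕ} {S : Matrix (Fin n) (Fin n) ℝ}

/-- The Jacobian identity for the substitution `y = μ + S^{1/2} x`. -/
lemma stdPDF_eq (hS : S.PosDef) (μ x : Vec n) :
    stdPDF x = |(CFC.sqrt S).det| * mvnPDF μ S (μ + mv (CFC.sqrt S) x) := by
  have hLL : CFC.sqrt S * CFC.sqrt S = S := CFC.sqrt_mul_sqrt_self S hS.posSemidef.nonneg
  have hL : (CFC.sqrt S)ᵀ = CFC.sqrt S := by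
    have h := (Matrix.nonneg_iff_posSemidef.1 (CFC.sqrt_nonneg S)).1.eq
    rwa [Matrix.conjTranspose_eq_transpose_of_trivial] at h
  have hdet : (CFC.sqrt S).det * (CFC.sqrt S).det = S.det := by
    rw [← Matrix.det_mul, hLL]
  have hd0 : (CFC.sqrt S).det ≠ 0 := fun h => by
    rw [h, mul_zero] at hdet
    exact hS.det_pos.ne hdet
  have hinv : (CFC.sqrt S)ᵀ * S⁻¹ * CFC.sqrt S = 1 := by
    have hu : IsUnit (CFC.sqrt S).det := isUnit_iff_ne_zero.2 hd0
    calc (CFC.sqrt S)ᵀ * S⁻¹ * CFC.sqrt S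
        = CFC.sqrt S * (CFC.sqrt S * CFC.sqrt S)⁻¹ * CFC.sqrt S := by rw [hL, hLL]
      _ = (CFC.sqrt S * (CFC.sqrt S)⁻¹) * ((CFC.sqrt S)⁻¹ * CFC.sqrt S) := by
        rw [Matrix.mul_inv_rev]
        simp only [Matrix.mul_assoc]
      _ = 1 := by rw [Matrix.mul_nonsing_inv _ hu, Matrix.nonsing_inv_mul _ hu, one_mul]
  rw [mvnPDF, add_sub_cancel_left, inner_mv_left, ← mv_mul, ← mv_mul, hinv,
    mv_one, real_inner_self_eq_norm_sq, stdPDF, ← mul_assoc]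
  congr 1
  rw [Real.sqrt_mul (by positivity), ← hdet, Real.sqrt_mul_self_eq_abs, mul_inv]
  have := abs_ne_zero.2 hd0
  field_simp

lemma mvnPDF_pos (hS : S.PosDef) (μ x : Vec n) : 0 < mvnPDF μ S x := by
  have := hS.det_pos
  unfold mvnPDF
  positivity

lemma continuous_mvnPDF {A : Type*} [TopologicalSpace A] (S : Matrix (Fin n) (Fin n) ℝ)
    {μ x : A → Vec n} (hμ : Continuous μ) (hx : Continuous x) :
    Continuous fun a => mvnPDF (μ a) S (x a) := by
  have h1 : Continuous (mv S⁻¹) := LinearMap.continuous_of_finiteDimensional _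
  unfold mvnPDF
  fun_prop

lemma lintegral_multivariateGaussian (hS : S.PosDef) (μ : Vec n) {g : Vec n → ℝ≥0∞}
    (hg : Measurable g) :
    ∫⁻ x, g x ∂(multivariateGaussian μ S) = ∫⁻ x, ENNReal.ofReal (mvnPDF μ S x) * g x := by
  have hL : Continuous (mv (CFC.sqrt S)) := LinearMap.continuous_of_finiteDimensional _
  have hdet : LinearMap.det (Matrix.toEuclideanLin (CFC.sqrt S)) = (CFC.sqrt S).det := by
    rw [Matrix.toEuclideanLin, Matrix.toLpLin_eq_toLin, LinearMap.det_toLin]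
  have hd0 : (CFC.sqrt S).det ≠ 0 := by
    have hLL : CFC.sqrt S * CFC.sqrt S = S := CFC.sqrt_mul_sqrt_self S hS.posSemidef.nonneg
    have h := hS.det_pos.ne'
    rw [← hLL, Matrix.det_mul] at h
    exact left_ne_zero_of_mul h
  set G : Vec n → ℝ≥0∞ := fun x => ENNReal.ofReal (mvnPDF μ S x) * g x with hG
  have hGm : Measurable G :=
    (continuous_mvnPDF S continuous_const continuous_id).measurable.ennreal_ofReal.mul hg
  have hm : Measurable fun x => μ + mv (CFC.sqrt S) x := by
    have := hL.measurable
    fun_prop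
  -- True by definition, which reduces the claim to a linear change of variables for Lebesgue
  -- measure.
  have h1 : multivariateGaussian μ S
      = (stdGaussian (Vec n)).map fun x => μ + mv (CFC.sqrt S) x := rfl
  rw [h1, lintegral_map hg hm, stdGaussian_eq_withDensity]
  refine (lintegral_withDensity_eq_lintegral_mul _ measurable_stdPDF.ennreal_ofReal
    (hg.comp hm)).trans ?_
  have h2 : ∀ x, ENNReal.ofReal (stdPDF x) * g (μ + mv (CFC.sqrt S) x)
      = ENNReal.ofReal |(CFC.sqrt S).det| * G (μ + mv (CFC.sqrt S) x) := fun x => by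
    simp only [hG]
    rw [stdPDF_eq hS μ, ENNReal.ofReal_mul (abs_nonneg _), mul_assoc]
  have h3 : ∫⁻ x, G (μ + mv (CFC.sqrt S) x)
      = ENNReal.ofReal |((CFC.sqrt S).det)⁻¹| * ∫⁻ x, G x := by
    have h4 := Measure.map_linearMap_addHaar_eq_smul_addHaar (volume : Measure (Vec n))
      (f := Matrix.toEuclideanLin (CFC.sqrt S)) (by rwa [hdet])
    rw [← lintegral_map (f := fun y => G (μ + y)) (μ := volume)
      (hGm.comp (measurable_const_add μ)) hL.measurable]
    erw [h4]
    rw [lintegral_smul_measure, hdet, lintegral_add_left_eq_self]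
    rfl
  refine (lintegral_congr h2).trans ?_
  have hGm' : Measurable fun x => G (μ + mv (CFC.sqrt S) x) := hGm.comp hm
  rw [lintegral_const_mul _ hGm', h3, ← mul_assoc, ← ENNReal.ofReal_mul (abs_nonneg _),
    ← abs_mul, mul_inv_cancel₀ hd0]
  simp

end Multivariate

/-- An affine image of independent normal vectors is normal. -/
lemma map_add_mv_multivariateGaussian {q h : ℕ} {Ψ : Matrix (Fin q) (Fin q) ℝ}
    {Ω : Matrix (Fin h) (Fin h) ℝ} (hΨ : Ψ.PosSemidef) (hΩ : Ω.PosSemidef) (α : Vec q) (c : Vec h)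
    (A : Matrix (Fin h) (Fin q) ℝ) :
    ((multivariateGaussian α Ψ).prod (multivariateGaussian 0 Ω)).map
        (fun e => c + mv A e.1 + e.2) = multivariateGaussian (c + mv A α) (A * Ψ * Aᵀ + Ω) := by
  have hA : Continuous (mv A) := LinearMap.continuous_of_finiteDimensional _
  have hm : Measurable fun e : Vec q × Vec h => c + mv A e.1 + e.2 := by
    have := hA.measurable
    fun_prop
  have hS : (A * Ψ * Aᵀ + Ω).PosSemidef := by
    have := hΨ.mul_mul_conjTranspose_same A
    rw [Matrix.conjTranspose_eq_transpose_of_trivial] at this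
    exact this.add hΩ
  have := Measure.isProbabilityMeasure_map (μ := (multivariateGaussian α Ψ).prod
    (multivariateGaussian 0 Ω)) hm.aemeasurable
  -- Characteristic functions are used since `Ψ` and `Ω` may be singular, so densities need not
  -- exist.
  refine Measure.ext_of_charFun (funext fun t => ?_)
  rw [charFun_multivariateGaussian hS, charFun_apply, integral_map hm.aemeasurable
    (by fun_prop)]
  have e : ∀ e : Vec q × Vec h, Complex.exp (⟪c + mv A e.1 + e.2, t⟫ * Complex.I)
      = Complex.exp (⟪c, t⟫ * Complex.I) * (Complex.exp (⟪e.1, mv Aᵀ t⟫ * Complex.I)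
        * Complex.exp (⟪e.2, t⟫ * Complex.I)) := by
    intro e
    rw [← Complex.exp_add, ← Complex.exp_add, inner_add_left, inner_add_left, inner_mv_left]
    congr 1
    push_cast
    ring
  simp only [e]
  rw [integral_const_mul, integral_prod_mul (fun x => Complex.exp (⟪x, mv Aᵀ t⟫ * Complex.I))
    (fun x => Complex.exp (⟪x, t⟫ * Complex.I)), ← charFun_apply, ← charFun_apply,
    charFun_multivariateGaussian hΨ, charFun_multivariateGaussian hΩ, ← Complex.exp_add,
    ← Complex.exp_add]
  congr 1
  have h1 : t ⬝ᵥ (A * Ψ * Aᵀ + Ω) *ᵥ t = (mv Aᵀ t) ⬝ᵥ Ψ *ᵥ (mv Aᵀ t) + t ⬝ᵥ Ω *ᵥ t := by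
    rw [Matrix.add_mulVec, dotProduct_add]
    congr 1
    simp only [mv, Matrix.toLpLin_apply]
    rw [← Matrix.mulVec_mulVec, ← Matrix.mulVec_mulVec, Matrix.dotProduct_mulVec,
      Matrix.mulVec_transpose]
  have h2 : ⟪mv Aᵀ t, α⟫ = ⟪t, mv A α⟫ := by rw [inner_mv_left, Matrix.transpose_transpose]
  rw [h1, h2, inner_add_right, real_inner_comm t c, inner_zero_right]
  push_cast
  ring

end

end TwoStage

namespace TwoStage

noncomputable section

/-! ### The law of `(X, Z)` in Gaussian mixtures -/

namespace MixtureParam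

variable {c q h r : ℕ} {M : MixtureParam c q h r}

lemma continuous_density (M : MixtureParam c q h r) : Continuous M.density := by
  have h1 : Continuous (mv M.Γ) := LinearMap.continuous_of_finiteDimensional _
  have h2 : Continuous (mv (1 - M.B)⁻¹) := LinearMap.continuous_of_finiteDimensional _
  have h3 : Continuous (mv M.Λ) := LinearMap.continuous_of_finiteDimensional _
  have h4 : Continuous (mv M.K) := LinearMap.continuous_of_finiteDimensional _
  have h5 : ∀ k, Continuous fun w : Vec h × Vec r => M.meanX k w.2 := fun k => by
    unfold meanX
    fun_prop
  unfold density
  exact continuous_finsetSum _ fun k _ =>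
    continuous_const.mul (continuous_mvnPDF _ (h5 k) continuous_fst)

lemma Valid.density_pos (hM : M.Valid) (w : Vec h × Vec r) : 0 < M.density w := by
  obtain ⟨h0, h1, -, -, -, hpd⟩ := hM
  have h2 : ∃ k, 0 < M.π k := by
    by_contra! hk
    have : ∑ k, M.π k ≤ 0 := Finset.sum_nonpos fun k _ => hk k
    linarith
  obtain ⟨k, hk⟩ := h2
  exact Finset.sum_pos' (fun j _ => mul_nonneg (h0 j) (mvnPDF_pos (hpd j) _ _).le)
    ⟨k, Finset.mem_univ k, mul_pos hk (mvnPDF_pos (hpd k) _ _)⟩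

lemma Valid.isProbabilityMeasure (hM : M.Valid) : IsProbabilityMeasure M.toStage1.lawζ := by
  refine ⟨?_⟩
  simp only [toStage1, Measure.coe_finsetSum, Finset.sum_apply, Measure.smul_apply, measure_univ,
    smul_eq_mul, mul_one]
  rw [← ENNReal.ofReal_sum_of_nonneg fun k _ => hM.1 k, hM.2.1, ENNReal.ofReal_one]

lemma Valid.toStage1 (hM : M.Valid) : M.toStage1.Valid :=
  ⟨hM.isProbabilityMeasure,
    inferInstanceAs (IsProbabilityMeasure (multivariateGaussian 0 M.Ω)), hM.2.2.2.2.1⟩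

/-- The joint law of `(X, Z)` has density `density` with respect to `dx P_Z(dz)`. -/
theorem Valid.lawXZ_eq (hM : M.Valid) (PZ : Measure (Vec r)) [IsProbabilityMeasure PZ] :
    M.toStage1.lawXZ PZ
      = (volume.prod PZ).withDensity fun w => ENNReal.ofReal (M.density w) := by
  have := hM.isProbabilityMeasure
  have : IsProbabilityMeasure M.toStage1.lawε :=
    inferInstanceAs (IsProbabilityMeasure (multivariateGaussian 0 M.Ω))
  obtain ⟨h0, h1, hΨ, hΩ, -, hpd⟩ := hM
  -- Integrating over `z` last leaves, for fixed `z` and each class, an affine image of independent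
  -- normal vectors with nondegenerate variance `varX`.
  refine Measure.ext_of_lintegral _ fun g hg => ?_
  have hd := M.continuous_density.measurable.ennreal_ofReal
  rw [lintegral_withDensity_eq_lintegral_mul _ hd hg, lintegral_prod_symm' _ (hd.mul hg),
    Stage1Model.lawXZ, Stage1Model.law,
    Measure.map_map measurable_snd M.toStage1.measurable_solution,
    lintegral_map hg (measurable_snd.comp M.toStage1.measurable_solution)]
  refine (lintegral_prod _
    (hg.comp (measurable_snd.comp M.toStage1.measurable_solution)).aemeasurable).trans ?_
  refine lintegral_congr fun z => ?_
  set A : Matrix (Fin h) (Fin q) ℝ := M.Λ * (1 - M.B)⁻¹ with hA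
  set b : Vec h := M.ν + mv A (mv M.Γ z) + mv M.K z with hb
  have hx : ∀ e : Vec q × Vec h, M.toStage1.indicator z (M.toStage1.latent z e.1) e.2
      = b + mv A e.1 + e.2 := by
    intro e
    simp only [Stage1Model.indicator, Stage1Model.latent, MixtureParam.toStage1, hb, hA, mv_mul,
      zero_add, mv, map_add]
    abel
  have hm : Measurable fun e : Vec q × Vec h => b + mv A e.1 + e.2 := by
    have := Stage1Model.measurable_mv A
    fun_prop
  have hgz : Measurable fun x => g (x, z) := hg.comp (by fun_prop)
  simp only [Function.comp_def, hx]
  have hprod : M.toStage1.lawζ.prod M.toStage1.lawε = ∑ k, ENNReal.ofReal (M.π k) •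
      (multivariateGaussian (M.α k) (M.Ψ k)).prod (multivariateGaussian 0 M.Ω) := by
    have h2 : M.toStage1.lawζ = Measure.sum fun k =>
        ENNReal.ofReal (M.π k) • multivariateGaussian (M.α k) (M.Ψ k) := by
      rw [Measure.sum_fintype]
      rfl
    rw [h2, Measure.prod_sum_left, Measure.sum_fintype]
    exact Finset.sum_congr rfl fun k _ => Measure.prod_smul_left _
  rw [hprod, lintegral_finsetSum_measure]
  have hk : ∀ k, ∫⁻ e, g (b + mv A e.1 + e.2, z) ∂(ENNReal.ofReal (M.π k) •
      (multivariateGaussian (M.α k) (M.Ψ k)).prod (multivariateGaussian 0 M.Ω))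
      = ∫⁻ x, ENNReal.ofReal (M.π k * mvnPDF (M.meanX k z) (M.varX k) x) * g (x, z) := by
    intro k
    have hvar : A * M.Ψ k * Aᵀ + M.Ω = M.varX k := by
      rw [varX, hA, Matrix.transpose_mul]
      simp only [Matrix.mul_assoc]
    have hmean : b + mv A (M.α k) = M.meanX k z := by
      simp only [meanX, hb, hA, mv_mul, mv, map_add]
      abel
    rw [lintegral_smul_measure, ← lintegral_map (f := fun x => g (x, z)) hgz hm,
      map_add_mv_multivariateGaussian (hΨ k) hΩ, hvar, hmean,
      lintegral_multivariateGaussian (hpd k) _ hgz, smul_eq_mul, ← lintegral_const_mul]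
    · refine lintegral_congr fun x => ?_
      rw [ENNReal.ofReal_mul (h0 k), mul_assoc]
    · exact ((continuous_mvnPDF _ continuous_const continuous_id).measurable.ennreal_ofReal).mul hgz
  simp only [hk]
  rw [← lintegral_finsetSum]
  · refine lintegral_congr fun x => ?_
    rw [← Finset.sum_mul, ← ENNReal.ofReal_sum_of_nonneg fun k _ =>
      mul_nonneg (h0 k) (mvnPDF_pos (hpd k) _ _).le]
    rfl
  · intro k _
    exact ((continuous_const.mul (continuous_mvnPDF _ continuous_const
      continuous_id)).measurable.ennreal_ofReal).mul hgz

end MixtureParam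

end

end TwoStage

namespace TwoStage

noncomputable section

/-! ### Regular families of densities -/

section RegularDensities

set_option maxSynthPendingDepth 3

variable {A : Type*} [MeasurableSpace A] {ν : Measure A} {d : ℕ}

lemma sum_proj_smulRight {E : Type*} [NormedAddCommGroup E] [NormedSpace ℝ E]
    (L : Vec d →L[ℝ] E) :
    L = ∑ j, (EuclideanSpace.proj (𝕜 := ℝ) j : Vec d →L[ℝ] ℝ).smulRight
      (L (EuclideanSpace.single j 1)) := by
  ext v
  conv_lhs => rw [← (EuclideanSpace.basisFun (Fin d) ℝ).sum_repr v, map_sum]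
  simp

/-- Directional derivatives are limits of sequences of difference quotients, and finitely many
directions determine the derivative. -/
lemma aestronglyMeasurable_fderiv {E : Type*} [NormedAddCommGroup E] [NormedSpace ℝ E]
    {F : Vec d → A → E} {N : Set (Vec d)} (hN : IsOpen N)
    (hm : ∀ θ ∈ N, AEStronglyMeasurable (F θ) ν) {θ : Vec d} (hθ : θ ∈ N)
    (hd : ∀ᵐ a ∂ν, DifferentiableAt ℝ (fun t => F t a) θ) :
    AEStronglyMeasurable (fun a => fderiv ℝ (fun t => F t a) θ) ν := by
  have h1 : ∀ v, AEStronglyMeasurable (fun a => fderiv ℝ (fun t => F t a) θ v) ν := by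
    intro v
    have h2 : Tendsto (fun n : ℕ => θ + ((n : ℝ))⁻¹ • v) atTop (𝓝 θ) := by
      have := (tendsto_inv_atTop_zero.comp (tendsto_natCast_atTop_atTop (R := ℝ))).smul_const v
      simpa using this.const_add θ
    -- Shifting the index by `n₀` keeps all evaluation points inside `N`.
    obtain ⟨n₀, hn₀⟩ := eventually_atTop.1 (h2 (hN.mem_nhds hθ))
    refine aestronglyMeasurable_of_tendsto_ae atTop (f := fun (n : ℕ) a =>
      ((n + n₀ : ℕ) : ℝ) • (F (θ + (((n + n₀ : ℕ) : ℝ))⁻¹ • v) a - F θ a)) (fun n => ?_) ?_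
    · exact ((hm _ (hn₀ (n + n₀) (Nat.le_add_left _ _))).sub (hm θ hθ)).const_smul _
    · filter_upwards [hd] with a ha
      refine ha.hasFDerivAt.lim v ?_
      refine tendsto_norm_atTop_atTop.comp (tendsto_natCast_atTop_atTop.comp ?_)
      exact tendsto_add_atTop_nat n₀
  have h3 : (fun a => fderiv ℝ (fun t => F t a) θ) = fun a =>
      ∑ j, (EuclideanSpace.proj (𝕜 := ℝ) j : Vec d →L[ℝ] ℝ).smulRight
        (fderiv ℝ (fun t => F t a) θ (EuclideanSpace.single j 1)) :=
    funext fun a => sum_proj_smulRight _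
  rw [h3]
  refine Finset.aestronglyMeasurable_fun_sum _ fun j _ => ?_
  exact (ContinuousLinearMap.smulRightL ℝ (Vec d) E (EuclideanSpace.proj j)).continuous
    |>.comp_aestronglyMeasurable (h1 _)

/-- The Riesz isometry from functionals to vectors. -/
def rieszIso (d : ℕ) : (Vec d →L[ℝ] ℝ) →ₗᵢ[ℝ] Vec d where
  toFun := (InnerProductSpace.toDual ℝ (Vec d)).symm
  map_add' := map_add _
  map_smul' c x := by simp
  norm_map' := LinearIsometryEquiv.norm_map _

lemma inner_rieszIso (L : Vec d →L[ℝ] ℝ) (v : Vec d) : ⟪rieszIso d L, v⟫ = L v :=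
  InnerProductSpace.toDual_symm_apply

lemma gradient_eq_rieszIso (f : Vec d → ℝ) (θ : Vec d) :
    gradient f θ = rieszIso d (fderiv ℝ f θ) := rfl

/-- Derivative of the gradient of a twice differentiable function. -/
lemma hasFDerivAt_gradient {f : Vec d → ℝ} {θ : Vec d} (hf : DifferentiableAt ℝ (fderiv ℝ f) θ) :
    HasFDerivAt (fun t => gradient f t)
      ((rieszIso d).toContinuousLinearMap.comp (fderiv ℝ (fderiv ℝ f) θ)) θ :=
  (rieszIso d).toContinuousLinearMap.hasFDerivAt.comp θ hf.hasFDerivAt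

/-- A family of densities with respect to `ν`, three times continuously differentiable on a ball,
with dominated derivatives. -/
structure RegularDensity (ν : Measure A) (p : Vec d → A → ℝ) (θ₀ : Vec d) (r : ℝ)
    (f₁ f₂ f₃ : A → ℝ) : Prop where
  radius_pos : 0 < r
  measurable : ∀ θ ∈ Metric.ball θ₀ r, Measurable (p θ)
  pos : ∀ θ ∈ Metric.ball θ₀ r, ∀ a, 0 < p θ a
  integrable : ∀ θ ∈ Metric.ball θ₀ r, Integrable (p θ) ν
  integral_eq_one : ∀ θ ∈ Metric.ball θ₀ r, ∫ a, p θ a ∂ν = 1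
  integrable₁ : Integrable f₁ ν
  integrable₂ : Integrable f₂ ν
  integrable₃ : Integrable f₃ (ν.withDensity fun a => ENNReal.ofReal (p θ₀ a))
  contDiffAt : ∀ᵐ a ∂ν, ∀ θ ∈ Metric.ball θ₀ r, ContDiffAt ℝ 3 (fun t => p t a) θ
  bound₁ : ∀ᵐ a ∂ν, ∀ θ ∈ Metric.ball θ₀ r, ‖fderiv ℝ (fun t => p t a) θ‖ ≤ f₁ a
  bound₂ : ∀ᵐ a ∂ν, ∀ θ ∈ Metric.ball θ₀ r, ‖fderiv ℝ (fderiv ℝ fun t => p t a) θ‖ ≤ f₂ a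
  bound₃ : ∀ᵐ a ∂ν, ∀ θ ∈ Metric.ball θ₀ r,
    ‖fderiv ℝ (fderiv ℝ (fderiv ℝ fun t => Real.log (p t a))) θ‖ ≤ f₃ a

namespace RegularDensity

variable {p : Vec d → A → ℝ} {θ₀ : Vec d} {r : ℝ} {f₁ f₂ f₃ : A → ℝ}

lemma center_mem (h : RegularDensity ν p θ₀ r f₁ f₂ f₃) : θ₀ ∈ Metric.ball θ₀ r :=
  Metric.mem_ball_self h.radius_pos

lemma aestronglyMeasurable_fderiv (h : RegularDensity ν p θ₀ r f₁ f₂ f₃) {θ : Vec d}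
    (hθ : θ ∈ Metric.ball θ₀ r) :
    AEStronglyMeasurable (fun a => fderiv ℝ (fun t => p t a) θ) ν := by
  refine TwoStage.aestronglyMeasurable_fderiv Metric.isOpen_ball
    (fun t ht => (h.integrable t ht).aestronglyMeasurable) hθ ?_
  filter_upwards [h.contDiffAt] with a ha
  exact (ha θ hθ).differentiableAt (by norm_num)

lemma integrable_fderiv (h : RegularDensity ν p θ₀ r f₁ f₂ f₃) {θ : Vec d}
    (hθ : θ ∈ Metric.ball θ₀ r) : Integrable (fun a => fderiv ℝ (fun t => p t a) θ) ν :=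
  h.integrable₁.mono' (h.aestronglyMeasurable_fderiv hθ) (h.bound₁.mono fun _ ha => ha θ hθ)

/-- Differentiate the constant total mass under the integral. The result on the whole ball permits a
second differentiation in `integral_fderiv₂`. -/
lemma integral_fderiv (h : RegularDensity ν p θ₀ r f₁ f₂ f₃) {θ : Vec d}
    (hθ : θ ∈ Metric.ball θ₀ r) : ∫ a, fderiv ℝ (fun t => p t a) θ ∂ν = 0 := by
  have hnhds := Metric.isOpen_ball.mem_nhds hθ
  have h1 := hasFDerivAt_integral_of_dominated_of_fderiv_le (𝕜 := ℝ) (F := p)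
    (F' := fun t a => fderiv ℝ (fun t => p t a) t) hnhds
    (eventually_of_mem hnhds fun t ht => (h.integrable t ht).aestronglyMeasurable)
    (h.integrable θ hθ) (h.aestronglyMeasurable_fderiv hθ) h.bound₁ h.integrable₁ (by
      filter_upwards [h.contDiffAt] with a ha t ht
      exact ((ha t ht).differentiableAt (by norm_num)).hasFDerivAt)
  refine h1.unique ((hasFDerivAt_const (1 : ℝ) θ).congr_of_eventuallyEq ?_)
  exact eventually_of_mem hnhds fun t ht => h.integral_eq_one t ht

lemma differentiableAt_fderiv {f : Vec d → ℝ} {θ : Vec d} {n : ℕ} (hf : ContDiffAt ℝ (n + 1) f θ)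
    (hn : n ≠ 0) : DifferentiableAt ℝ (fderiv ℝ f) θ :=
  (hf.fderiv_right (m := n) le_rfl).differentiableAt (by exact_mod_cast hn)

lemma aestronglyMeasurable_fderiv₂ (h : RegularDensity ν p θ₀ r f₁ f₂ f₃) {θ : Vec d}
    (hθ : θ ∈ Metric.ball θ₀ r) :
    AEStronglyMeasurable (fun a => fderiv ℝ (fderiv ℝ fun t => p t a) θ) ν := by
  refine TwoStage.aestronglyMeasurable_fderiv Metric.isOpen_ball
    (F := fun t a => fderiv ℝ (fun t => p t a) t)
    (fun t ht => h.aestronglyMeasurable_fderiv ht) hθ ?_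
  filter_upwards [h.contDiffAt] with a ha
  exact differentiableAt_fderiv (n := 2) (ha θ hθ) two_ne_zero

lemma integrable_fderiv₂ (h : RegularDensity ν p θ₀ r f₁ f₂ f₃) {θ : Vec d}
    (hθ : θ ∈ Metric.ball θ₀ r) :
    Integrable (fun a => fderiv ℝ (fderiv ℝ fun t => p t a) θ) ν :=
  h.integrable₂.mono' (h.aestronglyMeasurable_fderiv₂ hθ) (h.bound₂.mono fun _ ha => ha θ hθ)

lemma integral_fderiv₂ (h : RegularDensity ν p θ₀ r f₁ f₂ f₃) {θ : Vec d}
    (hθ : θ ∈ Metric.ball θ₀ r) : ∫ a, fderiv ℝ (fderiv ℝ fun t => p t a) θ ∂ν = 0 := by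
  have hnhds := Metric.isOpen_ball.mem_nhds hθ
  have h1 := hasFDerivAt_integral_of_dominated_of_fderiv_le (𝕜 := ℝ)
    (F := fun t a => fderiv ℝ (fun t => p t a) t)
    (F' := fun t a => fderiv ℝ (fderiv ℝ fun t => p t a) t) hnhds
    (eventually_of_mem hnhds fun t ht => h.aestronglyMeasurable_fderiv ht)
    (h.integrable_fderiv hθ) (h.aestronglyMeasurable_fderiv₂ hθ) h.bound₂ h.integrable₂ (by
      filter_upwards [h.contDiffAt] with a ha t ht
      exact (differentiableAt_fderiv (n := 2) (ha t ht) two_ne_zero).hasFDerivAt)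
  refine h1.unique ((hasFDerivAt_const (0 : Vec d →L[ℝ] ℝ) θ).congr_of_eventuallyEq ?_)
  exact eventually_of_mem hnhds fun t ht => h.integral_fderiv ht

lemma ae_law {q : A → Prop} (hq : ∀ᵐ a ∂ν, q a) :
    ∀ᵐ a ∂(ν.withDensity fun a => ENNReal.ofReal (p θ₀ a)), q a :=
  withDensity_absolutelyContinuous _ _ hq

lemma integrable_law_iff (h : RegularDensity ν p θ₀ r f₁ f₂ f₃) {E : Type*}
    [NormedAddCommGroup E] [NormedSpace ℝ E] {g : A → E} :
    Integrable g (ν.withDensity fun a => ENNReal.ofReal (p θ₀ a))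
      ↔ Integrable (fun a => p θ₀ a • g a) ν := by
  rw [integrable_withDensity_iff_integrable_smul' (h.measurable _ h.center_mem).ennreal_ofReal
    (ae_of_all _ fun _ => ENNReal.ofReal_lt_top)]
  simp only [ENNReal.toReal_ofReal (h.pos _ h.center_mem _).le]

lemma integral_law (h : RegularDensity ν p θ₀ r f₁ f₂ f₃) {E : Type*}
    [NormedAddCommGroup E] [NormedSpace ℝ E] (g : A → E) :
    ∫ a, g a ∂(ν.withDensity fun a => ENNReal.ofReal (p θ₀ a)) = ∫ a, p θ₀ a • g a ∂ν := by
  rw [integral_withDensity_eq_integral_toReal_smul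
    (h.measurable _ h.center_mem).ennreal_ofReal (ae_of_all _ fun _ => ENNReal.ofReal_lt_top)]
  simp only [ENNReal.toReal_ofReal (h.pos _ h.center_mem _).le]

lemma contDiffAt_log (h : RegularDensity ν p θ₀ r f₁ f₂ f₃) :
    ∀ᵐ a ∂ν, ∀ θ ∈ Metric.ball θ₀ r, ContDiffAt ℝ 3 (fun t => Real.log (p t a)) θ := by
  filter_upwards [h.contDiffAt] with a ha θ hθ
  exact (ha θ hθ).log (h.pos θ hθ a).ne'

/-- The score function has mean zero. -/
lemma integral_score (h : RegularDensity ν p θ₀ r f₁ f₂ f₃) :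
    ∫ a, gradient (fun t => Real.log (p t a)) θ₀
      ∂(ν.withDensity fun a => ENNReal.ofReal (p θ₀ a)) = 0 := by
  rw [h.integral_law]
  have h1 : (fun a => p θ₀ a • gradient (fun t => Real.log (p t a)) θ₀) =ᵐ[ν]
      fun a => (rieszIso d).toContinuousLinearMap (fderiv ℝ (fun t => p t a) θ₀) := by
    filter_upwards [h.contDiffAt] with a ha
    have hp := (h.pos _ h.center_mem a).ne'
    rw [gradient_eq_rieszIso, fderiv.log
      ((ha _ h.center_mem).differentiableAt (by norm_num)) hp, map_smul, smul_smul,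
      mul_inv_cancel₀ hp, one_smul]
    rfl
  rw [integral_congr_ae h1, ContinuousLinearMap.integral_comp_comm _
    (h.integrable_fderiv h.center_mem), h.integral_fderiv h.center_mem, map_zero]

/-- The pointwise form of the information identity: after integration the second derivative of the
density drops out. -/
lemma fderiv_fderiv_log {f : Vec d → ℝ} {θ : Vec d} (hf : ContDiffAt ℝ 3 f θ) (h0 : 0 < f θ)
    (v : Vec d) :
    f θ • fderiv ℝ (fderiv ℝ fun t => Real.log (f t)) θ v = fderiv ℝ (fderiv ℝ f) θ v
      - f θ • (fderiv ℝ (fun t => Real.log (f t)) θ v • fderiv ℝ (fun t => Real.log (f t)) θ) := by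
  have hd := hf.differentiableAt (n := 3) (by norm_num)
  have hd2 := differentiableAt_fderiv (n := 2) hf two_ne_zero
  have h1 : (fderiv ℝ fun t => Real.log (f t)) =ᶠ[𝓝 θ] fun t => (f t)⁻¹ • fderiv ℝ f t := by
    have h2 : ∀ᶠ t in 𝓝 θ, ContDiffAt ℝ 3 f t := hf.eventually (by norm_num)
    filter_upwards [h2, hf.continuousAt.eventually_const_lt h0] with t ht ht0
    exact fderiv.log (ht.differentiableAt (by norm_num)) ht0.ne'
  have h2 : HasFDerivAt (fun t => (f t)⁻¹ • fderiv ℝ f t) _ θ :=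
    ((hasDerivAt_inv h0.ne').comp_hasFDerivAt θ hd.hasFDerivAt).smul hd2.hasFDerivAt
  rw [h1.fderiv_eq, h2.fderiv, fderiv.log hd h0.ne']
  ext w
  simp only [FunLike.coe_smul, Pi.smul_apply, add_apply, sub_apply, smul_eq_mul,
    ContinuousLinearMap.smulRight_apply, Function.comp_apply]
  field_simp
  ring

/-- The information identity: minus the expected derivative of the score is the second moment of
the score. -/
lemma integral_fderiv_score (h : RegularDensity ν p θ₀ r f₁ f₂ f₃)
    (h2 : MemLp (fun a => gradient (fun t => Real.log (p t a)) θ₀) 2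
      (ν.withDensity fun a => ENNReal.ofReal (p θ₀ a))) :
    Integrable (fun a => fderiv ℝ (fun θ => gradient (fun t => Real.log (p t a)) θ) θ₀)
      (ν.withDensity fun a => ENNReal.ofReal (p θ₀ a)) ∧
    ∫ a, fderiv ℝ (fun θ => gradient (fun t => Real.log (p t a)) θ) θ₀
        ∂(ν.withDensity fun a => ENNReal.ofReal (p θ₀ a))
      = -∫ a, (innerSL ℝ (gradient (fun t => Real.log (p t a)) θ₀)).smulRight
          (gradient (fun t => Real.log (p t a)) θ₀)
          ∂(ν.withDensity fun a => ENNReal.ofReal (p θ₀ a)) := by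
  set Q := ν.withDensity fun a => ENNReal.ofReal (p θ₀ a) with hQ
  set s : A → Vec d := fun a => gradient (fun t => Real.log (p t a)) θ₀ with hs
  have hI : Integrable (fun a => (innerSL ℝ (s a)).smulRight (s a)) Q := by
    have hc : Continuous fun v : Vec d => (innerSL ℝ v).smulRight v := by fun_prop
    refine ((memLp_two_iff_integrable_sq_norm h2.1).1 h2).mono'
      (hc.comp_aestronglyMeasurable h2.1) (ae_of_all _ fun a => ?_)
    rw [ContinuousLinearMap.norm_smulRight_apply, innerSL_apply_norm, sq]
  have hR : Integrable (fun a => (rieszIso d).toContinuousLinearMap.comp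
      (fderiv ℝ (fderiv ℝ fun t => p t a) θ₀)) ν :=
    (ContinuousLinearMap.compL ℝ (Vec d) (Vec d →L[ℝ] ℝ) (Vec d)
      (rieszIso d).toContinuousLinearMap).integrable_comp (h.integrable_fderiv₂ h.center_mem)
  have hR0 : ∫ a, (rieszIso d).toContinuousLinearMap.comp
      (fderiv ℝ (fderiv ℝ fun t => p t a) θ₀) ∂ν = 0 := by
    have := (ContinuousLinearMap.compL ℝ (Vec d) (Vec d →L[ℝ] ℝ) (Vec d)
      (rieszIso d).toContinuousLinearMap).integral_comp_comm (h.integrable_fderiv₂ h.center_mem)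
    rw [h.integral_fderiv₂ h.center_mem, map_zero] at this
    exact this
  have hid : (fun a => p θ₀ a • fderiv ℝ (fun θ => gradient (fun t => Real.log (p t a)) θ) θ₀)
      =ᵐ[ν] fun a => (rieszIso d).toContinuousLinearMap.comp
        (fderiv ℝ (fderiv ℝ fun t => p t a) θ₀) - p θ₀ a • (innerSL ℝ (s a)).smulRight (s a) := by
    filter_upwards [h.contDiffAt, h.contDiffAt_log] with a ha hl
    rw [(hasFDerivAt_gradient (differentiableAt_fderiv (n := 2) (hl _ h.center_mem)
      two_ne_zero)).fderiv]
    ext1 v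
    have h3 := congrArg (rieszIso d) (fderiv_fderiv_log (ha _ h.center_mem)
      (h.pos _ h.center_mem a) v)
    rw [map_smul, map_sub, map_smul, map_smul, ← inner_rieszIso (fderiv ℝ (fun t =>
      Real.log (p t a)) θ₀)] at h3
    exact h3
  have hpI := h.integrable_law_iff.1 hI
  refine ⟨h.integrable_law_iff.2 ((hR.sub hpI).congr hid.symm), ?_⟩
  rw [h.integral_law, integral_congr_ae hid, integral_sub hR hpI, hR0, zero_sub, h.integral_law]

/-- The mean value inequality applied to the Hessian of the log-density; the Riesz isometry
preserves norms. -/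
lemma score_lipschitz (h : RegularDensity ν p θ₀ r f₁ f₂ f₃) :
    ∀ᵐ a ∂ν, ∀ θ ∈ Metric.ball θ₀ r,
      DifferentiableAt ℝ (fun θ => gradient (fun t => Real.log (p t a)) θ) θ ∧
      ‖fderiv ℝ (fun θ => gradient (fun t => Real.log (p t a)) θ) θ
        - fderiv ℝ (fun θ => gradient (fun t => Real.log (p t a)) θ) θ₀‖ ≤ f₃ a * ‖θ - θ₀‖ := by
  filter_upwards [h.contDiffAt_log, h.bound₃] with a hl hb θ hθ
  have hd2 : ∀ t ∈ Metric.ball θ₀ r,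
      DifferentiableAt ℝ (fderiv ℝ fun t => Real.log (p t a)) t := fun t ht =>
    differentiableAt_fderiv (n := 2) (hl t ht) two_ne_zero
  have h1 := hasFDerivAt_gradient (hd2 θ hθ)
  refine ⟨h1.differentiableAt, ?_⟩
  rw [h1.fderiv, (hasFDerivAt_gradient (hd2 _ h.center_mem)).fderiv, ← ContinuousLinearMap.comp_sub,
    LinearIsometry.norm_toContinuousLinearMap_comp]
  refine (convex_ball θ₀ r).norm_image_sub_le_of_norm_fderiv_le (𝕜 := ℝ) (fun t ht => ?_) hb
    h.center_mem hθ
  have h3 := (hl t ht).fderiv_right (m := 2) (by norm_num)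
  exact (h3.fderiv_right (m := 1) (by norm_num)).differentiableAt (by norm_num)

end RegularDensity

end RegularDensities

end

end TwoStage

namespace TwoStage

noncomputable section

/-! ### Maximum likelihood estimation in stage 1 -/

section MLE

variable {Ω A : Type*} [MeasurableSpace Ω] [MeasurableSpace A] {P : Measure Ω}
  [IsProbabilityMeasure P] {O : ℕ → Ω → A} {Q : Measure A} {d : ℕ}

lemma IsInfluence.clm_apply {ψ : A → Vec d} (hψ : IsInfluence Q ψ) [IsProbabilityMeasure Q]
    (L : Vec d →L[ℝ] Vec d) : IsInfluence Q fun a => L (ψ a) := by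
  refine ⟨L.continuous.measurable.comp_aemeasurable hψ.1, L.comp_memLp' hψ.2.1, ?_⟩
  rw [L.integral_comp_comm (hψ.2.1.integrable one_le_two), hψ.2.2, map_zero]

/-- Roots of a score equation whose derivative is Lipschitz with integrable constant. -/
theorem exists_radius_score (hO : IsSample P O Q) {s : Vec d → A → Vec d} {θ₀ : Vec d} {r₀ : ℝ}
    (hr₀ : 0 < r₀) {f : A → ℝ} (hf : Integrable f Q) (hψ : IsInfluence Q (s θ₀))
    (hs : ∀ᵐ a ∂Q, ∀ θ ∈ Metric.ball θ₀ r₀, DifferentiableAt ℝ (fun t => s t a) θ ∧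
      ‖fderiv ℝ (fun t => s t a) θ - fderiv ℝ (fun t => s t a) θ₀‖ ≤ f a * ‖θ - θ₀‖)
    (hi : Integrable (fun a => fderiv ℝ (fun t => s t a) θ₀) Q) {I : Vec d →L[ℝ] Vec d}
    (hI : I.IsInvertible) (hint : ∫ a, fderiv ℝ (fun t => s t a) θ₀ ∂Q = -I) :
    ∃ ρ > 0, UniqueLocalRoot P O (fun _ _ => s) θ₀ ρ ∧
      ∀ T : ℕ → Ω → Vec d, IsLocalRoot P O (fun _ _ => s) θ₀ ρ T →
        AsympLinear P O θ₀ (fun a => I.inverse (s θ₀ a)) T ∧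
        EmpL2 P O (fun x a => (empMean O x.1 x.2 fun a' =>
          -fderiv ℝ (fun t => s t a') (T x.1 x.2)).inverse (s (T x.1 x.2) a))
          (fun a => I.inverse (s θ₀ a)) := by
  have hQ := hO.isProbabilityMeasure
  set G : A → Vec d →L[ℝ] Vec d := fun a => fderiv ℝ (fun t => s t a) θ₀ with hG
  have hGlim : Tendsto (fun x : ℕ × Ω => empMean O x.1 x.2 G) (whp P) (𝓝 (-I)) := by
    rw [← hint]
    exact hO.tendsto_empMean hi
  have hflim := hO.tendsto_empMean hf.norm
  set κ := ∫ a, ‖f a‖ ∂Q with hκ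
  have hκ0 : 0 ≤ κ := integral_nonneg fun _ => norm_nonneg _
  -- One application of the law of large numbers to the Lipschitz constants gives control uniform in
  -- `θ`; `κ + 1` leaves room for the sampling error.
  have hdiff : ∀ᶠ x in whp P, ∀ θ ∈ Metric.ball θ₀ r₀,
      ‖empMean O x.1 x.2 (fun a => fderiv ℝ (fun t => s t a) θ) - empMean O x.1 x.2 G‖
        ≤ (κ + 1) * ‖θ - θ₀‖ := by
    filter_upwards [hO.whp_ae hs, hflim.eventually_lt_const (lt_add_one κ)] with x h1 h2 θ hθ
    rw [← empMean_sub]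
    refine (norm_empMean_le _).trans ((empMean_mono (g := fun a => ‖f a‖ * ‖θ - θ₀‖)
      fun i => ((h1 i θ hθ).2.trans ?_)).trans ?_)
    · gcongr
      exact Real.le_norm_self _
    · have h3 : empMean O x.1 x.2 (fun a => ‖f a‖ * ‖θ - θ₀‖)
          = empMean O x.1 x.2 (fun a => ‖f a‖) * ‖θ - θ₀‖ := by
        simp only [empMean, smul_eq_mul, ← Finset.sum_mul, mul_assoc]
      rw [h3]
      gcongr
  set H : ℕ × Ω → Vec d → Vec d := fun x t => empMean O x.1 x.2 (s t) with hH
  have hloc : ∀ ε : NNReal, 0 < ε → ∃ r > 0, ∀ᶠ x in whp P,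
      ApproximatesLinearOn (H x) (-I) (Metric.closedBall θ₀ r) ε := by
    intro ε hε
    have hε' : (0 : ℝ) < ε := hε
    set r := min (r₀ / 2) (ε / (2 * (κ + 1))) with hr
    have hr0 : 0 < r := by positivity
    refine ⟨r, hr0, ?_⟩
    filter_upwards [hO.whp_ae hs, hdiff,
      hGlim (Metric.ball_mem_nhds (-I) (half_pos hε'))] with x h1 h2 h3
    have hsub : ∀ t ∈ Metric.closedBall θ₀ r, t ∈ Metric.ball θ₀ r₀ := fun t ht =>
      (Metric.mem_closedBall.1 ht).trans_lt ((min_le_left _ _).trans_lt (half_lt_self hr₀))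
    refine approximatesLinearOn_of_hasFDerivAt (convex_closedBall _ _)
      (f' := fun t => empMean O x.1 x.2 fun a => fderiv ℝ (fun t => s t a) t)
      (fun t ht => hasFDerivAt_empMean (u := s) fun i => (h1 i t (hsub t ht)).1.hasFDerivAt)
      (fun t ht => ?_)
    have h4 := h2 t (hsub t ht)
    have h5 : ‖empMean O x.1 x.2 G - -I‖ < ε / 2 := by
      rw [← dist_eq_norm]
      exact h3
    have h6 : (κ + 1) * ‖t - θ₀‖ ≤ ε / 2 := by
      have : ‖t - θ₀‖ ≤ ε / (2 * (κ + 1)) := by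
        rw [← dist_eq_norm]
        exact (Metric.mem_closedBall.1 ht).trans (min_le_right _ _)
      calc (κ + 1) * ‖t - θ₀‖ ≤ (κ + 1) * (ε / (2 * (κ + 1))) := by gcongr
        _ = ε / 2 := by field_simp
    have h7 := norm_sub_le_norm_sub_add_norm_sub
      (empMean O x.1 x.2 fun a => fderiv ℝ (fun t => s t a) t) (empMean O x.1 x.2 G) (-I)
    linarith
  have hbdd : BddInProb P fun x : ℕ × Ω => Real.sqrt x.1 • H x θ₀ := by
    simpa only [hH, empMean, sqrt_mul_inv_smul] using hO.bddInProb hψ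
  obtain ⟨ρ, hρ, huniq, hroot⟩ := exists_radius_root hI hloc hbdd
  refine ⟨ρ, hρ, uniqueLocalRoot_of_whp huniq, fun T hT => ?_⟩
  have hlin : AsympLinear P O θ₀ (fun a => I.inverse (s θ₀ a)) T := by
    refine (tendstoInMeasure_iff_whp (X := fun (n : ℕ) ω => Real.sqrt n • (T n ω - θ₀)
      - (Real.sqrt n)⁻¹ • ∑ i ∈ Finset.range n, I.inverse (s θ₀ (O i ω)))).2 ?_
    refine (hroot (fun x => T x.1 x.2) hT.whp).congr fun x => ?_
    simp only [hH, empMean, sqrt_mul_inv_smul, map_smul, map_sum]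
  have hψ' := hψ.clm_apply I.inverse
  have hTc := hlin.consistent hO hψ'
  refine ⟨hlin, ?_⟩
  have hinfo : Tendsto (fun x : ℕ × Ω => empMean O x.1 x.2 fun a =>
      -fderiv ℝ (fun t => s t a) (T x.1 x.2)) (whp P) (𝓝 I) := by
    have h1 : Tendsto (fun x : ℕ × Ω => empMean O x.1 x.2
        (fun a => fderiv ℝ (fun t => s t a) (T x.1 x.2)) - empMean O x.1 x.2 G) (whp P)
        (𝓝 0) := by
      have h2 : Tendsto (fun x : ℕ × Ω => (κ + 1) * ‖T x.1 x.2 - θ₀‖) (whp P) (𝓝 0) := by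
        simpa using (hTc.sub_const θ₀).norm.const_mul (κ + 1)
      refine squeeze_zero_norm' ?_ h2
      filter_upwards [hdiff, hTc (Metric.ball_mem_nhds θ₀ hr₀)] with x h3 h4
      exact h3 _ h4
    have h2 := (h1.add hGlim).neg
    rw [zero_add, neg_neg] at h2
    refine h2.congr fun x => ?_
    rw [sub_add_cancel, ← empMean_neg]
  -- An envelope for the derivative of the score. It is merely integrable, which suffices for small
  -- tails and hence for the plug-in estimate.
  have hDi : Integrable (fun a => ‖G a‖ + ‖f a‖ * r₀) Q := hi.norm.add (hf.norm.mul_const r₀)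
  obtain ⟨D, hDm, hD⟩ := hDi.aestronglyMeasurable.aemeasurable
  have htail : SmallTail Q fun a => ‖D a‖ := SmallTail.of_integrable hDm.norm
    (fun _ => norm_nonneg _) (hDi.congr hD).norm
  refine EmpL2.clm_apply hO ?_ hψ.2.1 (tendsto_inverse hI hinfo)
  refine EmpL2.of_envelope hO hr₀ (htail.tendsto_empMean_sq hO) (hs.mono fun a ha θ hθ =>
    (ha θ hθ).1) ?_ (hlin.bddInProb hO hψ')
  filter_upwards [hs, hD] with a ha hDa θ hθ
  rw [← hDa, Real.norm_of_nonneg (by positivity)]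
  have h1 := (ha θ hθ).2
  have h2 : f a * ‖θ - θ₀‖ ≤ ‖f a‖ * r₀ := by
    refine mul_le_mul (Real.le_norm_self _) ?_ (norm_nonneg _) (norm_nonneg _)
    rw [← dist_eq_norm]
    exact (Metric.mem_ball.1 hθ).le
  have h3 := norm_sub_norm_le (fderiv ℝ (fun t => s t a) θ) (G a)
  linarith

end MLE

end

end TwoStage

namespace TwoStage

noncomputable section

/-! ### Maximum likelihood in Gaussian mixtures. -/

namespace MixtureParam

variable {c q h r d : ℕ}

lemma Valid.isProbabilityMeasure_lawXZ {M : MixtureParam c q h r} (hM : M.Valid)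
    (PZ : Measure (Vec r)) [IsProbabilityMeasure PZ] :
    IsProbabilityMeasure (M.toStage1.lawXZ PZ) := by
  have := hM.toStage1.isProbabilityMeasure_law (PZ := PZ)
  exact Measure.isProbabilityMeasure_map measurable_snd.aemeasurable

lemma Valid.lintegral_density {M : MixtureParam c q h r} (hM : M.Valid) (PZ : Measure (Vec r))
    [IsProbabilityMeasure PZ] :
    ∫⁻ w, ENNReal.ofReal (M.density w) ∂((volume : Measure (Vec h)).prod PZ) = 1 := by
  have := hM.isProbabilityMeasure_lawXZ PZ
  have h1 : M.toStage1.lawXZ PZ Set.univ = 1 := measure_univ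
  rwa [hM.lawXZ_eq PZ, withDensity_apply _ MeasurableSet.univ, Measure.restrict_univ] at h1

set_option maxSynthPendingDepth 3 in
/-- A regular mixture model is a regular family of densities. -/
lemma Regular.exists_regularDensity {mix : Vec d → MixtureParam c q h r} {PZ : Measure (Vec r)}
    [IsProbabilityMeasure PZ] {θ₀ : Vec d} (hreg : Regular mix PZ θ₀) :
    (mix θ₀).Valid ∧ ∃ ρ f₁ f₂ f₃, RegularDensity ((volume : Measure (Vec h)).prod PZ)
      (fun θ => (mix θ).density) θ₀ ρ f₁ f₂ f₃ := by
  obtain ⟨⟨N, hN, hmem, hval, f₁, f₂, f₃, hf₁, hf₂, hf₃, hae⟩, -, -⟩ := hreg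
  obtain ⟨ρ, hρ, hsub⟩ := Metric.isOpen_iff.1 hN θ₀ hmem
  refine ⟨hval _ hmem, ρ, f₁, f₂, f₃, hρ, fun θ _ => (mix θ).continuous_density.measurable,
    fun θ hθ => (hval θ (hsub hθ)).density_pos, fun θ hθ => ?_, fun θ hθ => ?_, hf₁, hf₂, ?_, ?_,
    ?_, ?_, ?_⟩
  · refine ⟨(mix θ).continuous_density.measurable.aestronglyMeasurable, ?_⟩
    rw [hasFiniteIntegral_iff_ofReal
      (ae_of_all _ fun w => ((hval θ (hsub hθ)).density_pos w).le),
      (hval θ (hsub hθ)).lintegral_density PZ]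
    exact ENNReal.one_lt_top
  · rw [integral_eq_lintegral_of_nonneg_ae
      (ae_of_all _ fun w => ((hval θ (hsub hθ)).density_pos w).le)
      (mix θ).continuous_density.measurable.aestronglyMeasurable,
      (hval θ (hsub hθ)).lintegral_density PZ, ENNReal.toReal_one]
  · rwa [← (hval _ hmem).lawXZ_eq PZ]
  · filter_upwards [hae] with w hw θ hθ
    exact hw.1.contDiffAt (hN.mem_nhds (hsub hθ))
  · filter_upwards [hae] with w hw θ hθ
    rw [← norm_iteratedFDeriv_one]
    exact (hw.2 θ (hsub hθ)).1
  · filter_upwards [hae] with w hw θ hθ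
    rw [← norm_iteratedFDeriv_one, norm_iteratedFDeriv_fderiv]
    exact (hw.2 θ (hsub hθ)).2.1
  · filter_upwards [hae] with w hw θ hθ
    rw [← norm_iteratedFDeriv_one, norm_iteratedFDeriv_fderiv, norm_iteratedFDeriv_fderiv]
    exact (hw.2 θ (hsub hθ)).2.2

/-- Maximum likelihood estimation in regular Gaussian mixtures. -/
theorem Regular.exists_radius_mle {Ω : Type*} [MeasurableSpace Ω] {P : Measure Ω}
    [IsProbabilityMeasure P] {mix : Vec d → MixtureParam c q h r} {PZ : Measure (Vec r)}
    [IsProbabilityMeasure PZ] {θ₀ : Vec d} (hreg : Regular mix PZ θ₀)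
    {XZ : ℕ → Ω → Vec h × Vec r} (hO : IsSample P XZ ((mix θ₀).toStage1.lawXZ PZ)) :
    IsInfluence ((mix θ₀).toStage1.lawXZ PZ) (mleIF mix PZ θ₀) ∧
    ∃ ρ > 0, UniqueLocalRoot P XZ (fun _ _ => score1 mix) θ₀ ρ ∧
      ∀ T : ℕ → Ω → Vec d, IsLocalRoot P XZ (fun _ _ => score1 mix) θ₀ ρ T →
        AsympLinear P XZ θ₀ (mleIF mix PZ θ₀) T ∧
        EmpL2 P XZ (fun x => mleIFhat mix XZ (T x.1 x.2) x.1 x.2) (mleIF mix PZ θ₀) := by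
  have hQ := hO.isProbabilityMeasure
  obtain ⟨hval, ρ, f₁, f₂, f₃, hd⟩ := hreg.exists_regularDensity
  obtain ⟨-, hS2, hpos⟩ := hreg
  have hlaw := hval.lawXZ_eq PZ
  have hS2' := hS2
  rw [hlaw] at hS2'
  have hψ : IsInfluence ((mix θ₀).toStage1.lawXZ PZ) (score1 mix θ₀) := by
    refine ⟨hS2.1.aemeasurable, hS2, ?_⟩
    rw [hlaw]
    exact hd.integral_score
  -- The information identity makes the expected derivative of the score the negative Fisher
  -- information, whose positivity then gives invertibility.
  obtain ⟨hi, hint⟩ := hd.integral_fderiv_score hS2'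
  rw [← hlaw] at hi hint
  have hI := isInvertible_of_pos hpos
  have hlip := RegularDensity.ae_law (p := fun θ => (mix θ).density) (θ₀ := θ₀) hd.score_lipschitz
  rw [← hlaw] at hlip
  have hf₃ := hd.integrable₃
  rw [← hlaw] at hf₃
  exact ⟨hψ.clm_apply _, exists_radius_score hO (s := score1 mix) hd.radius_pos hf₃ hψ hlip hi hI
    hint⟩

end MixtureParam

section Sample

variable {m p l r q h : ℕ} {M : Stage1Model q h r} {PZ : Measure (Vec r)} [IsProbabilityMeasure PZ]
  {φ : Vec q → Vec l} {S : Stage2Param m p l r} {lawζ : Measure (Vec p)}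
  [IsProbabilityMeasure lawζ] {lawε : Measure (Vec m)} [IsProbabilityMeasure lawε]

/-- Identifies the law under which stage-1 influence functions are centred with the marginal of the
observation law. -/
lemma map_snd_obsLaw (hM : M.Valid) (hφ : Measurable φ) :
    (obsLaw M PZ φ S lawζ lawε).map Prod.snd = M.lawXZ PZ := by
  have := hM.isProbabilityMeasure_law (PZ := PZ)
  rw [obsLaw, Measure.map_map measurable_snd (measurable_observation hφ S), Stage1Model.lawXZ]
  have h1 : (Prod.snd ∘ fun w : (Vec q × Vec h × Vec r) × Vec p × Vec m =>
      ((S.indicator w.1.2.2 (S.latent w.1.2.2 (φ w.1.1) w.2.1) w.2.2, w.1.2.1, w.1.2.2) :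
        Obs m h r)) = Prod.snd ∘ Prod.fst := rfl
  rw [h1, ← Measure.map_map measurable_snd measurable_fst, measurePreserving_fst.map_eq]

end Sample

end

end TwoStage
-- General stage-1 estimators and mixture maximum likelihood combined with stage 2.
theorem mainTheorem4
    {m p l r q h p₁ p₂ : ℕ}
    {Ω : Type*} [MeasurableSpace Ω] (P : Measure Ω) [IsProbabilityMeasure P]
    -- the non-linear structural equation model
    (PZ : Measure (Vec r)) [IsProbabilityMeasure PZ] (hZ : MemLp id 2 PZ)
    (φ : Vec q → Vec l) (hφ : Measurable φ)
    (M : Vec p₁ → Stage1Model q h r) (θ₀₁ : Vec p₁)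
    (hM : ∀ᶠ t in 𝓝 θ₀₁, (M t).Valid)
    (hφ2 : MemLp (fun w => φ w.1) 2 ((M θ₀₁).law PZ))
    (S : Stage2Param m p l r)
    (lawζ : Measure (Vec p)) [IsProbabilityMeasure lawζ] (hζ : IsResidualLaw lawζ S.Ψ)
    (lawε : Measure (Vec m)) [IsProbabilityMeasure lawε] (hε : IsResidualLaw lawε S.Ω)
    -- i.i.d. observations `(Y, X, Z)` from the model
    (O : ℕ → Ω → Obs m h r) (hOmeas : ∀ i, Measurable (O i)) (hOind : iIndepFun O P)
    (hOlaw : ∀ i, P.map (O i) = obsLaw (M θ₀₁) PZ φ S lawζ lawε)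
    -- predictions of `φ(ξ)` under the stage-1 model
    (φs : Vec p₁ → Vec h × Vec r → Vec l)
    (hφs : ∀ᶠ t in 𝓝 θ₀₁, (M t).IsPrediction PZ φ (φs t))
    -- parametrisation of the stage-2 model and its limiting parameter
    (par : Vec p₂ → Stage2Param m p l r) (θ₀₂ : Vec p₂)
    (hpar : ∀ᶠ t in 𝓝 θ₀₂, Stage2Param.DiffAt par t)
    (hlim : par θ₀₂ = { S with
      Ψ := S.Ψ + S.B * (M θ₀₁).predVar PZ φ (φs θ₀₁) * S.Bᵀ })
    (hvar : (par θ₀₂).varY.PosDef)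
    -- regularity conditions on the stage-2 score
    (hU2 : MemLp (score par φs θ₀₁ θ₀₂) 2 (obsLaw (M θ₀₁) PZ φ S lawζ lawε))
    (hreg : ScoreRegular P O (score par φs) (obsLaw (M θ₀₁) PZ φ S lawζ lawε) θ₀₁ θ₀₂)
    (hpos : ∀ v, v ≠ 0 →
      0 < ⟪v, sens (score par φs) (obsLaw (M θ₀₁) PZ φ S lawζ lawε) θ₀₁ θ₀₂ v⟫) :
    -- an arbitrary asymptotically linear stage-1 estimator `T₁`
    (∀ (T₁ : ℕ → Ω → Vec p₁) (IF1 : Vec h × Vec r → Vec p₁),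
      (∀ n, AEMeasurable (T₁ n) P) →
      IsInfluence ((M θ₀₁).lawXZ PZ) IF1 →
      AsympLinear P (fun i ω => (O i ω).2) θ₀₁ IF1 T₁ →
      ∃ ρ > 0,
        UniqueLocalRoot P O (fun n ω => score par φs (T₁ n ω)) θ₀₂ ρ ∧
        ∀ T₂ : ℕ → Ω → Vec p₂,
          IsLocalRoot P O (fun n ω => score par φs (T₁ n ω)) θ₀₂ ρ T₂ →
          HasInfluence P O (obsLaw (M θ₀₁) PZ φ S lawζ lawε) θ₀₂
            (IF3 (score par φs) (obsLaw (M θ₀₁) PZ φ S lawζ lawε) IF1 θ₀₁ θ₀₂) T₂ ∧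
          ∀ IF1fam : Vec p₁ → Vec h × Vec r → Vec p₁, IF1fam θ₀₁ = IF1 →
            LocallyRegular ((M θ₀₁).lawXZ PZ) θ₀₁ IF1fam →
            VarianceConsistent P O (score par φs) (obsLaw (M θ₀₁) PZ φ S lawζ lawε) θ₀₁ θ₀₂
              IF1 (fun n ω => IF1fam (T₁ n ω)) T₁ T₂) ∧
    -- maximum likelihood in a Gaussian mixture stage-1 model with `c` classes
    (∀ (c : ℕ) (mix : Vec p₁ → MixtureParam c q h r),
      (∀ᶠ t in 𝓝 θ₀₁, M t = (mix t).toStage1) →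
      MixtureParam.Regular mix PZ θ₀₁ →
      ∃ ρ₁ > 0,
        UniqueLocalRoot P (fun i ω => (O i ω).2) (fun _ _ => MixtureParam.score1 mix) θ₀₁ ρ₁ ∧
        ∀ T₁ : ℕ → Ω → Vec p₁, (∀ n, AEMeasurable (T₁ n) P) →
          IsLocalRoot P (fun i ω => (O i ω).2) (fun _ _ => MixtureParam.score1 mix)
            θ₀₁ ρ₁ T₁ →
          HasInfluence P (fun i ω => (O i ω).2) ((M θ₀₁).lawXZ PZ) θ₀₁
            (MixtureParam.mleIF mix PZ θ₀₁) T₁ ∧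
          ∃ ρ > 0,
            UniqueLocalRoot P O (fun n ω => score par φs (T₁ n ω)) θ₀₂ ρ ∧
            ∀ T₂ : ℕ → Ω → Vec p₂,
              IsLocalRoot P O (fun n ω => score par φs (T₁ n ω)) θ₀₂ ρ T₂ →
              HasInfluence P O (obsLaw (M θ₀₁) PZ φ S lawζ lawε) θ₀₂
                (IF3 (score par φs) (obsLaw (M θ₀₁) PZ φ S lawζ lawε)
                  (MixtureParam.mleIF mix PZ θ₀₁) θ₀₁ θ₀₂) T₂ ∧
              VarianceConsistent P O (score par φs) (obsLaw (M θ₀₁) PZ φ S lawζ lawε) θ₀₁ θ₀₂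
                (MixtureParam.mleIF mix PZ θ₀₁)
                (fun n ω => MixtureParam.mleIFhat mix (fun i ω' => (O i ω').2) (T₁ n ω) n ω)
                T₁ T₂) := by
  have hMv : (M θ₀₁).Valid := hM.self_of_nhds
  have hO : IsSample P O (obsLaw (M θ₀₁) PZ φ S lawζ lawε) := ⟨hOmeas, hOind, hOlaw⟩
  have hmap := map_snd_obsLaw (S := S) (lawζ := lawζ) (lawε := lawε) (PZ := PZ) hMv hφ
  have hOXZ : IsSample P (fun i ω => (O i ω).2) ((M θ₀₁).lawXZ PZ) := by
    rw [← hmap]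
    exact hO.comp measurable_snd
  have hQ := hO.isProbabilityMeasure
  obtain ⟨N, hN, hmem⟩ := hreg.exists_uniformDeriv
  have hA := isInvertible_of_pos hpos
  -- Centring of the score is proved from the model.
  have hU0 : ∫ o, score par φs θ₀₁ θ₀₂ o ∂(obsLaw (M θ₀₁) PZ φ S lawζ lawε) = 0 :=
    integral_score2_eq_zero hMv hZ hφ hφ2 hφs.self_of_nhds hζ hε hpar.self_of_nhds hlim hvar
      (hU2.integrable one_le_two)
  refine ⟨fun T₁ IF1 _ hIF hT₁ => ?_, fun c mix hmix hmixreg => ?_⟩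
  · obtain ⟨ρ, hρ, huniq, hroot⟩ := exists_radius_twoStage hO hN hmem hU2 hU0 hA
      (by rwa [hmap]) hT₁
    refine ⟨ρ, hρ, huniq, fun T₂ hT₂ => ⟨(hroot T₂ hT₂).1, fun IF1fam hfam hregfam => ?_⟩⟩
    subst hfam
    exact (hroot T₂ hT₂).2 _ (hregfam.empL2 hOXZ (hT₁.consistent hOXZ hIF))
  -- Agreement of the two models at `θ₀₁` identifies the sampling law; the likelihood itself is that
  -- of `mix` near `θ₀₁`.
  · have hMmix : (M θ₀₁).lawXZ PZ = (mix θ₀₁).toStage1.lawXZ PZ := by rw [hmix.self_of_nhds]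
    obtain ⟨hIF, ρ₁, hρ₁, huniq₁, hroot₁⟩ := hmixreg.exists_radius_mle (hMmix ▸ hOXZ)
    rw [← hMmix] at hIF
    refine ⟨ρ₁, hρ₁, huniq₁, fun T₁ _ hT₁ => ?_⟩
    obtain ⟨hlin, hhat⟩ := hroot₁ T₁ hT₁
    refine ⟨hlin.hasInfluence hOXZ hIF, ?_⟩
    obtain ⟨ρ, hρ, huniq, hroot⟩ := exists_radius_twoStage hO hN hmem hU2 hU0 hA
      (by rwa [hmap]) hlin
    exact ⟨ρ, hρ, huniq, fun T₂ hT₂ => ⟨(hroot T₂ hT₂).1, (hroot T₂ hT₂).2 _ hhat⟩⟩
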